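/- Let $F$ be a closed smooth manifold of dimension $n\ge 0$ and let $J_F$ be a smooth almost complex structure on $T^*F$ for which the zero section $F\subset T^*F$ is totally real. For a function $g$ on an almost complex manifold put $d^Jg:=-dg\circ J$; $g$ is $J$-plurisubharmonic at a point if $dd^Jg(v,Jv)>0$ for all tangent vectors $v\neq 0$ there. Let $f_F\colon T^*F\to[0,\infty)$ be a smooth function with $f_F^{-1}(0)=F$ that is $J_F$-plurisubharmonic on a neighbourhood of $F$ and for which $\{f_F\le c\}$ is compact for some $c>0$. On $$\mathbb{C}\times T^*\mathbb{S}^1\times T^*F=\{(x+iy;\varphi,r;\mathbf q,\mathbf p)\}$$ consider the almost complex structure $J=i\oplus i\oplus J_F$, where $T^*\mathbb{S}^1=\mathbb{C}/2\pi\mathbb{Z}$ with complex coordinate $\varphi+ir$, and the function $f=\tfrac12(x^2+y^2)+\tfrac12r^2+f_F$. Let $0<\varepsilon\le 1$, let $N_{\mathrm{mod}}$ be the image of $$\mathbb{S}^1\times[0,\varepsilon)\times F\to f^{-1}(1/2),\qquad(\varphi,r;\mathbf q)\mapsto(\sqrt{1-r^2};\varphi,r;\mathbf q,\mathbf 0),$$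 and for $\delta>0$ let $U_{\mathrm{mod}}=\{x\ge 1-\delta\}\cap f^{-1}([0,1/2])$. Below, $(\Sigma,j)$ is a connected compact Riemann surface with possibly empty boundary, and a $J$-holomorphic map $u$ on $\Sigma$ is a map that is smooth in the interior and $C^1$ up to the boundary and satisfies $Du\circ j=J\circ Du$. Then there is $\delta_0>0$, depending only on $F$, $J_F$, $f_F$, $\varepsilon$, such that for every $0<\delta<\delta_0$ the following hold. 1. Every $J$-holomorphic map $u\colon(\Sigma,j)\to U_{\mathrm{mod}}$ with $u(\partial\Sigma)\subset N_{\mathrm{mod}}$ is constant. 2. Let $(W,J)$ be a compact almost complex manifold of dimension $2n+4$ with boundary $M=\partial W$ that is $J$-convex, that is, there is a smooth $h\colon W\to(-\infty,0]$ with $h^{-1}(0)=\partial W$ that has no critical point on $\partial W$ and is $J$-plurisubharmonic near $\partial W$. Let $N\subset M$ be an embedded $(n+2)$-dimensional submanifold, possibly with boundary, and let $U\subset W$ be a compact subset identified with $U_{\mathrm{mod}}$ by a smooth embedding of an open neighbourhood of $U$ in $W$ into $\mathbb{C}\times T^*\mathbb{S}^1\times T^*F$, such that the points of $U$ with $x>1-\delta$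 form an open subset of $W$, and such that $M\cap U$, $N\cap U$ and $J|_U$ correspond to $f^{-1}(1/2)\cap U_{\mathrm{mod}}$, $N_{\mathrm{mod}}\cap U_{\mathrm{mod}}$ and the model structure on $U_{\mathrm{mod}}$. Then every $J$-holomorphic map $u\colon(\Sigma,j)\to(W,J)$ with $u(\partial\Sigma)\subset N$ whose image meets $U$ is constant. -/

import Mathlib

open Set Topology
open scoped Manifold ContDiff

noncomputable section

namespace CodimOneModel

universe u v w

/-! ### Almost complex structures and plurisubharmonic functions -/

section AlmostComplex

variable {E : Type*} [NormedAddCommGroup E] [NormedSpace ℝ E]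
  {H : Type*} [TopologicalSpace H] (I : ModelWithCorners ℝ E H)
  {X : Type*} [TopologicalSpace X] [ChartedSpace H X]

/-- A field of (continuous linear) endomorphisms of the tangent spaces of `X`. -/
abbrev EndField : Type _ := ∀ p : X, TangentSpace I p →L[ℝ] TangentSpace I p

variable {I}

/-- A smooth almost complex structure: a smooth section `J` of the endomorphism bundle of the
tangent bundle with `J² = -1`. -/
structure IsAlmostComplex [IsManifold I 1 X] (J : EndField I (X := X)) : Prop where
  contMDiff : ContMDiff I (I.prod 𝓘(ℝ, E →L[ℝ] E)) ∞
    (fun p => Bundle.TotalSpace.mk' (E →L[ℝ] E)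
      (E := fun p : X => TangentSpace I p →L[ℝ] TangentSpace I p) p (J p))
  sq_eq_neg : ∀ (p : X) (v : TangentSpace I p), J p (J p v) = -v

/-- The 1-form `d^J f = - df ∘ J`, written in the coordinates of the preferred chart at `p`. -/
def dcInChart [IsManifold I 1 X] (J : EndField I (X := X)) (f : X → ℝ) (p : X) (y : E) :
    E →L[ℝ] ℝ :=
  -(fderivWithin ℝ (f ∘ (extChartAt I p).symm) (range I) y).comp
    (inTangentCoordinates I I id id (fun q : X => (J q : E →L[ℝ] E)) p
      ((extChartAt I p).symm y))

/-- The value at `p` of the 2-form `dd^J f` on two tangent vectors, computed in the preferred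
chart at `p` (the chart through which `TangentSpace I p` is identified with `E`) by
`dθ(v, w) = ∂_v θ(w) - ∂_w θ(v)`. -/
def ddc [IsManifold I 1 X] (J : EndField I (X := X)) (f : X → ℝ) (p : X)
    (v w : TangentSpace I p) : ℝ :=
  (fderivWithin ℝ (dcInChart J f p) (range I) (extChartAt I p p) (v : E)) (w : E) -
    (fderivWithin ℝ (dcInChart J f p) (range I) (extChartAt I p p) (w : E)) (v : E)

/-- `f` is (strictly) `J`-plurisubharmonic at `p`: `dd^J f (v, J v) > 0` for all tangent vectors
`v ≠ 0` at `p`. -/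
def IsPlurisubharmonicAt [IsManifold I 1 X] (J : EndField I (X := X)) (f : X → ℝ) (p : X) : Prop :=
  ∀ v : TangentSpace I p, v ≠ 0 → 0 < ddc J f p v (J p v)

/-- `X` has `J`-convex boundary: there is a smooth function `h ≤ 0` with `h⁻¹(0) = ∂X` that has no
critical point on `∂X` and is `J`-plurisubharmonic on a neighbourhood of `∂X`. -/
def HasConvexBoundary [IsManifold I 1 X] (J : EndField I (X := X)) : Prop :=
  ∃ h : X → ℝ, ContMDiff I 𝓘(ℝ, ℝ) ∞ h ∧ (∀ p, h p ≤ 0) ∧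
    (∀ p, h p = 0 ↔ p ∈ I.boundary X) ∧
    (∀ p ∈ I.boundary X, mfderiv I 𝓘(ℝ, ℝ) h p ≠ 0) ∧
    ∃ O : Set X, IsOpen O ∧ I.boundary X ⊆ O ∧ ∀ p ∈ O, IsPlurisubharmonicAt J h p

end AlmostComplex

/-! ### Riemann surfaces with boundary -/

/-- The closed upper half-plane `{Im z ≥ 0}`. -/
abbrev ClosedHalfPlane : Type := {z : ℂ // 0 ≤ z.im}

/-- The inclusion of the closed half-plane into `ℂ`, as a partial equivalence. -/
def halfPlaneEquiv : PartialEquiv ClosedHalfPlane ℂ where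
  toFun := Subtype.val
  invFun z := ⟨⟨z.re, max z.im 0⟩, le_max_right z.im 0⟩
  source := univ
  target := {z | 0 ≤ z.im}
  map_source' z _ := z.2
  map_target' _ _ := mem_univ _
  left_inv' z _ := Subtype.ext (Complex.ext rfl (max_eq_left z.2))
  right_inv' _ hz := Complex.ext rfl (max_eq_left hz)

theorem range_halfPlaneEquiv : range halfPlaneEquiv = {z : ℂ | 0 ≤ z.im} := by
  ext z
  exact ⟨fun ⟨w, hw⟩ => hw ▸ w.2, fun hz => ⟨⟨z, hz⟩, rfl⟩⟩

theorem convex_halfPlane : Convex ℝ {z : ℂ | 0 ≤ z.im} := by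
  intro a ha b hb s t hs ht _
  simp only [mem_ofPred_eq, Complex.add_im, Complex.real_smul, Complex.im_ofReal_mul] at *
  positivity

theorem nonempty_interior_halfPlane : (interior {z : ℂ | 0 ≤ z.im}).Nonempty := by
  refine ⟨Complex.I, mem_interior.2 ⟨{z : ℂ | 0 < z.im}, fun z (hz : 0 < z.im) => hz.le, ?_, by simp⟩⟩
  exact isOpen_lt continuous_const Complex.continuous_im

theorem continuous_halfPlaneEquiv_symm : Continuous halfPlaneEquiv.invFun := by
  refine Continuous.subtype_mk ?_ _
  have : (fun z : ℂ => (⟨z.re, max z.im 0⟩ : ℂ)) =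
      fun z : ℂ => ((z.re : ℝ) : ℂ) + ((max z.im 0 : ℝ) : ℂ) * Complex.I := by
    funext z
    apply Complex.ext <;> simp
  rw [this]
  fun_prop

/-- The closed half-plane as a complex model with corners. A space charted on it that is an
`IsManifold` for this model is a Riemann surface with (possibly empty) boundary: its transition
maps are holomorphic, smoothly up to the boundary. -/
def complexHalfPlane : ModelWithCorners ℂ ℂ ClosedHalfPlane where
  toPartialEquiv := halfPlaneEquiv
  source_eq := rfl
  convex_range' := by
    rw [range_halfPlaneEquiv]
    simp only [instIsRCLikeNormedField, ↓reduceDIte]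
    exact Convex.convex_isRCLikeNormedField (𝕜 := ℂ) convex_halfPlane
  nonempty_interior' := by
    rw [range_halfPlaneEquiv]
    exact nonempty_interior_halfPlane
  continuous_toFun := continuous_subtype_val
  continuous_invFun := continuous_halfPlaneEquiv_symm

/-- The closed half-plane as a real model with corners, describing the underlying smooth surface
with boundary. -/
def realHalfPlane : ModelWithCorners ℝ ℂ ClosedHalfPlane where
  toPartialEquiv := halfPlaneEquiv
  source_eq := rfl
  convex_range' := by
    rw [range_halfPlaneEquiv]
    simp only [instIsRCLikeNormedField, ↓reduceDIte]
    exact Convex.convex_isRCLikeNormedField (𝕜 := ℝ) convex_halfPlane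
  nonempty_interior' := by
    rw [range_halfPlaneEquiv]
    exact nonempty_interior_halfPlane
  continuous_toFun := continuous_subtype_val
  continuous_invFun := continuous_halfPlaneEquiv_symm

/-- The complex structure `j` of a Riemann surface: multiplication by `i` in the preferred complex
chart at the point (it does not depend on the complex chart). -/
def surfaceJ {S : Type*} [TopologicalSpace S] [ChartedSpace ClosedHalfPlane S] :
    EndField realHalfPlane (X := S) :=
  fun _ => (ContinuousLinearMap.mul ℝ ℂ Complex.I : ℂ →L[ℝ] ℂ)

/-- `u : S → X` is a `J`-holomorphic map from a Riemann surface with boundary: it is smooth in the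
interior, `C¹` up to the boundary, and `Du ∘ j = J ∘ Du`. -/
structure IsJHolomorphic {E : Type*} [NormedAddCommGroup E] [NormedSpace ℝ E]
    {H : Type*} [TopologicalSpace H] {I : ModelWithCorners ℝ E H}
    {X : Type*} [TopologicalSpace X] [ChartedSpace H X] (J : EndField I (X := X))
    {S : Type*} [TopologicalSpace S] [ChartedSpace ClosedHalfPlane S] (u : S → X) : Prop where
  contMDiff_one : ContMDiff realHalfPlane I 1 u
  contMDiffOn_interior : ContMDiffOn realHalfPlane I ∞ u (realHalfPlane.interior S)
  holomorphic : ∀ (z : S) (v : TangentSpace realHalfPlane z),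
    mfderiv realHalfPlane I u z (surfaceJ z v) = J (u z) (mfderiv realHalfPlane I u z v)

/-! ### The local model -/

section Model

variable {n : ℕ} {F : Type*} [TopologicalSpace F] [ChartedSpace (EuclideanSpace ℝ (Fin n)) F]
  [IsManifold (𝓡 n) ∞ F]

variable (n) in
/-- The model vector space of the fibres of `T^*F`. -/
abbrev CotFiber : Type := EuclideanSpace ℝ (Fin n) →L[ℝ] ℝ

variable (n F) in
/-- The cotangent bundle `T^*F`. -/
abbrev Cotangent : Type _ :=
  Bundle.TotalSpace (CotFiber n)
    (fun q : F => TangentSpace (𝓡 n) q →L[ℝ] Bundle.Trivial F ℝ q)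

variable (n) in
/-- The model with corners of `T^*F`. -/
abbrev cotI : ModelWithCorners ℝ (EuclideanSpace ℝ (Fin n) × CotFiber n)
    (ModelProd (EuclideanSpace ℝ (Fin n)) (CotFiber n)) :=
  (𝓡 n).prod 𝓘(ℝ, CotFiber n)

variable (n F) in
/-- The zero section `F → T^*F`. -/
def zeroSec (q : F) : Cotangent n F := ⟨q, 0⟩

/-- The zero section of `T^*F` is totally real for `J`: `T F ∩ J (T F) = 0`. -/
def ZeroSectionTotallyReal (JF : EndField (cotI n) (X := Cotangent n F)) : Prop :=
  ∀ (q : F) (v w : TangentSpace (𝓡 n) q),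
    mfderiv (𝓡 n) (cotI n) (zeroSec n F) q v =
      JF (zeroSec n F q) (mfderiv (𝓡 n) (cotI n) (zeroSec n F) q w) →
    mfderiv (𝓡 n) (cotI n) (zeroSec n F) q v = 0

/-- A smooth function `f_F ≥ 0` on `T^*F` that vanishes exactly on the zero section, is
`J_F`-plurisubharmonic near the zero section, and has a compact sublevel set `{f_F ≤ c}` with
`c > 0`. -/
structure IsFiberFunction (JF : EndField (cotI n) (X := Cotangent n F))
    (fF : Cotangent n F → ℝ) : Prop where
  contMDiff : ContMDiff (cotI n) 𝓘(ℝ, ℝ) ∞ fF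
  nonneg : ∀ ξ, 0 ≤ fF ξ
  eq_zero_iff : ∀ ξ, fF ξ = 0 ↔ ξ ∈ range (zeroSec n F)
  plurisubharmonic : ∃ O : Set (Cotangent n F), IsOpen O ∧ range (zeroSec n F) ⊆ O ∧
    ∀ ξ ∈ O, IsPlurisubharmonicAt JF fF ξ
  compact_sublevel : ∃ c > 0, IsCompact {ξ | fF ξ ≤ c}

/-- The unit tangent vector `∂_φ` of the circle at `θ`. -/
def circleTangent (θ : Circle) : TangentSpace (𝓡 1) θ :=
  (mfderiv 𝓘(ℝ, ℝ) (𝓡 1) (fun t : ℝ => Circle.exp t * θ) 0 (1 : ℝ) :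
    EuclideanSpace ℝ (Fin 1))

/-- The angular form `dφ` of the circle, `dφ(v) = Im (conj θ · v)` for `v ∈ T_θ S¹ ⊆ ℂ`. -/
def circleAngle (θ : Circle) : EuclideanSpace ℝ (Fin 1) →L[ℝ] ℝ :=
  Complex.imCLM.comp
    ((ContinuousLinearMap.mul ℝ ℂ (starRingEnd ℂ (θ : ℂ))).comp
      (mfderiv (𝓡 1) 𝓘(ℝ, ℂ) (fun τ : Circle => (τ : ℂ)) θ :
        EuclideanSpace ℝ (Fin 1) →L[ℝ] ℂ))

/-- The complex structure of `T^*S¹ = S¹ × ℝ ∋ (φ, r)` with complex coordinate `φ + i r` modulo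
`2π`: `∂_φ ↦ ∂_r`, `∂_r ↦ -∂_φ`. -/
def cylinderJ : EndField ((𝓡 1).prod 𝓘(ℝ, ℝ)) (X := Circle × ℝ) := fun p =>
  ((-(ContinuousLinearMap.smulRight (ContinuousLinearMap.snd ℝ (EuclideanSpace ℝ (Fin 1)) ℝ)
      (circleTangent p.1 : EuclideanSpace ℝ (Fin 1)))).prod
    ((circleAngle p.1).comp (ContinuousLinearMap.fst ℝ (EuclideanSpace ℝ (Fin 1)) ℝ)) :
    EuclideanSpace ℝ (Fin 1) × ℝ →L[ℝ] EuclideanSpace ℝ (Fin 1) × ℝ)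

variable (n F) in
/-- The manifold `ℂ × T^*S¹ × T^*F` with points `(x + i y; (φ, r); (q, p))`. -/
abbrev ModelSpace : Type _ := ℂ × (Circle × ℝ) × Cotangent n F

variable (n) in
/-- The model vector space of `ℂ × T^*S¹ × T^*F`. -/
abbrev ModelVec : Type :=
  ℂ × (EuclideanSpace ℝ (Fin 1) × ℝ) × (EuclideanSpace ℝ (Fin n) × CotFiber n)

variable (n) in
/-- The model with corners of `ℂ × T^*S¹ × T^*F`. -/
abbrev modelI : ModelWithCorners ℝ (ModelVec n)
    (ModelProd ℂ (ModelProd (ModelProd (EuclideanSpace ℝ (Fin 1)) ℝ)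
      (ModelProd (EuclideanSpace ℝ (Fin n)) (CotFiber n)))) :=
  𝓘(ℝ, ℂ).prod (((𝓡 1).prod 𝓘(ℝ, ℝ)).prod (cotI n))

/-- The almost complex structure `i ⊕ i ⊕ J_F` on `ℂ × T^*S¹ × T^*F`. -/
def modelJ (JF : EndField (cotI n) (X := Cotangent n F)) :
    EndField (modelI n) (X := ModelSpace n F) := fun p =>
  ((ContinuousLinearMap.mul ℝ ℂ Complex.I : ℂ →L[ℝ] ℂ).prodMap
    ((cylinderJ p.2.1 : EuclideanSpace ℝ (Fin 1) × ℝ →L[ℝ] EuclideanSpace ℝ (Fin 1) × ℝ).prodMap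
      (JF p.2.2 : EuclideanSpace ℝ (Fin n) × CotFiber n →L[ℝ]
        EuclideanSpace ℝ (Fin n) × CotFiber n)) : ModelVec n →L[ℝ] ModelVec n)

/-- The function `f = (x² + y²)/2 + r²/2 + f_F`. -/
def modelf (fF : Cotangent n F → ℝ) (p : ModelSpace n F) : ℝ :=
  (p.1.re ^ 2 + p.1.im ^ 2) / 2 + p.2.1.2 ^ 2 / 2 + fF p.2.2

variable (n F) in
/-- The submanifold `N`: the image of `S¹ × [0, ε) × F` under
`(φ, r; q) ↦ (√(1 - r²); φ, r; q, 0)`. -/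
def modelN (ε : ℝ) : Set (ModelSpace n F) :=
  {p | ∃ (θ : Circle) (r : ℝ) (q : F), 0 ≤ r ∧ r < ε ∧
    p = (((Real.sqrt (1 - r ^ 2) : ℝ) : ℂ), (θ, r), zeroSec n F q)}

/-- The model neighbourhood `U = {x ≥ 1 - δ} ∩ f⁻¹([0, 1/2])`. -/
def modelU (fF : Cotangent n F → ℝ) (δ : ℝ) : Set (ModelSpace n F) :=
  {p | 1 - δ ≤ p.1.re ∧ modelf fF p ∈ Icc 0 (1 / 2)}

/-- The subset `U` of the almost complex manifold `(W, J)` with boundary `M = ∂W` is identical to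
the model neighbourhood by means of `c`, such that `M ∩ U`, `N ∩ U` and `J|_U` agree with the
corresponding objects of the model: `c` is a smooth embedding of an open neighbourhood of the
compact set `U` into `ℂ × T^*S¹ × T^*F` that maps `U` onto the model neighbourhood. The points
of `U` with `x > 1 - δ` form an open subset of `W` (so `U` is a neighbourhood in `W` of the boundary
part `{r = 0}` of `N`). -/
structure IsModelNeighborhood (JF : EndField (cotI n) (X := Cotangent n F))
    (fF : Cotangent n F → ℝ) (ε δ : ℝ)
    {E : Type*} [NormedAddCommGroup E] [NormedSpace ℝ E]
    {H : Type*} [TopologicalSpace H] {I : ModelWithCorners ℝ E H}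
    {W : Type*} [TopologicalSpace W] [ChartedSpace H W] (J : EndField I (X := W))
    (N U : Set W) (c : W → ModelSpace n F) : Prop where
  isCompact : IsCompact U
  image_eq : c '' U = modelU fF δ
  smoothEmbedding : ∃ O : Set W, IsOpen O ∧ U ⊆ O ∧ ContMDiffOn I (modelI n) ∞ c O ∧ InjOn c O ∧
    ∀ p ∈ O, Function.Bijective (mfderiv I (modelI n) c p)
  isOpen_inner : IsOpen {p ∈ U | 1 - δ < (c p).1.re}
  boundary_iff : ∀ p ∈ U, p ∈ I.boundary W ↔ modelf fF (c p) = 1 / 2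
  submanifold_iff : ∀ p ∈ U, p ∈ N ↔ c p ∈ modelN n F ε
  structure_eq : ∀ p ∈ U, ∀ v : TangentSpace I p,
    mfderiv I (modelI n) c p (J p v) = modelJ JF (c p) (mfderiv I (modelI n) c p v)

end Model

/-- `ι : N → W` parametrizes an embedded submanifold (with boundary) of `W`: it is a topological
embedding and a smooth immersion. -/
structure IsEmbeddedSubmanifold {E : Type*} [NormedAddCommGroup E] [NormedSpace ℝ E]
    {H : Type*} [TopologicalSpace H] (I : ModelWithCorners ℝ E H)
    {E' : Type*} [NormedAddCommGroup E'] [NormedSpace ℝ E']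
    {H' : Type*} [TopologicalSpace H'] (I' : ModelWithCorners ℝ E' H')
    {N : Type*} [TopologicalSpace N] [ChartedSpace H N]
    {W : Type*} [TopologicalSpace W] [ChartedSpace H' W] (ι : N → W) : Prop where
  isEmbedding : IsEmbedding ι
  contMDiff : ContMDiff I I' ∞ ι
  injective_mfderiv : ∀ p, Function.Injective (mfderiv I I' ι p)

end CodimOneModel

end

/-! Inside the model the three factors of a curve separate. The `T^*F`-component has `f_F ∘ u`
subharmonic and zero on the boundary, so `f_F ∘ u` is constant, and strict plurisubharmonicity makes
the component constant. For the `ℂ`-component, `y = 0` on the boundary, so the nowhere vanishing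
holomorphic function `exp(-i(x + iy))`, of modulus `e^y`, has modulus one there; the maximum
principle for it and its inverse makes it constant. Once `x` is constant, `x = √(1 - r²)` fixes `r`
along the boundary, and the same argument with `e^{i(φ + ir)}`, of modulus `e^{-r}`, finishes the
cylinder component. This is `exists_eq_of_mem_modelU`; it needs `δ` so small that `f_F` is
plurisubharmonic on the region visible from `U`.

In `W` the point is that a curve meeting `U` stays in `U`. If an interior point of the curve hits
`∂W`, then `h ∘ u` has an interior maximum and the curve is constant. Otherwise let `K` be the set
where `x ∘ u` attains its maximum `m` over `u⁻¹(U)`; it is closed, and it remains to prove it open.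

Where `x > 1 - δ`, `U` is open in `W`, and `x` is the real part of a holomorphic function, so `x ∘
u` is harmonic. The delicate case is `m = 1 - δ`: the coordinate map extends smoothly past `U`, but
it need not be holomorphic there. The 2-form `dd^J x` vanishes on the part of `U` with `x > 1 - δ`,
hence on its closure, and it is Lipschitz, so outside it is bounded by the distance to that closure.
By `exists_dist_estimate` this distance is at most a multiple of the negative part of `x - (1 - δ)`.
Thus `v = m - x ∘ u` is nonnegative and satisfies `Δv ≤ C v` near the maximum
(`exists_extD_estimate`), and the strong minimum principle and the Hopf lemma survive the
zeroth-order term (`hopf`).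

At boundary points of the curve the Hopf lemma needs the normal derivative of `x ∘ u` to vanish. By
the Cauchy–Riemann equations this is the vanishing of `dy` on vectors tangent to `N`, which holds
because `T N = T N_mod` at points of `U` (`im_eq_zero_of_mem_range`). So `K` is open and closed, the
curve lies in `U`, and the first part applies. -/

namespace CodimOneModel

/-! ### The Hopf lemma in the plane -/

section Hopf

open Metric Complex

/-- The Laplacian of a function on `ℂ`. -/
noncomputable def lap (v : ℂ → ℝ) (z : ℂ) : ℝ :=
  fderiv ℝ (fderiv ℝ v) z 1 1 + fderiv ℝ (fderiv ℝ v) z I I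

theorem hasDerivAt_line {E : Type*} [NormedAddCommGroup E] [NormedSpace ℝ E] (z a : E) (t : ℝ) :
    HasDerivAt (fun t : ℝ => z + t • a) a t :=
  (((hasDerivAt_id t).smul_const a).const_add z).congr_deriv (one_smul _ _)

theorem eventually_differentiableAt_of_contDiffAt_two {v : ℂ → ℝ} {z : ℂ}
    (h : ContDiffAt ℝ 2 v z) : ∀ᶠ ζ in 𝓝 z, DifferentiableAt ℝ v ζ := by
  filter_upwards [h.eventually (by simp)] with ζ hζ
  exact hζ.differentiableAt (by simp)

theorem differentiableAt_fderiv_of_contDiffAt_two {v : ℂ → ℝ} {z : ℂ}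
    (h : ContDiffAt ℝ 2 v z) : DifferentiableAt ℝ (fderiv ℝ v) z :=
  (h.fderiv_right (m := 1) (by norm_num)).differentiableAt (by simp)

/-- Restrict to the line in direction `a`. A negative second derivative would make the minimum also
a local maximum, so the restriction would be locally constant and its second derivative zero. -/
theorem fderiv_fderiv_nonneg_of_isLocalMin {v : ℂ → ℝ} {z : ℂ} (h : ContDiffAt ℝ 2 v z)
    (hmin : IsLocalMin v z) (a : ℂ) : 0 ≤ fderiv ℝ (fderiv ℝ v) z a a := by
  set l : ℝ → ℂ := fun t => z + t • a with hl
  have hl0 : l 0 = z := by simp [hl]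
  have hld : ∀ t, HasDerivAt l a t := hasDerivAt_line z a
  have hlc : ContinuousAt l 0 := (hld 0).continuousAt
  have hlt : Filter.Tendsto l (𝓝 0) (𝓝 z) := by simpa [ContinuousAt, hl0] using hlc
  have h1 : ∀ᶠ t in 𝓝 (0 : ℝ), deriv (v ∘ l) t = fderiv ℝ v (l t) a := by
    filter_upwards [hlt.eventually (eventually_differentiableAt_of_contDiffAt_two h)] with t ht
    exact (ht.hasFDerivAt.comp_hasDerivAt t (hld t)).deriv
  have h2 : deriv (deriv (v ∘ l)) 0 = fderiv ℝ (fderiv ℝ v) z a a := by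
    rw [Filter.EventuallyEq.deriv_eq h1]
    have h3 : HasFDerivAt (fderiv ℝ v) (fderiv ℝ (fderiv ℝ v) z) (l 0) := by
      rw [hl0]; exact (differentiableAt_fderiv_of_contDiffAt_two h).hasFDerivAt
    have h4 := h3.comp_hasDerivAt (0 : ℝ) (hld 0)
    exact ((ContinuousLinearMap.apply ℝ ℝ a).hasFDerivAt.comp_hasDerivAt (0 : ℝ) h4).deriv
  have hmin' : IsLocalMin (v ∘ l) 0 := by
    have := hlt.eventually hmin
    filter_upwards [this] with t ht
    simpa [hl0] using ht
  by_contra hneg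
  rw [not_le, ← h2] at hneg
  have hc : ContinuousAt (v ∘ l) 0 := by
    refine ContinuousAt.comp ?_ hlc
    rw [hl0]; exact h.continuousAt
  have hmax : IsLocalMax (v ∘ l) 0 :=
    isLocalMax_of_deriv_deriv_neg hneg hmin'.deriv_eq_zero hc
  have hconst : (v ∘ l) =ᶠ[𝓝 0] fun _ => (v ∘ l) 0 := by
    filter_upwards [hmin', hmax] with t h1 h2
    exact le_antisymm h2 h1
  have : deriv (v ∘ l) =ᶠ[𝓝 0] fun _ => 0 := by
    have := hconst.deriv
    simpa using this
  rw [this.deriv_eq] at hneg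
  simp at hneg

theorem lap_nonneg_of_isLocalMin {v : ℂ → ℝ} {z : ℂ} (h : ContDiffAt ℝ 2 v z)
    (hmin : IsLocalMin v z) : 0 ≤ lap v z :=
  add_nonneg (fderiv_fderiv_nonneg_of_isLocalMin h hmin _)
    (fderiv_fderiv_nonneg_of_isLocalMin h hmin _)

theorem lap_congr {v w : ℂ → ℝ} {z : ℂ} (h : v =ᶠ[𝓝 z] w) : lap v z = lap w z := by
  unfold lap
  rw [Filter.EventuallyEq.fderiv_eq (Filter.EventuallyEq.fderiv h)]

theorem lap_sub_const_mul {v w : ℂ → ℝ} {z : ℂ} (hv : ContDiffAt ℝ 2 v z)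
    (hw : ContDiffAt ℝ 2 w z) (c : ℝ) :
    lap (fun ζ => v ζ - c * w ζ) z = lap v z - c * lap w z := by
  have h1 : fderiv ℝ (fun ζ => v ζ - c * w ζ) =ᶠ[𝓝 z]
      fun ζ => fderiv ℝ v ζ - c • fderiv ℝ w ζ := by
    filter_upwards [eventually_differentiableAt_of_contDiffAt_two hv,
      eventually_differentiableAt_of_contDiffAt_two hw] with ζ h1 h2
    exact (h1.hasFDerivAt.sub (h2.hasFDerivAt.const_mul c)).fderiv
  have h2 : fderiv ℝ (fderiv ℝ (fun ζ => v ζ - c * w ζ)) z =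
      fderiv ℝ (fderiv ℝ v) z - c • fderiv ℝ (fderiv ℝ w) z := by
    rw [h1.fderiv_eq]
    exact ((differentiableAt_fderiv_of_contDiffAt_two hv).hasFDerivAt.sub
      ((differentiableAt_fderiv_of_contDiffAt_two hw).hasFDerivAt.const_smul c)).fderiv
  simp only [lap, h2, _root_.sub_apply, _root_.smul_apply, smul_eq_mul]
  ring

theorem lap_const_sub {v : ℂ → ℝ} {z : ℂ} (c : ℝ) :
    lap (fun ζ => c - v ζ) z = - lap v z := by
  have h1 : fderiv ℝ (fun ζ => c - v ζ) = fun ζ => - fderiv ℝ v ζ := by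
    funext ζ
    rw [fderiv_const_sub]
  have h2 : fderiv ℝ (fun ζ => - fderiv ℝ v ζ) z = - fderiv ℝ (fderiv ℝ v) z := fderiv_fun_neg
  simp only [lap, h1, h2, _root_.neg_apply]
  ring

/-- The barrier function of the Hopf lemma. -/
noncomputable def barrier (α : ℝ) (a ζ : ℂ) : ℝ := Real.exp (-α * ‖ζ - a‖ ^ 2)

theorem contDiff_barrier (α : ℝ) (a : ℂ) : ContDiff ℝ 2 (barrier α a) := by
  unfold barrier
  exact ((contDiff_const.mul ((contDiff_id.sub contDiff_const).norm_sq ℝ))).exp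

/-- For large `α` the factor in front of the barrier exceeds any given constant away from the centre
`a`; this is what beats the term `C v` in the Hopf lemma. -/
theorem lap_barrier (α : ℝ) (a ζ : ℂ) :
    lap (barrier α a) ζ = (4 * α ^ 2 * ‖ζ - a‖ ^ 2 - 4 * α) * barrier α a ζ := by
  have h1 : ∀ z, HasFDerivAt (barrier α a) (barrier α a z • ((-2 * α) • innerSL ℝ (z - a))) z := by
    intro z
    have := ((((hasFDerivAt_id (𝕜 := ℝ) z).sub_const a).norm_sq).const_mul (-α)).exp
    refine (this.congr_fderiv ?_ : HasFDerivAt (barrier α a) _ z)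
    ext <;> simp [barrier] <;> ring
  have h2 : fderiv ℝ (barrier α a) = fun z => barrier α a z • ((-2 * α) • innerSL ℝ (z - a)) :=
    funext fun z => (h1 z).fderiv
  have h3 : HasFDerivAt (fun z : ℂ => (-2 * α) • innerSL ℝ (z - a))
      ((-2 * α) • (innerSL ℝ : ℂ →L[ℝ] ℂ →L[ℝ] ℝ)) ζ := by
    have := (((innerSL ℝ : ℂ →L[ℝ] ℂ →L[ℝ] ℝ).hasFDerivAt (x := ζ - a)).comp ζ
      ((hasFDerivAt_id (𝕜 := ℝ) ζ).sub_const a)).const_smul (-2 * α)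
    exact this
  have h4 := ((h1 ζ).smul h3).fderiv
  have hn : ‖ζ - a‖ ^ 2 = (ζ - a).re ^ 2 + (ζ - a).im ^ 2 := by
    rw [← Complex.normSq_eq_norm_sq, Complex.normSq_apply]; ring
  unfold lap
  rw [h2]
  erw [h4]
  rw [hn]
  simp only [_root_.add_apply, _root_.smul_apply, ContinuousLinearMap.smulRight_apply,
    innerSL_apply_apply, smul_eq_mul, Complex.inner]
  have e1 : (innerSL ℝ (1 : ℂ)) 1 = 1 := by simp [innerSL_apply_apply]
  have e2 : (innerSL ℝ I) I = 1 := by simp [innerSL_apply_apply]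
  simp
  erw [e1, e2]
  ring

/-- Compare `v` with a small multiple of `e^{-α|ζ-a|²} - e^{-αR²}` on the annulus `R/2 ≤ |ζ - a| ≤
R`. The barrier vanishes on the outer circle and grows linearly from it, and it is a strict
subsolution of `Δb = C b`, so it stays below `v`. -/
theorem hopf {v : ℂ → ℝ} {a q : ℂ} {R C : ℝ} (hR : 0 < R) (hC : 0 ≤ C) (hq : dist q a = R)
    (hcont : ContinuousOn v (closedBall a R)) (hC2 : ∀ ζ ∈ ball a R, ContDiffAt ℝ 2 v ζ)
    (hpos : ∀ ζ ∈ ball a R, 0 < v ζ) (hlap : ∀ ζ ∈ ball a R, lap v ζ ≤ C * v ζ) :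
    ∃ κ > 0, ∀ t ∈ Icc (0 : ℝ) (1 / 2), κ * t ≤ v (q + t • (a - q)) := by
  have hnn : ∀ ζ ∈ closedBall a R, 0 ≤ v ζ := by
    intro ζ hζ
    have hcl : ζ ∈ closure (ball a R) := by rwa [closure_ball _ hR.ne']
    have := mem_closure_iff_nhdsWithin_neBot.1 hcl
    refine ge_of_tendsto (x := 𝓝[ball a R] ζ) (f := v) ?_ ?_
    · exact (hcont ζ hζ).mono ball_subset_closedBall
    · filter_upwards [self_mem_nhdsWithin] with x hx using (hpos x hx).le
  -- On the annulus `4|ζ-a|² ≥ R²`, so the factor in `lap_barrier` is at least `α²R² - 4α`, which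
  -- must exceed `C`.
  obtain ⟨α, hα0, hα⟩ : ∃ α > 0, 4 * α + C < α ^ 2 * R ^ 2 := by
    refine ⟨(4 + C) / R ^ 2 + 1, by positivity, ?_⟩
    have hR2 : 0 < R ^ 2 := by positivity
    have h1 : ((4 + C) / R ^ 2 + 1) ^ 2 * R ^ 2 =
      ((4 + C) / R ^ 2 + 1) * (4 + C) + ((4 + C) / R ^ 2 + 1) * R ^ 2 := by
      field_simp
    have h2 : 1 ≤ (4 + C) / R ^ 2 + 1 := by
      have : 0 ≤ (4 + C) / R ^ 2 := by positivity
      linarith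
    rw [h1]
    have h3 : 0 < ((4 + C) / R ^ 2 + 1) * R ^ 2 := by positivity
    nlinarith
  set b : ℂ → ℝ := fun ζ => barrier α a ζ - Real.exp (-α * R ^ 2) with hb
  have hexp : 0 < Real.exp (-α * R ^ 2) := Real.exp_pos _
  have hlapb : ∀ ζ, lap b ζ = lap (barrier α a) ζ := by
    intro ζ
    have h1 : fderiv ℝ b = fderiv ℝ (barrier α a) := by
      funext z
      simp only [hb, fderiv_sub_const]
    simp [lap, h1]
  have hbC2 : ContDiff ℝ 2 b := (contDiff_barrier α a).sub contDiff_const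
  have hsub : ∀ ζ, R / 2 ≤ dist ζ a → C * b ζ < lap b ζ := by
    intro ζ hζ
    rw [hlapb, lap_barrier]
    have h1 : R ^ 2 ≤ 4 * ‖ζ - a‖ ^ 2 := by
      rw [dist_eq_norm] at hζ; nlinarith
    have h2 : 0 < barrier α a ζ := Real.exp_pos _
    have h3 : C < 4 * α ^ 2 * ‖ζ - a‖ ^ 2 - 4 * α := by nlinarith [sq_nonneg α]
    have h4 := mul_lt_mul_of_pos_right h3 h2
    have h5 : 0 ≤ C * Real.exp (-α * R ^ 2) := by positivity
    simp only [hb]; nlinarith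
  -- minimum on the inner circle
  obtain ⟨ζ₁, hζ₁, hmin₁⟩ := (isCompact_sphere a (R / 2)).exists_isMinOn
    ((NormedSpace.sphere_nonempty (x := a) (r := R / 2)).2 (by positivity))
    (hcont.mono (sphere_subset_closedBall.trans (closedBall_subset_closedBall (by linarith))))
  have hζ₁' : ζ₁ ∈ ball a R := by
    rw [mem_sphere] at hζ₁; rw [mem_ball, hζ₁]; linarith
  -- Half the minimum of `v` on the inner circle: since `b < 1`, this gives `ε b < v` there.
  set ε := v ζ₁ / 2 with hε
  have hε0 : 0 < ε := half_pos (hpos ζ₁ hζ₁')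
  have hb1 : ∀ ζ, b ζ < 1 := by
    intro ζ
    have : barrier α a ζ ≤ 1 := by
      unfold barrier
      rw [Real.exp_le_one_iff]
      have : 0 ≤ α * ‖ζ - a‖ ^ 2 := by positivity
      linarith
    simp only [hb]; linarith
  have hmain : ∀ ζ ∈ closedBall a R, R / 2 ≤ dist ζ a → ε * b ζ ≤ v ζ := by
    set A : Set ℂ := closedBall a R ∩ {ζ | R / 2 ≤ dist ζ a} with hA
    have hAc : IsCompact A := (isCompact_closedBall a R).inter_right
      (isClosed_le continuous_const (continuous_id.dist continuous_const))
    have hAn : A.Nonempty := ⟨ζ₁, ball_subset_closedBall hζ₁', (mem_sphere.1 hζ₁).ge⟩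
    have hwc : ContinuousOn (fun ζ => v ζ - ε * b ζ) A :=
      (hcont.mono inter_subset_left).sub (continuousOn_const.mul hbC2.continuous.continuousOn)
    obtain ⟨ζ₂, hζ₂, hmin₂⟩ := hAc.exists_isMinOn hAn hwc
    suffices h : 0 ≤ v ζ₂ - ε * b ζ₂ by
      intro ζ h1 h2
      have := isMinOn_iff.1 hmin₂ ζ ⟨h1, h2⟩
      linarith
    -- At a negative minimum of `w = v - εb` inside the annulus, `Δw ≥ 0`, but `Δw < C w ≤ 0` by the
    -- two differential inequalities. On the inner circle `εb < v`, and on the outer one `b = 0 ≤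
    -- v`.
    by_contra hneg
    rw [not_le] at hneg
    obtain ⟨h21, h22⟩ := hζ₂
    rcases (mem_closedBall.1 h21).lt_or_eq with hlt | heq
    · rcases (show R / 2 ≤ dist ζ₂ a from h22).lt_or_eq with hlt2 | heq2
      · have hloc : IsLocalMin (fun ζ => v ζ - ε * b ζ) ζ₂ := by
          refine hmin₂.isLocalMin ?_
          have hO : IsOpen (ball a R ∩ {ζ | R / 2 < dist ζ a}) :=
            isOpen_ball.inter (isOpen_lt continuous_const (continuous_id.dist continuous_const))
          refine Filter.mem_of_superset (hO.mem_nhds ⟨hlt, hlt2⟩) ?_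
          exact fun x hx => ⟨ball_subset_closedBall hx.1, (show R / 2 < dist x a from hx.2).le⟩
        have hv2 := hC2 ζ₂ hlt
        have h5 := lap_nonneg_of_isLocalMin
          (hv2.sub (contDiffAt_const.mul hbC2.contDiffAt)) hloc
        rw [lap_sub_const_mul hv2 hbC2.contDiffAt] at h5
        have h6 := hlap ζ₂ hlt
        have h7 := mul_lt_mul_of_pos_left (hsub ζ₂ h22) hε0
        nlinarith
      · have h5 := isMinOn_iff.1 hmin₁ ζ₂ (mem_sphere.2 heq2.symm)
        have h6 := mul_lt_mul_of_pos_left (hb1 ζ₂) hε0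
        linarith
    · have h5 : b ζ₂ = 0 := by
        rw [dist_eq_norm] at heq
        simp [hb, barrier, heq]
      have := hnn ζ₂ h21
      rw [h5] at hneg; linarith
  -- At distance `(1 - t)R` from `a` the barrier equals `e^{-αR²}(e^{αR² t(2-t)} - 1)`; use `e^s - 1
  -- ≥ s` and `t(2 - t) ≥ t`.
  refine ⟨ε * (Real.exp (-α * R ^ 2) * (α * R ^ 2)), by positivity, fun t ht => ?_⟩
  have hd : dist (q + t • (a - q)) a = (1 - t) * R := by
    have : q + t • (a - q) - a = ((1 - t : ℝ)) • (q - a) := by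
      simp only [Complex.real_smul]; push_cast; ring
    rw [dist_eq_norm, this, norm_smul, ← dist_eq_norm q a, hq, Real.norm_of_nonneg (by linarith [ht.2])]
  have h1 := hmain (q + t • (a - q)) (by rw [mem_closedBall, hd]; nlinarith [ht.1])
    (by rw [hd]; nlinarith [ht.2])
  refine le_trans ?_ h1
  rw [mul_assoc]
  refine mul_le_mul_of_nonneg_left ?_ hε0.le
  simp only [hb, barrier]
  rw [← dist_eq_norm, hd]
  have h2 : -α * ((1 - t) * R) ^ 2 = -α * R ^ 2 + α * R ^ 2 * (t * (2 - t)) := by ring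
  rw [h2, Real.exp_add]
  have h3 := Real.add_one_le_exp (α * R ^ 2 * (t * (2 - t)))
  have h4 : t ≤ t * (2 - t) := by nlinarith [ht.1, ht.2]
  have h5 : α * R ^ 2 * t ≤ α * R ^ 2 * (t * (2 - t)) :=
    mul_le_mul_of_nonneg_left h4 (by positivity)
  have h6 := mul_le_mul_of_nonneg_left (h5.trans (le_sub_iff_add_le.2 h3)) hexp.le
  linarith

/-- The derivative at the touching point of the Hopf lemma does not vanish. -/
theorem hopf_deriv_ne {v : ℂ → ℝ} {a q : ℂ} {R C : ℝ} (hR : 0 < R) (hC : 0 ≤ C) (hq : dist q a = R)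
    (hcont : ContinuousOn v (closedBall a R)) (hC2 : ∀ ζ ∈ ball a R, ContDiffAt ℝ 2 v ζ)
    (hpos : ∀ ζ ∈ ball a R, 0 < v ζ) (hlap : ∀ ζ ∈ ball a R, lap v ζ ≤ C * v ζ) (hvq : v q = 0)
    (hd : HasDerivWithinAt (fun t : ℝ => v (q + t • (a - q))) 0 (Ici 0) 0) : False := by
  obtain ⟨κ, hκ, h⟩ := hopf hR hC hq hcont hC2 hpos hlap
  have h1 := (hasDerivWithinAt_iff_isLittleO.1 hd).def (half_pos hκ)
  have h2 : ∀ᶠ t in 𝓝[>] (0 : ℝ), t ∈ Icc (0 : ℝ) (1 / 2) := by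
    filter_upwards [Ioc_mem_nhdsGT (show (0 : ℝ) < 1 / 2 by norm_num)] with t ht
      using ⟨ht.1.le, ht.2⟩
  have h3 := (h1.filter_mono (nhdsWithin_mono _ Ioi_subset_Ici_self)).and
    (h2.and self_mem_nhdsWithin)
  obtain ⟨t, h4, h5, h6⟩ := h3.exists
  have h7 := h t h5
  have h6 : 0 < t := h6
  simp only [zero_smul, add_zero, hvq, sub_zero, smul_zero, Real.norm_eq_abs, abs_of_pos h6] at h4
  have := le_abs_self (v (q + t • (a - q)))
  nlinarith

/-- If `v(a) ≠ 0`, the largest open disc about `a` free of zeros touches the zero set at some `q`.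
There the Hopf lemma forbids a vanishing derivative, while `q` is an interior minimum. -/
theorem eq_zero_on_ball_of_lap_le {v : ℂ → ℝ} {z₀ : ℂ} {R C : ℝ} (hC : 0 ≤ C)
    (hC2 : ∀ ζ ∈ ball z₀ (3 * R), ContDiffAt ℝ 2 v ζ)
    (hnn : ∀ ζ ∈ ball z₀ (3 * R), 0 ≤ v ζ) (hlap : ∀ ζ ∈ ball z₀ (3 * R), lap v ζ ≤ C * v ζ)
    (hz : v z₀ = 0) : ∀ ζ ∈ ball z₀ R, v ζ = 0 := by
  intro a ha
  by_contra hne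
  have hda : dist a z₀ < R := ha
  have hR : 0 < R := dist_nonneg.trans_lt ha
  have hcont : ContinuousOn v (closedBall z₀ (2 * R)) := fun ζ hζ =>
    (hC2 ζ (closedBall_subset_ball (by linarith) hζ)).continuousAt.continuousWithinAt
  -- The zeros are cut off at radius `2R` for compactness. Since `z₀` is a zero at distance less
  -- than `R` from `a`, the disc about `a` through the nearest zero stays inside `ball z₀ (2R)`, and
  -- no zero outside the cut-off can lie in it.
  set Z : Set ℂ := closedBall z₀ (2 * R) ∩ v ⁻¹' {0} with hZ
  have hZc : IsCompact Z := by
    have : IsClosed Z := hcont.preimage_isClosed_of_isClosed isClosed_closedBall isClosed_singleton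
    exact (isCompact_closedBall z₀ (2 * R)).of_isClosed_subset this inter_subset_left
  have hZn : Z.Nonempty := ⟨z₀, mem_closedBall_self (by linarith), hz⟩
  obtain ⟨q, hqZ, hq⟩ := hZc.exists_infDist_eq_dist hZn a
  set ρ := dist a q with hρ
  have hρR : ρ < R := by
    have := infDist_le_dist_of_mem (x := a) (show z₀ ∈ Z from ⟨mem_closedBall_self (by linarith), hz⟩)
    rw [hq] at this
    linarith
  have hρ0 : 0 < ρ := by
    rw [hρ, dist_pos]
    rintro rfl
    exact hne hqZ.2
  have hsub : closedBall a ρ ⊆ ball z₀ (2 * R) := by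
    intro x hx
    rw [mem_closedBall] at hx
    rw [mem_ball]
    have := dist_triangle x a z₀
    linarith
  have hsub3 : closedBall a ρ ⊆ ball z₀ (3 * R) := hsub.trans (ball_subset_ball (by linarith))
  have hpos : ∀ ζ ∈ ball a ρ, 0 < v ζ := by
    intro ζ hζ
    refine lt_of_le_of_ne (hnn ζ (hsub3 (ball_subset_closedBall hζ))) fun h0 => ?_
    have h1 : ζ ∈ Z := ⟨ball_subset_closedBall (hsub (ball_subset_closedBall hζ)), h0.symm⟩
    have h2 := infDist_le_dist_of_mem (x := a) h1
    rw [hq, dist_comm a ζ] at h2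
    exact absurd (mem_ball.1 hζ) (not_lt.2 h2)
  have hqa : q ∈ closedBall a ρ := by rw [mem_closedBall, dist_comm]
  have hqd := (hC2 q (hsub3 hqa)).differentiableAt (by simp)
  have hqmin : IsLocalMin v q := by
    filter_upwards [isOpen_ball.mem_nhds (hsub3 hqa)] with x hx
    rw [show v q = 0 from hqZ.2]
    exact hnn x hx
  refine hopf_deriv_ne hρ0 hC (by rw [dist_comm]) (hcont.mono (hsub.trans ball_subset_closedBall))
    (fun ζ hζ => hC2 ζ (hsub3 (ball_subset_closedBall hζ))) hpos
    (fun ζ hζ => hlap ζ (hsub3 (ball_subset_closedBall hζ))) hqZ.2 ?_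
  have hl := hasDerivAt_line q (a - q) 0
  have h5 : HasFDerivAt v (0 : ℂ →L[ℝ] ℝ) (q + (0 : ℝ) • (a - q)) := by
    have := hqd.hasFDerivAt
    rw [hqmin.fderiv_eq_zero] at this
    simpa using this
  exact (h5.comp_hasDerivAt (0 : ℝ) hl).hasDerivWithinAt

/-- Strong minimum principle: a nonnegative function with `Δ v ≤ C v` vanishes on a connected open
set as soon as it has a zero there. -/
theorem eqOn_zero_of_lap_le {v : ℂ → ℝ} {D : Set ℂ} {C : ℝ} (hC : 0 ≤ C) (hD : IsOpen D)
    (hDc : IsPreconnected D) (hC2 : ∀ ζ ∈ D, ContDiffAt ℝ 2 v ζ) (hnn : ∀ ζ ∈ D, 0 ≤ v ζ)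
    (hlap : ∀ ζ ∈ D, lap v ζ ≤ C * v ζ) {z₀ : ℂ} (hz₀ : z₀ ∈ D) (hz : v z₀ = 0) :
    ∀ ζ ∈ D, v ζ = 0 := by
  have hcont : ContinuousOn v D := fun ζ hζ => (hC2 ζ hζ).continuousAt.continuousWithinAt
  have hopen1 : IsOpen (D ∩ v ⁻¹' {0}) := by
    rw [isOpen_iff]
    rintro z ⟨hzD, hz0⟩
    obtain ⟨r, hr, hrD⟩ := isOpen_iff.1 hD z hzD
    have hr3 : ball z (3 * (r / 3)) ⊆ D := by rwa [mul_div_cancel₀ r (by norm_num)]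
    refine ⟨r / 3, by positivity, fun ζ hζ => ⟨hrD (ball_subset_ball (by linarith) hζ), ?_⟩⟩
    exact eq_zero_on_ball_of_lap_le hC (fun ζ h => hC2 ζ (hr3 h)) (fun ζ h => hnn ζ (hr3 h))
      (fun ζ h => hlap ζ (hr3 h)) hz0 ζ hζ
  have hopen2 : IsOpen (D ∩ v ⁻¹' {0}ᶜ) := hcont.isOpen_inter_preimage hD isOpen_compl_singleton
  intro ζ hζ
  by_contra hne
  obtain ⟨x, -, hx1, hx2⟩ := hDc _ _ hopen1 hopen2
    (fun x hx => (em (v x = 0)).imp (fun h => ⟨hx, h⟩) fun h => ⟨hx, h⟩)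
    ⟨z₀, hz₀, hz₀, hz⟩ ⟨ζ, hζ, hζ, hne⟩
  exact hx2.2 hx1.2

/-- The open upper half-disc around a point. -/
def halfDisc (z : ℂ) (R : ℝ) : Set ℂ := ball z R ∩ {ζ | 0 < ζ.im}

theorem isOpen_halfDisc (z : ℂ) (R : ℝ) : IsOpen (halfDisc z R) :=
  isOpen_ball.inter (isOpen_lt continuous_const Complex.continuous_im)

theorem convex_halfDisc (z : ℂ) (R : ℝ) : Convex ℝ (halfDisc z R) :=
  (convex_ball z R).inter (convex_halfSpace_im_gt 0)

/-- A nonnegative function with `Δ v ≤ C v` on a half-disc that vanishes at the centre together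
with its normal derivative vanishes identically. -/
theorem eqOn_zero_halfDisc_of_lap_le {v : ℂ → ℝ} {z : ℂ} (hz : z.im = 0) {R C : ℝ} (hR : 0 < R)
    (hC : 0 ≤ C) (hC2 : ∀ ζ ∈ halfDisc z R, ContDiffAt ℝ 2 v ζ)
    (hnn : ∀ ζ ∈ halfDisc z R, 0 ≤ v ζ) (hlap : ∀ ζ ∈ halfDisc z R, lap v ζ ≤ C * v ζ)
    (hvz : v z = 0) (hd : HasDerivWithinAt (fun t : ℝ => v (z + t • I)) 0 (Ici 0) 0)
    (hc : ContinuousWithinAt v {ζ | 0 ≤ ζ.im} z) :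
    ∀ ζ ∈ halfDisc z R, v ζ = 0 := by
  by_contra! hne
  obtain ⟨ζ₁, hζ₁, hne⟩ := hne
  have hpos : ∀ ζ ∈ halfDisc z R, 0 < v ζ := by
    intro ζ hζ
    refine lt_of_le_of_ne (hnn ζ hζ) fun h0 => hne ?_
    exact eqOn_zero_of_lap_le hC (isOpen_halfDisc z R) (convex_halfDisc z R).isPreconnected hC2 hnn
      hlap hζ h0.symm ζ₁ hζ₁
  -- The disc of radius `ρ` about `z + iρ` is tangent to the real axis at `z`. Its closure meets the
  -- axis only there and, of diameter `2R/3`, stays in the half-disc otherwise, so regularity of `v`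
  -- at other boundary points is never used.
  set ρ := R / 3 with hρ
  have hρ0 : 0 < ρ := by positivity
  set a : ℂ := z + ρ • I with ha
  have haz : a - z = ρ • I := by simp [ha]
  have hdz : dist z a = ρ := by
    rw [dist_comm, dist_eq_norm, haz, norm_smul, norm_I, mul_one, Real.norm_of_nonneg hρ0.le]
  have hre : a.re = z.re := by simp [ha]
  have him : a.im = ρ := by simp [ha, hz]
  have hsubR : closedBall a ρ ⊆ ball z R := by
    intro x hx
    rw [mem_closedBall] at hx
    rw [mem_ball]
    have := dist_triangle x a z
    rw [dist_comm a z, hdz] at this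
    linarith
  have him0 : ∀ x ∈ closedBall a ρ, 0 ≤ x.im := by
    intro x hx
    rw [mem_closedBall, dist_eq_norm] at hx
    have h1 := (Complex.abs_im_le_norm (x - a)).trans hx
    rw [Complex.sub_im, him, abs_le] at h1
    linarith [h1.1]
  have hsub1 : ∀ x ∈ closedBall a ρ, x ≠ z → x ∈ halfDisc z R := by
    intro x hx hxz
    refine ⟨hsubR hx, lt_of_le_of_ne (him0 x hx) fun h0 => hxz ?_⟩
    rw [mem_closedBall, dist_eq_norm] at hx
    have h2 : ‖x - a‖ ^ 2 = (x - a).re ^ 2 + (x - a).im ^ 2 := by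
      rw [← Complex.normSq_eq_norm_sq, Complex.normSq_apply]; ring
    have h3 : ‖x - a‖ ^ 2 ≤ ρ ^ 2 := by gcongr
    rw [h2, Complex.sub_re, Complex.sub_im, him, hre, ← h0] at h3
    have h4 : x.re - z.re = 0 := by nlinarith
    exact Complex.ext (by linarith) (by rw [← h0, hz])
  have hsub2 : ∀ x ∈ ball a ρ, x ∈ halfDisc z R := by
    intro x hx
    refine hsub1 x (ball_subset_closedBall hx) ?_
    rintro rfl
    rw [mem_ball, hdz] at hx
    exact lt_irrefl _ hx
  refine hopf_deriv_ne hρ0 hC hdz ?_ (fun x hx => hC2 x (hsub2 x hx))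
    (fun x hx => hpos x (hsub2 x hx)) (fun x hx => hlap x (hsub2 x hx)) hvz ?_
  · intro x hx
    by_cases hxz : x = z
    · rw [hxz]
      exact hc.mono him0
    · exact (hC2 x (hsub1 x hx hxz)).continuousAt.continuousWithinAt
  · have h1 : HasDerivWithinAt (fun t : ℝ => t * ρ) ρ (Ici 0) 0 := by
      simpa using ((hasDerivAt_id (0 : ℝ)).mul_const ρ).hasDerivWithinAt
    have h2 : HasDerivWithinAt (fun t : ℝ => v (z + t • I)) 0 (Ici 0) (0 * ρ) := by simpa using hd
    have h3 := h2.scomp (0 : ℝ) h1 (fun t (ht : 0 ≤ t) => mul_nonneg ht hρ0.le)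
    have h4 : ((fun t : ℝ => v (z + t • I)) ∘ fun t => t * ρ) =
        fun t : ℝ => v (z + t • (a - z)) := by
      funext t
      simp [haz, mul_assoc]
    rw [h4] at h3
    simpa using h3

end Hopf

/-! ### The Laplacian of a function along a holomorphic curve in a vector space -/

section LinearModel

open Complex

variable {E : Type*} [NormedAddCommGroup E] [NormedSpace ℝ E]

/-- The 1-form `-dg ∘ J` on a subset of a vector space. -/
noncomputable def dcOn (K : Set E) (g : E → ℝ) (Jc : E → E →L[ℝ] E) (y : E) : E →L[ℝ] ℝ :=
  -(fderivWithin ℝ g K y).comp (Jc y)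

/-- The exterior derivative of a 1-form on a subset of a vector space. -/
noncomputable def extD (K : Set E) (θ : E → E →L[ℝ] ℝ) (y v w : E) : ℝ :=
  fderivWithin ℝ θ K y v w - fderivWithin ℝ θ K y w v

theorem contDiffAt_comp_of_eventually_mem {K : Set E} {g : E → ℝ} {u : ℂ → E} {ζ : ℂ}
    (hu : ContDiffAt ℝ 2 u ζ) (huK : ∀ᶠ z in 𝓝 ζ, u z ∈ K)
    (hg : ContDiffWithinAt ℝ 2 g K (u ζ)) : ContDiffAt ℝ 2 (g ∘ u) ζ := by
  have h := hg.comp_of_preimage_mem_nhdsWithin (t := K) (s := univ) ζ hu.contDiffWithinAt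
    (by rwa [nhdsWithin_univ])
  exact contDiffWithinAt_univ.1 h

/-- This is `Δ(g ∘ u) dx ∧ dy = u^* dd^J g`. Holomorphy turns the partial derivatives of `g ∘ u`
into `θ(u_I)` and `-θ(u_1)`; differentiating once more, the terms with second derivatives of `u`
cancel by symmetry. Derivatives within `K` allow targets with boundary. -/
theorem lap_comp_eq_extD {K : Set E} (hK : UniqueDiffOn ℝ K) {Jc : E → E →L[ℝ] E} {g : E → ℝ}
    {u : ℂ → E} {ζ : ℂ} (hu : ContDiffAt ℝ 2 u ζ) (huK : ∀ᶠ z in 𝓝 ζ, u z ∈ K)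
    (hg : ContDiffWithinAt ℝ 2 g K (u ζ)) (hJ : DifferentiableWithinAt ℝ Jc K (u ζ))
    (hol : ∀ᶠ z in 𝓝 ζ, ∀ a, fderiv ℝ u z (I * a) = Jc (u z) (fderiv ℝ u z a)) :
    lap (g ∘ u) ζ = extD K (dcOn K g Jc) (u ζ) (fderiv ℝ u ζ 1) (fderiv ℝ u ζ I) := by
  set θ := dcOn K g Jc with hθ
  have hζK : u ζ ∈ K := huK.self_of_nhds
  have htend : Filter.Tendsto u (𝓝 ζ) (𝓝[K] (u ζ)) :=
    tendsto_nhdsWithin_iff.2 ⟨hu.continuousAt, huK⟩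
  have hgev : ∀ᶠ z in 𝓝 ζ, DifferentiableWithinAt ℝ g K (u z) := by
    have h1 := hg.eventually (by simp)
    rw [insert_eq_of_mem hζK] at h1
    filter_upwards [htend.eventually h1] with z hz using hz.differentiableWithinAt (by simp)
  have huev : ∀ᶠ z in 𝓝 ζ, DifferentiableAt ℝ u z := by
    filter_upwards [hu.eventually (by simp)] with z hz using hz.differentiableAt (by simp)
  have hG : ∀ᶠ z in 𝓝 ζ, fderiv ℝ (g ∘ u) z = (fderivWithin ℝ g K (u z)).comp (fderiv ℝ u z) := by
    filter_upwards [hgev, huev, huK.eventually_nhds] with z h1 h2 h3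
    exact (h1.hasFDerivWithinAt.comp_hasFDerivAt z h2.hasFDerivAt h3).fderiv
  have hP : (fun z => fderiv ℝ (g ∘ u) z 1) =ᶠ[𝓝 ζ] fun z => θ (u z) (fderiv ℝ u z I) := by
    filter_upwards [hG, hol] with z h1 h2
    have h3 := h2 I
    rw [I_mul_I, map_neg] at h3
    simp [h1, hθ, dcOn, ← h3]
  have hQ : (fun z => fderiv ℝ (g ∘ u) z I) =ᶠ[𝓝 ζ] fun z => - θ (u z) (fderiv ℝ u z 1) := by
    filter_upwards [hG, hol] with z h1 h2
    have h3 := h2 1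
    rw [mul_one] at h3
    simp [h1, hθ, dcOn, ← h3]
  have hu' : HasFDerivAt (fderiv ℝ u) (fderiv ℝ (fderiv ℝ u) ζ) ζ :=
    ((hu.fderiv_right (m := 1) (by norm_num)).differentiableAt (by simp)).hasFDerivAt
  have hud : HasFDerivAt u (fderiv ℝ u ζ) ζ := (hu.differentiableAt (by simp)).hasFDerivAt
  have hθd : DifferentiableWithinAt ℝ θ K (u ζ) := by
    have h1 : DifferentiableWithinAt ℝ (fderivWithin ℝ g K) K (u ζ) :=
      (hg.fderivWithin_right hK (m := 1) (by norm_num) hζK).differentiableWithinAt (by simp)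
    exact (h1.clm_comp hJ).neg
  have hθu : HasFDerivAt (θ ∘ u) ((fderivWithin ℝ θ K (u ζ)).comp (fderiv ℝ u ζ)) ζ :=
    hθd.hasFDerivWithinAt.comp_hasFDerivAt ζ hud huK
  have hev : ∀ a : ℂ, HasFDerivAt (fun z => fderiv ℝ u z a)
      ((ContinuousLinearMap.apply ℝ E a).comp (fderiv ℝ (fderiv ℝ u) ζ)) ζ := fun a =>
    (ContinuousLinearMap.apply ℝ E a).hasFDerivAt.comp ζ hu'
  have hd : ∀ a b : ℂ, fderiv ℝ (fun z => θ (u z) (fderiv ℝ u z a)) ζ b =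
      fderivWithin ℝ θ K (u ζ) (fderiv ℝ u ζ b) (fderiv ℝ u ζ a) +
        θ (u ζ) (fderiv ℝ (fderiv ℝ u) ζ b a) := by
    intro a b
    have h := (hθu.clm_apply (hev a)).fderiv
    have h' := DFunLike.congr_fun h b
    refine h'.trans ?_
    simp [add_comm]
  have hG2 : DifferentiableAt ℝ (fderiv ℝ (g ∘ u)) ζ :=
    differentiableAt_fderiv_of_contDiffAt_two (contDiffAt_comp_of_eventually_mem hu huK hg)
  have hGa : ∀ a b : ℂ, fderiv ℝ (fun z => fderiv ℝ (g ∘ u) z a) ζ b =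
      fderiv ℝ (fderiv ℝ (g ∘ u)) ζ b a := by
    intro a b
    have h := ((ContinuousLinearMap.apply ℝ ℝ a).hasFDerivAt.comp ζ hG2.hasFDerivAt).fderiv
    exact DFunLike.congr_fun h b
  have hsymm : fderiv ℝ (fderiv ℝ u) ζ 1 I = fderiv ℝ (fderiv ℝ u) ζ I 1 :=
    (hu.isSymmSndFDerivAt (by simp)) 1 I
  have h1 : fderiv ℝ (fderiv ℝ (g ∘ u)) ζ 1 1 = _ :=
    (hGa 1 1).symm.trans ((DFunLike.congr_fun hP.fderiv_eq 1).trans (hd I 1))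
  have h2 : fderiv ℝ (fderiv ℝ (g ∘ u)) ζ I I = _ :=
    (hGa I I).symm.trans (DFunLike.congr_fun hQ.fderiv_eq I)
  rw [fderiv_fun_neg, _root_.neg_apply, hd 1 I] at h2
  rw [lap, h1, h2, hsymm, extD]
  ring

/-- The exterior derivative of an exact form vanishes. -/
theorem extD_eq_zero_of_eventuallyEq_fderivWithin {K : Set E} (hK : UniqueDiffOn ℝ K)
    {θ : E → E →L[ℝ] ℝ} {g : E → ℝ} {y : E} (hy : y ∈ K) (hy' : y ∈ closure (interior K))
    (hg : ContDiffWithinAt ℝ 2 g K y) (h : θ =ᶠ[𝓝[K] y] fderivWithin ℝ g K) (v w : E) :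
    extD K θ y v w = 0 := by
  rw [extD, h.fderivWithin_eq (h.self_of_nhdsWithin hy)]
  have := hg.isSymmSndFDerivWithinAt (by simp) hK hy' hy v w
  rw [this, sub_self]

end LinearModel

/-! ### Charts of a Riemann surface with boundary -/

section SurfaceCharts

variable {S : Type*} [TopologicalSpace S] [ChartedSpace ClosedHalfPlane S]

theorem range_realHalfPlane : range realHalfPlane = {z : ℂ | 0 ≤ z.im} := range_halfPlaneEquiv

theorem interior_halfPlane : interior {z : ℂ | 0 ≤ z.im} = {z : ℂ | 0 < z.im} :=
  Complex.interior_setOfPred_le_im 0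

theorem im_nonneg_of_mem_target {z₀ : S} {ζ : ℂ} (h : ζ ∈ (extChartAt realHalfPlane z₀).target) :
    0 ≤ ζ.im := by
  have := extChartAt_target_subset_range z₀ h
  rwa [range_realHalfPlane] at this

theorem target_mem_nhds_of_im_pos {z₀ : S} {ζ : ℂ}
    (h : ζ ∈ (extChartAt realHalfPlane z₀).target) (hζ : 0 < ζ.im) :
    (extChartAt realHalfPlane z₀).target ∈ 𝓝 ζ := by
  have h1 := extChartAt_target_mem_nhdsWithin_of_mem h
  rwa [nhdsWithin_eq_nhds.2] at h1
  rw [range_realHalfPlane, ← mem_interior_iff_mem_nhds, interior_halfPlane]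
  exact hζ

/-- Half-disc neighbourhoods in a chart. -/
theorem exists_halfDisc_subset {z₀ : S} {V : Set S} (hV : V ∈ 𝓝 z₀) :
    ∃ R > 0, ∀ ζ ∈ Metric.ball (extChartAt realHalfPlane z₀ z₀) R, 0 ≤ ζ.im →
      ζ ∈ (extChartAt realHalfPlane z₀).target ∧ (extChartAt realHalfPlane z₀).symm ζ ∈ V := by
  have h1 := extChartAt_target_mem_nhdsWithin (I := realHalfPlane) z₀
  have h2 : (extChartAt realHalfPlane z₀).symm ⁻¹' V ∈
      𝓝[range realHalfPlane] (extChartAt realHalfPlane z₀ z₀) :=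
    (continuousAt_extChartAt_symm z₀).continuousWithinAt.preimage_mem_nhdsWithin (by simpa using hV)
  obtain ⟨R, hR, h⟩ := Metric.mem_nhdsWithin_iff.1 (Filter.inter_mem h1 h2)
  rw [range_realHalfPlane] at h
  exact ⟨R, hR, fun ζ h3 h4 => h ⟨h3, h4⟩⟩

theorem eventually_mem_halfDisc (z₀ : S) {R : ℝ} (hR : 0 < R) :
    ∀ᶠ z in 𝓝 z₀, z ∈ (extChartAt realHalfPlane z₀).source ∧
      extChartAt realHalfPlane z₀ z ∈ Metric.ball (extChartAt realHalfPlane z₀ z₀) R ∧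
      0 ≤ (extChartAt realHalfPlane z₀ z).im := by
  filter_upwards [extChartAt_source_mem_nhds (I := realHalfPlane) z₀,
    (continuousAt_extChartAt (I := realHalfPlane) z₀).preimage_mem_nhds
      (Metric.ball_mem_nhds _ hR)] with z h1 h2
  exact ⟨h1, h2, im_nonneg_of_mem_target ((extChartAt realHalfPlane z₀).map_source h1)⟩

variable [IsManifold complexHalfPlane ∞ S]

variable (S) in
theorem isManifold_realHalfPlane : IsManifold realHalfPlane ∞ S := by
  refine isManifold_of_contDiffOn realHalfPlane ∞ S fun e e' he he' => ?_
  have h := StructureGroupoid.compatible (contDiffGroupoid ∞ complexHalfPlane) he he'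
  rw [contDiffGroupoid, mem_groupoid_of_pregroupoid] at h
  have h1 : ContDiffOn ℂ ∞ (complexHalfPlane ∘ e.symm ≫ₕ e' ∘ complexHalfPlane.symm)
      (complexHalfPlane.symm ⁻¹' (e.symm ≫ₕ e').source ∩ range complexHalfPlane) := h.1
  exact h1.restrict_scalars ℝ

/-- Being an interior point is defined through the preferred chart at the point; smooth transition
maps make it visible in every chart. -/
theorem isInteriorPoint_iff_im_pos {z₀ z : S} (hz : z ∈ (extChartAt realHalfPlane z₀).source) :
    z ∈ realHalfPlane.interior S ↔ 0 < (extChartAt realHalfPlane z₀ z).im := by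
  have := isManifold_realHalfPlane S
  have h1 := realHalfPlane.isInteriorPoint_iff_of_mem_atlas (n := ∞) (by simp)
    (chart_mem_atlas ClosedHalfPlane z₀) (x := z) (by simpa using hz)
  have hmem := (extChartAt realHalfPlane z₀).map_source hz
  refine h1.trans ⟨fun h => ?_, fun h => ?_⟩
  · have h2 := interior_mono (extChartAt_target_subset_range z₀) h
    rwa [range_realHalfPlane, interior_halfPlane] at h2
  · exact mem_interior_iff_mem_nhds.2 (target_mem_nhds_of_im_pos hmem h)

theorem isBoundaryPoint_iff_im_eq {z₀ z : S} (hz : z ∈ (extChartAt realHalfPlane z₀).source) :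
    z ∈ realHalfPlane.boundary S ↔ (extChartAt realHalfPlane z₀ z).im = 0 := by
  rw [← realHalfPlane.compl_interior, mem_compl_iff, isInteriorPoint_iff_im_pos hz, not_lt]
  have h := im_nonneg_of_mem_target ((extChartAt realHalfPlane z₀).map_source hz)
  exact ⟨fun h' => le_antisymm h' h, fun h' => h'.le⟩

/-- The derivative of an inverse chart. -/
noncomputable def chartSymmD (z₀ : S) (ζ : ℂ) : ℂ →L[ℝ] ℂ :=
  mfderivWithin 𝓘(ℝ, ℂ) realHalfPlane (extChartAt realHalfPlane z₀).symm (range realHalfPlane) ζ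

/-- The inverse charts of a Riemann surface are holomorphic. -/
theorem chartSymmD_I_mul {z₀ : S} {ζ : ℂ}
    (h : ζ ∈ (extChartAt realHalfPlane z₀).target) (v : ℂ) :
    chartSymmD z₀ ζ (Complex.I * v) = Complex.I * chartSymmD z₀ ζ v := by
  have := isManifold_realHalfPlane S
  have : IsManifold realHalfPlane 1 S := IsManifold.of_le (n := ∞) (by simp)
  set z := (extChartAt realHalfPlane z₀).symm ζ with hz
  have h1 := mdifferentiableWithinAt_extChartAt_symm h
  have hr : ζ ∈ range realHalfPlane := extChartAt_target_subset_range z₀ h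
  have h2 : ContDiffWithinAt ℂ ∞ (extChartAt complexHalfPlane z ∘
      (extChartAt complexHalfPlane z₀).symm) (range complexHalfPlane) ζ := by
    refine contDiffWithinAt_ext_coord_change z z₀ ?_
    rw [PartialEquiv.trans_source, PartialEquiv.symm_source]
    exact ⟨h, mem_extChartAt_source (I := complexHalfPlane) z⟩
  have h3 := (h2.differentiableWithinAt (by simp)).hasFDerivWithinAt.restrictScalars ℝ
  have h4 : UniqueDiffWithinAt ℝ (range realHalfPlane) ζ := realHalfPlane.uniqueDiffOn _ hr
  -- The tangent space at `z` is read in the preferred chart at `z`, so the derivative of the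
  -- inverse chart at `z₀` is that of a transition map, which is complex linear.
  have h5 : chartSymmD z₀ ζ = (fderivWithin ℂ (extChartAt complexHalfPlane z ∘
      (extChartAt complexHalfPlane z₀).symm) (range complexHalfPlane) ζ).restrictScalars ℝ := by
    rw [← h3.fderivWithin h4]
    unfold chartSymmD mfderivWithin
    refine (if_pos h1).trans ?_
    simp only [modelWithCornersSelf_coe, range_id, inter_univ, extChartAt_model_space_eq_id,
      PartialEquiv.refl_symm, PartialEquiv.refl_coe, id_eq, preimage_id]
    rfl
  rw [h5]
  exact (fderivWithin ℂ (extChartAt complexHalfPlane z ∘ (extChartAt complexHalfPlane z₀).symm)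
    (range complexHalfPlane) ζ).map_smul Complex.I v

end SurfaceCharts

/-! ### Holomorphic curves in charts -/

section CurveCharts

variable {S : Type*} [TopologicalSpace S] [ChartedSpace ClosedHalfPlane S]
  {E : Type*} [NormedAddCommGroup E] [NormedSpace ℝ E]
  {H : Type*} [TopologicalSpace H] {I : ModelWithCorners ℝ E H}
  {X : Type*} [TopologicalSpace X] [ChartedSpace H X]

/-- The derivative of a chart. -/
noncomputable def chartD (I : ModelWithCorners ℝ E H) (p q : X) : E →L[ℝ] E :=
  mfderiv I 𝓘(ℝ, E) (extChartAt I p) q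

/-- The derivative of a map from a surface. -/
noncomputable def curveD (I : ModelWithCorners ℝ E H) (u : S → X) (z : S) : ℂ →L[ℝ] E :=
  mfderiv realHalfPlane I u z

/-- The coordinate expression of a map from a surface. -/
noncomputable def curveInChart (I : ModelWithCorners ℝ E H) (u : S → X) (z₀ : S) (p : X) : ℂ → E :=
  extChartAt I p ∘ u ∘ (extChartAt realHalfPlane z₀).symm

variable {J : EndField I (X := X)} {u : S → X}

theorem IsJHolomorphic.mdifferentiableAt (hu : IsJHolomorphic J u) (z : S) :
    MDifferentiableAt realHalfPlane I u z :=
  (hu.contMDiff_one z).mdifferentiableAt (by simp)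

theorem IsJHolomorphic.curveD_I_mul (hu : IsJHolomorphic J u) (z : S) (v : ℂ) :
    curveD I u z (Complex.I * v) = (J (u z) (curveD I u z v) : E) := hu.holomorphic z v

theorem IsJHolomorphic.eventually_mem_source (hu : IsJHolomorphic J u) {z₀ : S} {p : X} {ζ : ℂ}
    (hζ : ζ ∈ (extChartAt realHalfPlane z₀).target) (him : 0 < ζ.im)
    (hp : u ((extChartAt realHalfPlane z₀).symm ζ) ∈ (chartAt H p).source) :
    ∀ᶠ ξ in 𝓝 ζ, ξ ∈ (extChartAt realHalfPlane z₀).target ∧ 0 < ξ.im ∧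
      u ((extChartAt realHalfPlane z₀).symm ξ) ∈ (chartAt H p).source := by
  have h1 : ContinuousAt (extChartAt realHalfPlane z₀).symm ζ :=
    (continuousOn_extChartAt_symm z₀).continuousAt (target_mem_nhds_of_im_pos hζ him)
  have h2 := (hu.contMDiff_one.continuous.continuousAt).comp h1
  filter_upwards [target_mem_nhds_of_im_pos hζ him,
    (isOpen_lt continuous_const Complex.continuous_im).mem_nhds him,
    h2.preimage_mem_nhds ((chartAt H p).open_source.mem_nhds hp)] with ξ a b c
  exact ⟨a, b, c⟩

theorem contDiffWithinAt_comp_extChartAt_symm {g : X → ℝ} {p : X} {n : ℕ∞ω}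
    (hg : ContMDiffAt I 𝓘(ℝ, ℝ) n g p) :
    ContDiffWithinAt ℝ n (g ∘ (extChartAt I p).symm) (range I) (extChartAt I p p) :=
  (contMDiffAt_iff.1 hg).2

variable [IsManifold I ∞ X]

/-- The coordinate expression of an endomorphism field. -/
noncomputable def JInChart (J : EndField I (X := X)) (p : X) : E → E →L[ℝ] E := fun y =>
  inTangentCoordinates I I id id (fun q : X => (J q : E →L[ℝ] E)) p ((extChartAt I p).symm y)

theorem dcInChart_eq (J : EndField I (X := X)) (g : X → ℝ) (p : X) :
    dcInChart J g p = dcOn (range I) (g ∘ (extChartAt I p).symm) (JInChart J p) := rfl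

theorem contDiffWithinAt_JInChart {J : EndField I (X := X)} (hJ : IsAlmostComplex J) (p : X) :
    ContDiffWithinAt ℝ ∞ (JInChart J p) (range I) (extChartAt I p p) := by
  have h := (contMDiffAt_hom_bundle _).1 (hJ.contMDiff p)
  exact (contMDiffAt_iff.1 h.2).2

theorem chartD_self (p : X) : chartD I p p = ContinuousLinearMap.id ℝ E := mfderiv_extChartAt_self

/-- The coordinate form of `J` is `J` conjugated by the derivative of the chart, and the derivatives
of the chart and its inverse cancel. -/
theorem JInChart_apply (J : EndField I (X := X)) {p q : X} (hq : q ∈ (chartAt H p).source) (v : E) :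
    JInChart J p (extChartAt I p q) (chartD I p q v) = chartD I p q (J q v) := by
  have hq' : q ∈ (extChartAt I p).source := by simpa using hq
  have h1 := inTangentCoordinates_eq_mfderiv_comp (I := I) (I' := I)
    (f := id) (g := id) (ϕ := J) (x₀ := p) (x := q) hq hq
  have h2 := DFunLike.congr_fun
    (mfderivWithin_extChartAt_symm_comp_mfderiv_extChartAt' (I := I) hq') v
  have h4 : JInChart J p (extChartAt I p q) =
      inTangentCoordinates I I id id (fun q : X => (J q : E →L[ℝ] E)) p q := by
    rw [JInChart, (extChartAt I p).left_inv hq']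
  rw [h4]
  refine (DFunLike.congr_fun h1 (chartD I p q v)).trans ?_
  exact congrArg (fun w => chartD I p q (J q w)) h2

theorem JInChart_self (J : EndField I (X := X)) (p : X) :
    JInChart J p (extChartAt I p p) = (J p : E →L[ℝ] E) := by
  refine ContinuousLinearMap.ext fun v => ?_
  have h := JInChart_apply J (mem_chart_source H p) v
  rw [chartD_self] at h
  exact h

/-- The derivative of a curve in charts. -/
theorem hasFDerivWithinAt_curveInChart [IsManifold complexHalfPlane ∞ S]
    {z₀ : S} {p : X} {ζ : ℂ}
    (hζ : ζ ∈ (extChartAt realHalfPlane z₀).target)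
    (hu : MDifferentiableAt realHalfPlane I u ((extChartAt realHalfPlane z₀).symm ζ))
    (hp : u ((extChartAt realHalfPlane z₀).symm ζ) ∈ (chartAt H p).source) :
    HasFDerivWithinAt (curveInChart I u z₀ p)
      ((chartD I p (u ((extChartAt realHalfPlane z₀).symm ζ))).comp
        ((curveD I u ((extChartAt realHalfPlane z₀).symm ζ)).comp (chartSymmD z₀ ζ)))
      (range realHalfPlane) ζ := by
  have := isManifold_realHalfPlane S
  have : IsManifold realHalfPlane 1 S := IsManifold.of_le (n := ∞) (by simp)
  have h1 := (mdifferentiableWithinAt_extChartAt_symm hζ).hasMFDerivWithinAt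
  have h2 := hu.hasMFDerivAt.comp_hasMFDerivWithinAt ζ h1
  have h3 := (mdifferentiableAt_extChartAt (I := I) hp).hasMFDerivAt.comp_hasMFDerivWithinAt ζ h2
  exact hasMFDerivWithinAt_iff_hasFDerivWithinAt.1 h3

theorem range_realHalfPlane_mem_nhds {ζ : ℂ} (him : 0 < ζ.im) : range realHalfPlane ∈ 𝓝 ζ := by
  rw [range_realHalfPlane, ← mem_interior_iff_mem_nhds, interior_halfPlane]
  exact him

theorem hasFDerivAt_curveInChart [IsManifold complexHalfPlane ∞ S]
    {z₀ : S} {p : X} {ζ : ℂ}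
    (hζ : ζ ∈ (extChartAt realHalfPlane z₀).target) (him : 0 < ζ.im)
    (hu : MDifferentiableAt realHalfPlane I u ((extChartAt realHalfPlane z₀).symm ζ))
    (hp : u ((extChartAt realHalfPlane z₀).symm ζ) ∈ (chartAt H p).source) :
    HasFDerivAt (curveInChart I u z₀ p)
      ((chartD I p (u ((extChartAt realHalfPlane z₀).symm ζ))).comp
        ((curveD I u ((extChartAt realHalfPlane z₀).symm ζ)).comp (chartSymmD z₀ ζ))) ζ :=
  (hasFDerivWithinAt_curveInChart hζ hu hp).hasFDerivAt (range_realHalfPlane_mem_nhds him)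

theorem IsJHolomorphic.fderiv_curveInChart_I_mul [IsManifold complexHalfPlane ∞ S]
    (hu : IsJHolomorphic J u) {z₀ : S} {p : X} {ζ : ℂ}
    (hζ : ζ ∈ (extChartAt realHalfPlane z₀).target) (him : 0 < ζ.im)
    (hp : u ((extChartAt realHalfPlane z₀).symm ζ) ∈ (chartAt H p).source) (v : ℂ) :
    fderiv ℝ (curveInChart I u z₀ p) ζ (Complex.I * v) =
      JInChart J p (curveInChart I u z₀ p ζ) (fderiv ℝ (curveInChart I u z₀ p) ζ v) := by
  rw [(hasFDerivAt_curveInChart hζ him (hu.mdifferentiableAt _) hp).fderiv]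
  simp only [ContinuousLinearMap.comp_apply]
  rw [chartSymmD_I_mul hζ, hu.curveD_I_mul]
  exact (JInChart_apply J hp _).symm

theorem IsPlurisubharmonicAt.extD_pos {g : X → ℝ} {p : X} (h : IsPlurisubharmonicAt J g p) {v : E}
    (hv : v ≠ 0) : 0 < extD (range I) (dcInChart J g p) (extChartAt I p p) v
      (JInChart J p (extChartAt I p p) v) := by
  rw [JInChart_self]
  exact h v hv

theorem IsJHolomorphic.contDiffAt_curveInChart [IsManifold complexHalfPlane ∞ S]
    (hu : IsJHolomorphic J u) {z₀ : S} {p : X} {ζ : ℂ}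
    (hζ : ζ ∈ (extChartAt realHalfPlane z₀).target) (him : 0 < ζ.im)
    (hp : u ((extChartAt realHalfPlane z₀).symm ζ) ∈ (chartAt H p).source) :
    ContDiffAt ℝ ∞ (curveInChart I u z₀ p) ζ := by
  have := isManifold_realHalfPlane S
  set z := (extChartAt realHalfPlane z₀).symm ζ with hz
  have hzs : z ∈ (extChartAt realHalfPlane z₀).source := (extChartAt realHalfPlane z₀).map_target hζ
  have hzi : z ∈ realHalfPlane.interior S := by
    rw [isInteriorPoint_iff_im_pos hzs, hz, (extChartAt realHalfPlane z₀).right_inv hζ]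
    exact him
  have h1 : ContMDiffAt realHalfPlane I ∞ u z := (hu.contMDiffOn_interior z hzi).contMDiffAt
    ((realHalfPlane.isOpen_interior (n := ∞) (by simp)).mem_nhds hzi)
  have h2 : ContMDiffAt 𝓘(ℝ, ℂ) realHalfPlane ∞ (extChartAt realHalfPlane z₀).symm ζ :=
    (contMDiffOn_extChartAt_symm (n := ∞) z₀ ζ hζ).contMDiffAt (target_mem_nhds_of_im_pos hζ him)
  have h3 : ContMDiffAt I 𝓘(ℝ, E) ∞ (extChartAt I p) (u z) := contMDiffAt_extChartAt' hp
  exact contMDiffAt_iff_contDiffAt.1 (h3.comp ζ (h1.comp ζ h2))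

/-- The Laplacian of a function along a holomorphic curve, computed in a chart. -/
theorem IsJHolomorphic.lap_eq [IsManifold complexHalfPlane ∞ S]
    (hu : IsJHolomorphic J u) {z₀ : S} {p : X} {ζ : ℂ}
    (hζ : ζ ∈ (extChartAt realHalfPlane z₀).target) (him : 0 < ζ.im)
    (hp : u ((extChartAt realHalfPlane z₀).symm ζ) ∈ (chartAt H p).source) {g : X → ℝ}
    (hg : ContDiffWithinAt ℝ 2 (g ∘ (extChartAt I p).symm) (range I) (curveInChart I u z₀ p ζ))
    (hJ : DifferentiableWithinAt ℝ (JInChart J p) (range I) (curveInChart I u z₀ p ζ)) :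
    ContDiffAt ℝ 2 (g ∘ u ∘ (extChartAt realHalfPlane z₀).symm) ζ ∧
    lap (g ∘ u ∘ (extChartAt realHalfPlane z₀).symm) ζ =
      extD (range I) (dcInChart J g p) (curveInChart I u z₀ p ζ)
        (fderiv ℝ (curveInChart I u z₀ p) ζ 1)
        (fderiv ℝ (curveInChart I u z₀ p) ζ Complex.I) := by
  have hev := hu.eventually_mem_source hζ him hp
  have hE : g ∘ u ∘ (extChartAt realHalfPlane z₀).symm =ᶠ[𝓝 ζ]
      (g ∘ (extChartAt I p).symm) ∘ curveInChart I u z₀ p := by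
    filter_upwards [hev] with ξ hξ
    simp only [curveInChart, Function.comp_apply]
    rw [(extChartAt I p).left_inv (by simpa using hξ.2.2)]
  have hc : ContDiffAt ℝ 2 (curveInChart I u z₀ p) ζ :=
    (hu.contDiffAt_curveInChart hζ him hp).of_le (by norm_cast)
  have hr : ∀ᶠ ξ in 𝓝 ζ, curveInChart I u z₀ p ξ ∈ range I :=
    Filter.Eventually.of_forall fun ξ => mem_range_self _
  refine ⟨(contDiffAt_comp_of_eventually_mem hc hr hg).congr_of_eventuallyEq hE, ?_⟩
  rw [lap_congr hE, dcInChart_eq]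
  refine lap_comp_eq_extD I.uniqueDiffOn hc hr hg hJ ?_
  filter_upwards [hev] with ξ hξ v
  exact hu.fderiv_curveInChart_I_mul hξ.1 hξ.2.1 hξ.2.2 v

/-- A plurisubharmonic function is subharmonic along a holomorphic curve, and strictly so where the
derivative does not vanish. -/
theorem IsJHolomorphic.lap_nonneg [IsManifold complexHalfPlane ∞ S]
    (hu : IsJHolomorphic J u) (hJ : IsAlmostComplex J) {z₀ : S}
    {ζ : ℂ} (hζ : ζ ∈ (extChartAt realHalfPlane z₀).target) (him : 0 < ζ.im) {g : X → ℝ}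
    (hg : ContMDiffAt I 𝓘(ℝ, ℝ) ∞ g (u ((extChartAt realHalfPlane z₀).symm ζ)))
    (hpsh : IsPlurisubharmonicAt J g (u ((extChartAt realHalfPlane z₀).symm ζ))) :
    ContDiffAt ℝ 2 (g ∘ u ∘ (extChartAt realHalfPlane z₀).symm) ζ ∧
    0 ≤ lap (g ∘ u ∘ (extChartAt realHalfPlane z₀).symm) ζ ∧
    (lap (g ∘ u ∘ (extChartAt realHalfPlane z₀).symm) ζ = 0 →
      fderiv ℝ (curveInChart I u z₀ (u ((extChartAt realHalfPlane z₀).symm ζ))) ζ = 0) := by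
  set q := u ((extChartAt realHalfPlane z₀).symm ζ) with hq
  have hqs := mem_chart_source H q
  have hcq : curveInChart I u z₀ q ζ = extChartAt I q q := rfl
  obtain ⟨h1, h2⟩ := hu.lap_eq hζ him hqs (g := g)
    (hcq ▸ (contDiffWithinAt_comp_extChartAt_symm hg).of_le (by norm_cast))
    (hcq ▸ (contDiffWithinAt_JInChart hJ q).differentiableWithinAt (by simp))
  have h3 := hu.fderiv_curveInChart_I_mul hζ him hqs 1
  rw [mul_one, hcq] at h3
  refine ⟨h1, ?_⟩
  rw [h2, hcq, h3]
  set a : E := fderiv ℝ (curveInChart I u z₀ q) ζ 1 with ha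
  -- By `J`-linearity the derivative of the curve is determined by its value `a` at `1`, and the
  -- Laplacian is `dd^J g (a, J a)`.
  by_cases h0 : a = 0
  · refine ⟨by simp [h0, extD], fun _ => ?_⟩
    refine ContinuousLinearMap.ext fun v => ?_
    have hv : v = v.re • (1 : ℂ) + v.im • Complex.I := by
      simp [Complex.re_add_im]
    rw [hv, map_add, map_smul, map_smul, ← ha, h3, h0, map_zero]
    simp
  · have hz := hpsh.extD_pos h0
    exact ⟨hz.le, fun h => absurd h hz.ne'⟩

end CurveCharts

/-! ### Unique continuation and maximum principles on a Riemann surface with boundary -/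

section SurfaceTopology

variable {S : Type*} [TopologicalSpace S] [ChartedSpace ClosedHalfPlane S]

theorem mem_closure_halfDisc {a ζ : ℂ} {R : ℝ} (h : ζ ∈ Metric.ball a R) (him : 0 ≤ ζ.im) :
    ζ ∈ closure (halfDisc a R) := by
  have hc : Filter.Tendsto (fun t : ℝ => ζ + t • Complex.I) (𝓝[>] 0) (𝓝 ζ) := by
    have := (hasDerivAt_line ζ Complex.I 0).continuousAt.continuousWithinAt (s := Ioi 0)
    simpa [ContinuousWithinAt] using this
  refine mem_closure_of_tendsto hc ?_
  filter_upwards [hc.eventually (Metric.isOpen_ball.mem_nhds h), self_mem_nhdsWithin] with t h1 h2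
  refine ⟨h1, ?_⟩
  have : (0 : ℝ) < t := h2
  simp
  linarith

/-- The part of a half-disc neighbourhood in the interior of the surface. -/
def innerNhd (z : S) (R : ℝ) : Set S :=
  (extChartAt realHalfPlane z).symm '' halfDisc (extChartAt realHalfPlane z z) R

/-- `R` is the radius of a half-disc contained in the target of the chart at `z`, with image in
`V`. -/
def IsChartRadius (z : S) (V : Set S) (R : ℝ) : Prop :=
  0 < R ∧ ∀ ζ ∈ Metric.ball (extChartAt realHalfPlane z z) R, 0 ≤ ζ.im →
    ζ ∈ (extChartAt realHalfPlane z).target ∧ (extChartAt realHalfPlane z).symm ζ ∈ V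

theorem exists_isChartRadius {z : S} {V : Set S} (hV : V ∈ 𝓝 z) : ∃ R, IsChartRadius z V R := by
  obtain ⟨R, h1, h2⟩ := exists_halfDisc_subset hV
  exact ⟨R, h1, h2⟩

variable {z : S} {V : Set S} {R : ℝ}

theorem IsChartRadius.mem (h : IsChartRadius z V R) {ζ : ℂ}
    (hζ : ζ ∈ halfDisc (extChartAt realHalfPlane z z) R) :
    ζ ∈ (extChartAt realHalfPlane z).target ∧ (extChartAt realHalfPlane z).symm ζ ∈ V :=
  h.2 ζ hζ.1 (le_of_lt hζ.2)

theorem IsChartRadius.isPreconnected (h : IsChartRadius z V R) :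
    IsPreconnected (innerNhd z R) :=
  (convex_halfDisc _ _).isPreconnected.image _
    ((continuousOn_extChartAt_symm z).mono fun _ hζ => (h.mem hζ).1)

/-- Pushing points in direction `i` shows that the interior half-disc is dense nearby. Closed
conditions verified on interior points thus extend to a full neighbourhood, also at boundary points.
-/
theorem IsChartRadius.eventually_mem_closure (h : IsChartRadius z V R) :
    ∀ᶠ w in 𝓝 z, w ∈ V ∧ w ∈ closure (innerNhd z R) := by
  filter_upwards [eventually_mem_halfDisc z h.1] with w hw
  obtain ⟨h1, h2, h3⟩ := hw
  have h4 := h.2 _ h2 h3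
  have h5 := (extChartAt realHalfPlane z).left_inv h1
  rw [h5] at h4
  refine ⟨h4.2, ?_⟩
  have h6 : ContinuousWithinAt (extChartAt realHalfPlane z).symm
      (halfDisc (extChartAt realHalfPlane z z) R) (extChartAt realHalfPlane z w) :=
    ((continuousOn_extChartAt_symm z) _ h4.1).mono fun _ hζ => (h.mem hζ).1
  have h7 := h6.mem_closure_image (mem_closure_halfDisc h2 h3)
  rwa [h5] at h7

theorem IsChartRadius.self_mem_closure (h : IsChartRadius z V R) : z ∈ closure (innerNhd z R) :=
  h.eventually_mem_closure.self_of_nhds.2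

/-- Closed sets containing the inner part of a half-disc neighbourhood are neighbourhoods. -/
theorem IsChartRadius.mem_nhds_of_isClosed (h : IsChartRadius z V R) {K : Set S} (hK : IsClosed K)
    (hsub : innerNhd z R ⊆ K) : K ∈ 𝓝 z := by
  filter_upwards [h.eventually_mem_closure] with w hw
  exact hK.closure_subset_iff.2 hsub hw.2

theorem eventually_of_eventually_chart {z : S} {P : S → Prop}
    (h : ∀ᶠ ζ in 𝓝 (extChartAt realHalfPlane z z), P ((extChartAt realHalfPlane z).symm ζ)) :
    ∀ᶠ w in 𝓝 z, P w := by
  filter_upwards [extChartAt_source_mem_nhds (I := realHalfPlane) z,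
    (continuousAt_extChartAt (I := realHalfPlane) z).eventually h] with w h1 h2
  rwa [(extChartAt realHalfPlane z).left_inv h1] at h2

/-- A holomorphic function on a Riemann surface with boundary. -/
def IsHolo (G : S → ℂ) : Prop :=
  ∀ z, MDifferentiableAt realHalfPlane 𝓘(ℝ, ℂ) G z ∧
    ∀ v, curveD 𝓘(ℝ, ℂ) G z (Complex.I * v) = Complex.I * curveD 𝓘(ℝ, ℂ) G z v

theorem IsHolo.continuous {G : S → ℂ} (h : IsHolo G) : Continuous G :=
  continuous_iff_continuousAt.2 fun z => (h z).1.continuousAt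

theorem IsHolo.inv {G : S → ℂ} (h : IsHolo G) (h0 : ∀ z, G z ≠ 0) : IsHolo fun z => (G z)⁻¹ := by
  intro z
  have h1 : HasFDerivAt (fun w : ℂ => w⁻¹)
      ((ContinuousLinearMap.toSpanSingleton ℂ (-((G z) ^ 2)⁻¹)).restrictScalars ℝ) (G z) :=
    (hasFDerivAt_inv (h0 z)).restrictScalars ℝ
  have h2 := h1.hasMFDerivAt.comp z (h z).1.hasMFDerivAt
  refine ⟨h2.mdifferentiableAt, fun v => ?_⟩
  have h3 : ∀ v, curveD 𝓘(ℝ, ℂ) (fun z => (G z)⁻¹) z v =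
      curveD 𝓘(ℝ, ℂ) G z v * (-((G z) ^ 2)⁻¹) := fun v => DFunLike.congr_fun h2.mfderiv v
  rw [h3, h3, (h z).2, mul_assoc]

variable [IsManifold complexHalfPlane ∞ S]

theorem IsChartRadius.innerNhd_subset (h : IsChartRadius z V R) :
    innerNhd z R ⊆ V ∩ realHalfPlane.interior S := by
  rintro _ ⟨ζ, hζ, rfl⟩
  have h1 := h.mem hζ
  refine ⟨h1.2, ?_⟩
  rw [isInteriorPoint_iff_im_pos ((extChartAt realHalfPlane z).map_target h1.1),
    (extChartAt realHalfPlane z).right_inv h1.1]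
  exact hζ.2

theorem exists_interior_mem {O : Set S} (hO : IsOpen O) (hn : O.Nonempty) :
    ∃ z ∈ O, z ∈ realHalfPlane.interior S := by
  obtain ⟨z, hz⟩ := hn
  obtain ⟨R, hR⟩ := exists_isChartRadius (hO.mem_nhds hz)
  obtain ⟨w, hw⟩ := closure_nonempty_iff.1 ⟨z, hR.self_mem_closure⟩
  exact ⟨w, hR.innerNhd_subset hw⟩

/-- Unique continuation: a closed set that is a neighbourhood of each of its interior points is
everything as soon as it contains an interior point. -/
theorem eq_univ_of_isClosed [PreconnectedSpace S] {K : Set S} (hK : IsClosed K)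
    (hn : ∀ z ∈ K, z ∈ realHalfPlane.interior S → K ∈ 𝓝 z)
    (hne : ∃ z ∈ K, z ∈ realHalfPlane.interior S) : K = univ := by
  -- Near a limit point of `interior K`, the inner half-disc is connected and consists of interior
  -- points of the surface. There every point of `K` lies in `interior K`, so the half-disc is
  -- covered by `interior K` and the open complement of `K`. It meets the former, hence lies in it,
  -- and closedness of `K` gives a neighbourhood.
  have key : closure (interior K) ⊆ interior K := by
    intro z hz
    rw [mem_interior_iff_mem_nhds]
    obtain ⟨R, hR⟩ := exists_isChartRadius (z := z) (V := univ) Filter.univ_mem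
    have hP := hR.isPreconnected
    refine hR.mem_nhds_of_isClosed hK ((hP.subset_left_of_subset_union isOpen_interior
      hK.isOpen_compl (disjoint_compl_right.mono_left interior_subset) ?_ ?_).trans interior_subset)
    · intro w hw
      by_cases hwK : w ∈ K
      · exact Or.inl (mem_interior_iff_mem_nhds.2 (hn w hwK (hR.innerNhd_subset hw).2))
      · exact Or.inr hwK
    · obtain ⟨w, h1, h2⟩ := mem_closure_iff_nhds.1 hz _ hR.eventually_mem_closure
      obtain ⟨x, hx1, hx2⟩ := mem_closure_iff.1 h1.2 _ isOpen_interior h2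
      exact ⟨x, hx2, hx1⟩
  have hclopen : IsClopen (interior K) :=
    ⟨isClosed_of_closure_subset key, isOpen_interior⟩
  obtain ⟨z, h1, h2⟩ := hne
  have := hclopen.eq_univ ⟨z, mem_interior_iff_mem_nhds.2 (hn z h1 h2)⟩
  exact eq_univ_of_univ_subset (this ▸ interior_subset)

/-- In a chart the map is constant on the open half-disc, and by continuity on a neighbourhood of
its centre, so no derivative at boundary points is needed. A locally constant map on a connected
surface is constant. -/
theorem exists_eq_of_curveD_eq_zero [PreconnectedSpace S] [Nonempty S]
    {E : Type*} [NormedAddCommGroup E] [NormedSpace ℝ E]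
    {H : Type*} [TopologicalSpace H] {I : ModelWithCorners ℝ E H}
    {X : Type*} [TopologicalSpace X] [ChartedSpace H X] [IsManifold I ∞ X] {u : S → X}
    (hu : ∀ z, MDifferentiableAt realHalfPlane I u z)
    (h0 : ∀ z ∈ realHalfPlane.interior S, curveD I u z = 0) : ∃ p, ∀ z, u z = p := by
  have hcont : Continuous u := continuous_iff_continuousAt.2 fun z => (hu z).continuousAt
  have hloc : IsLocallyConstant u := by
    rw [IsLocallyConstant.iff_eventually_eq]
    intro z
    have hVo : IsOpen (u ⁻¹' (chartAt H (u z)).source) :=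
      (chartAt H (u z)).open_source.preimage hcont
    obtain ⟨R, hR⟩ := exists_isChartRadius (hVo.mem_nhds (mem_chart_source H (u z)))
    set D := halfDisc (extChartAt realHalfPlane z z) R with hD
    have hderiv : ∀ ζ ∈ D, HasFDerivAt (curveInChart I u z (u z)) (0 : ℂ →L[ℝ] E) ζ := by
      intro ζ hζ
      have h1 := hasFDerivAt_curveInChart (I := I) (u := u) (p := u z) (hR.mem hζ).1 hζ.2 (hu _)
        (hR.mem hζ).2
      rwa [h0 _ (hR.innerNhd_subset ⟨ζ, hζ, rfl⟩).2, ContinuousLinearMap.zero_comp,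
        ContinuousLinearMap.comp_zero] at h1
    have hconst : ∀ a ∈ D, ∀ b ∈ D, curveInChart I u z (u z) a = curveInChart I u z (u z) b := by
      intro a ha b hb
      exact (isOpen_halfDisc _ _).is_const_of_fderiv_eq_zero (convex_halfDisc _ _).isPreconnected
        (fun x hx => (hderiv x hx).differentiableAt.differentiableWithinAt)
        (fun x hx => (hderiv x hx).fderiv) ha hb
    obtain ⟨w₀, ζ₀, hζ₀, rfl⟩ := closure_nonempty_iff.1 ⟨z, hR.self_mem_closure⟩
    have hval : ∀ w ∈ u ⁻¹' (chartAt H (u z)).source, w ∈ closure (innerNhd z R) →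
        extChartAt I (u z) (u w) = curveInChart I u z (u z) ζ₀ := by
      intro w hw hwc
      have hcw : ContinuousAt (fun w => extChartAt I (u z) (u w)) w :=
        ContinuousAt.comp (g := extChartAt I (u z)) (continuousAt_extChartAt' (by simpa using hw))
          hcont.continuousAt
      have h1 := hcw.continuousWithinAt.mem_closure_image hwc
      have h2 : (fun w => extChartAt I (u z) (u w)) '' innerNhd z R ⊆
          {curveInChart I u z (u z) ζ₀} := by
        rintro _ ⟨_, ⟨ζ, hζ, rfl⟩, rfl⟩
        exact hconst ζ hζ ζ₀ hζ₀
      have h3 := closure_mono h2 h1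
      rwa [closure_singleton] at h3
    have hz := hval z (mem_chart_source H (u z)) hR.self_mem_closure
    filter_upwards [hR.eventually_mem_closure] with w hw
    refine (extChartAt I (u z)).injOn (by simpa using hw.1) (by simp) ?_
    rw [hval w hw.1 hw.2, hz]
  obtain ⟨z₀⟩ := ‹Nonempty S›
  exact ⟨u z₀, fun z => hloc.apply_eq_of_isPreconnected isPreconnected_univ (mem_univ _)
    (mem_univ _)⟩

theorem tendsto_chart_symm {z : S} (hz : z ∈ realHalfPlane.interior S) :
    0 < (extChartAt realHalfPlane z z).im ∧
    Filter.Tendsto (extChartAt realHalfPlane z).symm (𝓝 (extChartAt realHalfPlane z z)) (𝓝 z) :=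
  ⟨(isInteriorPoint_iff_im_pos (mem_extChartAt_source z)).1 hz, by
    simpa [ContinuousAt] using continuousAt_extChartAt_symm (I := realHalfPlane) z⟩

/-- The local strong maximum principle for subharmonic functions. -/
theorem eventually_eq_of_subharmonic {g : S → ℝ} {z : S} (hz : z ∈ realHalfPlane.interior S)
    (hsub : ∀ᶠ ζ in 𝓝 (extChartAt realHalfPlane z z),
      ContDiffAt ℝ 2 (g ∘ (extChartAt realHalfPlane z).symm) ζ ∧
      0 ≤ lap (g ∘ (extChartAt realHalfPlane z).symm) ζ)
    (hmax : ∀ᶠ w in 𝓝 z, g w ≤ g z) : ∀ᶠ w in 𝓝 z, g w = g z := by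
  apply eventually_of_eventually_chart
  obtain ⟨r, hr, h⟩ := Metric.eventually_nhds_iff_ball.1
    (hsub.and ((tendsto_chart_symm hz).2.eventually hmax))
  have h3 : 3 * (r / 3) = r := by ring
  filter_upwards [Metric.ball_mem_nhds (extChartAt realHalfPlane z z)
    (show 0 < r / 3 by positivity)] with ζ hζ
  -- The minimum principle with `C = 0` for the nonnegative superharmonic function `g(z) - g`.
  have := eq_zero_on_ball_of_lap_le (v := fun ζ => g z - (g ∘ (extChartAt realHalfPlane z).symm) ζ)
    (z₀ := extChartAt realHalfPlane z z) (R := r / 3) le_rfl ?_ ?_ ?_ ?_ ζ hζ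
  · simp only [Function.comp_apply] at this
    linarith
  · intro x hx
    exact contDiffAt_const.sub (h x (h3 ▸ hx)).1.1
  · intro x hx
    exact sub_nonneg.2 (h x (h3 ▸ hx)).2
  · intro x hx
    rw [lap_const_sub, zero_mul]
    linarith [(h x (h3 ▸ hx)).1.2]
  · simp

/-- The global maximum principle. -/
theorem const_or_le_of_max_principle [CompactSpace S] [ConnectedSpace S] {g : S → ℝ}
    (hg : Continuous g) (hmax : ∀ z ∈ realHalfPlane.interior S, (∀ w, g w ≤ g z) →
      ∀ᶠ w in 𝓝 z, g w = g z) {c : ℝ} (hc : ∀ z ∈ realHalfPlane.boundary S, g z = c) :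
    (∃ m, ∀ z, g z = m) ∨ ∀ z, g z ≤ c := by
  obtain ⟨z₁, -, hz₁⟩ := isCompact_univ.exists_isMaxOn univ_nonempty hg.continuousOn
  have hz₁ : ∀ w, g w ≤ g z₁ := fun w => hz₁ (mem_univ w)
  -- If no interior point attains the maximum, a boundary point does, and the maximum is `c`. With
  -- empty boundary only the first case occurs.
  by_cases hi : ∃ z ∈ realHalfPlane.interior S, g z = g z₁
  · obtain ⟨z, hz, hzg⟩ := hi
    have hK : {w | g w = g z₁} = univ := by
      refine eq_univ_of_isClosed (isClosed_eq hg continuous_const) (fun x hx hxi => ?_) ⟨z, hzg, hz⟩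
      have hx : g x = g z₁ := hx
      have := hmax x hxi (fun w => hx ▸ hz₁ w)
      filter_upwards [this] with w hw
      exact hw.trans hx
    exact Or.inl ⟨g z₁, fun w => (hK ▸ mem_univ w : w ∈ {w | g w = g z₁})⟩
  · push Not at hi
    have hb : z₁ ∈ realHalfPlane.boundary S := by
      rw [← realHalfPlane.compl_interior]
      exact fun h => hi z₁ h rfl
    exact Or.inr fun w => (hz₁ w).trans (hc z₁ hb).le

theorem differentiableAt_complex_of_I_mul {f : ℂ → ℂ} {L : ℂ →L[ℝ] ℂ} {z : ℂ}
    (h : HasFDerivAt f L z) (hL : ∀ v, L (Complex.I * v) = Complex.I * L v) :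
    DifferentiableAt ℂ f z := by
  have hL' : ∀ c v : ℂ, L (c * v) = c * L v := by
    intro c v
    have h1 : c * v = c.re • v + c.im • (Complex.I * v) := by
      rw [Complex.real_smul, Complex.real_smul]
      nth_rewrite 1 [← Complex.re_add_im c]
      ring
    rw [h1, map_add, map_smul, map_smul, hL, Complex.real_smul, Complex.real_smul]
    nth_rewrite 3 [← Complex.re_add_im c]
    ring
  let A : ℂ →L[ℂ] ℂ := ⟨⟨⟨L, map_add L⟩, hL'⟩, L.continuous⟩
  have h2 : HasFDerivAt f A z := hasFDerivAt_of_restrictScalars ℝ h rfl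
  exact h2.differentiableAt

theorem IsHolo.eventually_eq_of_max {G : S → ℂ} (h : IsHolo G) {z : S}
    (hz : z ∈ realHalfPlane.interior S) (hmax : ∀ w, ‖G w‖ ≤ ‖G z‖) : ∀ᶠ w in 𝓝 z, G w = G z := by
  apply eventually_of_eventually_chart
  have ht := tendsto_chart_symm hz
  have hmem := mem_extChartAt_target (I := realHalfPlane) z
  have hd : ∀ᶠ ζ in 𝓝 (extChartAt realHalfPlane z z),
      DifferentiableAt ℂ (G ∘ (extChartAt realHalfPlane z).symm) ζ := by
    filter_upwards [target_mem_nhds_of_im_pos hmem ht.1,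
      (isOpen_lt continuous_const Complex.continuous_im).mem_nhds ht.1] with ζ h1 h2
    have h3 := hasFDerivAt_curveInChart (I := 𝓘(ℝ, ℂ)) (u := G)
      (p := G ((extChartAt realHalfPlane z).symm ζ)) h1 h2 (h _).1 (mem_chart_source _ _)
    rw [chartD_self] at h3
    refine differentiableAt_complex_of_I_mul h3 fun v => ?_
    simp only [ContinuousLinearMap.comp_apply, ContinuousLinearMap.id_apply]
    rw [chartSymmD_I_mul h1, (h _).2]
  have := Complex.eventually_eq_of_isLocalMax_norm hd (Filter.Eventually.of_forall fun ζ => by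
    simpa using hmax _)
  simpa using this

/-- A nowhere vanishing holomorphic function with constant modulus on the boundary is constant. -/
theorem IsHolo.const [CompactSpace S] [ConnectedSpace S] {G : S → ℂ} (h : IsHolo G)
    (h0 : ∀ z, G z ≠ 0) {c : ℝ} (hc : ∀ z ∈ realHalfPlane.boundary S, ‖G z‖ = c) :
    ∃ a, ∀ z, G z = a := by
  -- The maximum principle for `G` and for `1/G` bounds `‖G‖` by `c` from both sides, unless one of
  -- the moduli is already constant.
  have hnorm : ∃ m, ∀ z, ‖G z‖ = m := by
    have hi := h.inv h0
    have h1 := const_or_le_of_max_principle h.continuous.norm (c := c) (fun z hz hm => by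
      filter_upwards [h.eventually_eq_of_max hz hm] with w hw
      rw [hw]) hc
    have h2 := const_or_le_of_max_principle hi.continuous.norm (c := c⁻¹) (fun z hz hm => by
      filter_upwards [hi.eventually_eq_of_max hz hm] with w hw
      rw [hw]) (fun z hz => by rw [norm_inv, hc z hz])
    simp only [norm_inv] at h2
    rcases h1 with h1 | h1
    · exact h1
    rcases h2 with ⟨m, h2⟩ | h2
    · exact ⟨m⁻¹, fun z => by rw [← h2 z, inv_inv]⟩
    · refine ⟨c, fun z => le_antisymm (h1 z) ?_⟩
      have hz : 0 < ‖G z‖ := norm_pos_iff.2 (h0 z)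
      exact (inv_le_inv₀ hz (hz.trans_le (h1 z))).1 (h2 z)
  obtain ⟨m, hm⟩ := hnorm
  obtain ⟨z₁, -, hz₁⟩ := exists_interior_mem (S := S) isOpen_univ univ_nonempty
  have hK : {w | G w = G z₁} = univ := by
    refine eq_univ_of_isClosed (isClosed_eq h.continuous continuous_const) (fun x hx hxi => ?_)
      ⟨z₁, rfl, hz₁⟩
    filter_upwards [h.eventually_eq_of_max hxi fun w => by rw [hm, hm]] with w hw
    exact hw.trans hx
  exact ⟨G z₁, fun w => (hK ▸ mem_univ w : w ∈ {w | G w = G z₁})⟩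

end SurfaceTopology

/-! ### Maximum principle for plurisubharmonic functions and compositions -/

section Curves

variable {S : Type*} [TopologicalSpace S] [ChartedSpace ClosedHalfPlane S]
  {E : Type*} [NormedAddCommGroup E] [NormedSpace ℝ E]
  {H : Type*} [TopologicalSpace H] {I : ModelWithCorners ℝ E H}
  {X : Type*} [TopologicalSpace X] [ChartedSpace H X]
  {J : EndField I (X := X)} {u : S → X}

theorem IsJHolomorphic.isHolo_comp (hu : IsJHolomorphic J u) {Ψ : X → ℂ}
    (hΨ : ∀ p, ∃ L : E →L[ℝ] ℂ, HasMFDerivAt I 𝓘(ℝ, ℂ) Ψ p L ∧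
      ∀ v : E, L (J p v) = Complex.I * L v) : IsHolo (Ψ ∘ u) := by
  intro z
  obtain ⟨L, hL, hLJ⟩ := hΨ (u z)
  have h2 := hL.comp z (hu.mdifferentiableAt z).hasMFDerivAt
  refine ⟨h2.mdifferentiableAt, fun v => ?_⟩
  have h3 : ∀ v, curveD 𝓘(ℝ, ℂ) (Ψ ∘ u) z v = L (curveD I u z v) :=
    fun v => DFunLike.congr_fun h2.mfderiv v
  rw [h3, h3, hu.curveD_I_mul]
  exact hLJ _

theorem IsJHolomorphic.comp {E' : Type*} [NormedAddCommGroup E'] [NormedSpace ℝ E']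
    {H' : Type*} [TopologicalSpace H'] {I' : ModelWithCorners ℝ E' H'}
    {X' : Type*} [TopologicalSpace X'] [ChartedSpace H' X'] {J' : EndField I' (X := X')}
    (hu : IsJHolomorphic J u) {Ψ : X → X'} (hΨ : ∀ z, ContMDiffAt I I' ∞ Ψ (u z))
    (hΨJ : ∀ z (v : TangentSpace I (u z)), mfderiv I I' Ψ (u z) (J (u z) v) =
      J' (Ψ (u z)) (mfderiv I I' Ψ (u z) v)) : IsJHolomorphic J' (Ψ ∘ u) where
  contMDiff_one z := ((hΨ z).of_le (by norm_cast)).comp z (hu.contMDiff_one z)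
  contMDiffOn_interior z hz := (hΨ z).comp_contMDiffWithinAt z (hu.contMDiffOn_interior z hz)
  holomorphic z v := by
    have h2 := ((hΨ z).mdifferentiableAt (by simp)).hasMFDerivAt.comp z
      (hu.mdifferentiableAt z).hasMFDerivAt
    rw [h2.mfderiv]
    refine Eq.trans ?_ (hΨJ z _)
    exact congrArg (mfderiv I I' Ψ (u z)) (hu.holomorphic z v)

variable [IsManifold complexHalfPlane ∞ S] [IsManifold I ∞ X]

theorem IsJHolomorphic.eventually_subharmonic (hu : IsJHolomorphic J u) (hJ : IsAlmostComplex J)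
    {g : X → ℝ} (hg : ContMDiff I 𝓘(ℝ, ℝ) ∞ g) {z : S} (hz : z ∈ realHalfPlane.interior S)
    (hpsh : ∀ᶠ w in 𝓝 z, IsPlurisubharmonicAt J g (u w)) :
    ∀ᶠ ζ in 𝓝 (extChartAt realHalfPlane z z),
      ContDiffAt ℝ 2 ((g ∘ u) ∘ (extChartAt realHalfPlane z).symm) ζ ∧
      0 ≤ lap ((g ∘ u) ∘ (extChartAt realHalfPlane z).symm) ζ := by
  have ht := tendsto_chart_symm hz
  filter_upwards [target_mem_nhds_of_im_pos (mem_extChartAt_target (I := realHalfPlane) z) ht.1,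
      (isOpen_lt continuous_const Complex.continuous_im).mem_nhds ht.1,
      ht.2.eventually hpsh] with ζ h1 h2 h3
  have h4 := hu.lap_nonneg hJ h1 h2 (hg _) h3
  exact ⟨h4.1, h4.2.1⟩

/-- A locally constant `g ∘ u` has zero Laplacian, which strict plurisubharmonicity allows only
where the derivative of `u` vanishes. -/
theorem IsJHolomorphic.curveD_eq_zero (hu : IsJHolomorphic J u) (hJ : IsAlmostComplex J)
    {g : X → ℝ} (hg : ContMDiff I 𝓘(ℝ, ℝ) ∞ g) {z : S} (hz : z ∈ realHalfPlane.interior S)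
    (hpsh : IsPlurisubharmonicAt J g (u z)) (hconst : ∀ᶠ w in 𝓝 z, g (u w) = g (u z)) :
    curveD I u z = 0 := by
  have ht := tendsto_chart_symm hz
  have hinv : (extChartAt realHalfPlane z).symm (extChartAt realHalfPlane z z) = z := by simp
  have hmem := mem_extChartAt_target (I := realHalfPlane) z
  have h4 := (hu.lap_nonneg hJ hmem ht.1 (hg _) (by rwa [hinv])).2.2
  have h5 : lap (g ∘ u ∘ (extChartAt realHalfPlane z).symm) (extChartAt realHalfPlane z z) = 0 := by
    have : g ∘ u ∘ (extChartAt realHalfPlane z).symm =ᶠ[𝓝 (extChartAt realHalfPlane z z)]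
        fun _ => g (u z) := ht.2.eventually hconst
    rw [lap_congr this]
    simp [lap]
  have h6 := h4 h5
  have h7 := hasFDerivAt_curveInChart (I := I) (u := u) (p := u z) hmem ht.1
    (hu.mdifferentiableAt _) (by rw [hinv]; exact mem_chart_source H (u z))
  rw [hinv] at h6 h7
  rw [h7.fderiv, chartD_self] at h6
  have h8 : chartSymmD z (extChartAt realHalfPlane z z) = ContinuousLinearMap.id ℝ ℂ := by
    have := isManifold_realHalfPlane S
    have : IsManifold realHalfPlane 1 S := IsManifold.of_le (n := ∞) (by simp)
    exact mfderivWithin_range_extChartAt_symm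
  rwa [h8, ContinuousLinearMap.id_comp, ContinuousLinearMap.comp_id] at h6

end Curves

/-! ### The cylinder -/

section Cylinder

/-- The derivative of the inclusion of the circle into `ℂ`. -/
noncomputable def circleD (θ : Circle) : EuclideanSpace ℝ (Fin 1) →L[ℝ] ℂ :=
  mfderiv (𝓡 1) 𝓘(ℝ, ℂ) (fun τ : Circle => (τ : ℂ)) θ

theorem hasMFDerivAt_circle_coe (θ : Circle) :
    HasMFDerivAt (𝓡 1) 𝓘(ℝ, ℂ) (fun τ : Circle => (τ : ℂ)) θ (circleD θ) := by
  have : Fact (Module.finrank ℝ ℂ = 1 + 1) := ⟨Complex.finrank_real_complex⟩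
  have h : ContMDiff (𝓡 1) 𝓘(ℝ, ℂ) ∞ (fun τ : Circle => (τ : ℂ)) :=
    contMDiff_coe_sphere (E := ℂ) (n := 1)
  exact ((h θ).mdifferentiableAt (by simp)).hasMFDerivAt

theorem circleD_circleTangent (θ : Circle) : circleD θ (circleTangent θ) = Complex.I * θ := by
  have h1 : ContMDiff 𝓘(ℝ, ℝ) (𝓡 1) ∞ (fun t : ℝ => Circle.exp t * θ) :=
    contMDiff_circleExp.mul contMDiff_const
  have h2 := ((h1 0).mdifferentiableAt (by simp)).hasMFDerivAt
  have h3 := (hasMFDerivAt_circle_coe (Circle.exp 0 * θ)).comp 0 h2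
  have h4 : HasDerivAt (fun t : ℝ => Complex.exp (t * Complex.I) * (θ : ℂ)) (Complex.I * θ) 0 := by
    have h5 : HasDerivAt (fun t : ℝ => (t : ℂ) * Complex.I) Complex.I 0 := by
      simpa using (Complex.ofRealCLM.hasDerivAt (x := 0)).mul_const Complex.I
    simpa using h5.cexp.mul_const (θ : ℂ)
  have h6 : HasMFDerivAt 𝓘(ℝ, ℝ) 𝓘(ℝ, ℂ)
      ((fun τ : Circle => (τ : ℂ)) ∘ fun t : ℝ => Circle.exp t * θ) 0
      (ContinuousLinearMap.toSpanSingleton ℝ (Complex.I * (θ : ℂ))) := by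
    refine HasFDerivAt.hasMFDerivAt ?_
    have := h4.hasFDerivAt
    refine this.congr_of_eventuallyEq (Filter.Eventually.of_forall fun t => ?_)
    simp [Circle.coe_exp]
  have h7 := DFunLike.congr_fun (hasMFDerivAt_unique h3 h6) (1 : ℝ)
  have h8 : circleD (Circle.exp 0 * θ) (circleTangent θ) = Complex.I * θ := by
    refine h7.trans ?_
    exact one_smul ℝ _
  rwa [Circle.exp_zero, one_mul] at h8

/-- Differentiating `|τ|² = 1` shows that `conj θ` times a tangent vector is purely imaginary; its
imaginary part is `dφ` by definition. -/
theorem circleD_eq (θ : Circle) (a : EuclideanSpace ℝ (Fin 1)) :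
    circleD θ a = Complex.I * θ * (circleAngle θ a : ℝ) := by
  have h1 := ((hasStrictFDerivAt_norm_sq (θ : ℂ)).hasFDerivAt.hasMFDerivAt).comp θ
    (hasMFDerivAt_circle_coe θ)
  have h2 : HasMFDerivAt (𝓡 1) 𝓘(ℝ, ℝ) ((fun z : ℂ => ‖z‖ ^ 2) ∘ fun τ : Circle => (τ : ℂ)) θ
      (0 : EuclideanSpace ℝ (Fin 1) →L[ℝ] ℝ) := by
    have : ((fun z : ℂ => ‖z‖ ^ 2) ∘ fun τ : Circle => (τ : ℂ)) = fun _ => (1 : ℝ) := by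
      funext τ
      simp only [Function.comp_apply, Circle.norm_coe, one_pow]
    rw [this]
    exact hasMFDerivAt_const _ _
  have h3 := DFunLike.congr_fun (hasMFDerivAt_unique h1 h2) a
  have h4 : 2 * inner ℝ (θ : ℂ) (circleD θ a) = 0 := by
    have h3' : (2 • innerSL ℝ (θ : ℂ)) (circleD θ a) = 0 := h3
    rwa [_root_.smul_apply, innerSL_apply_apply, nsmul_eq_mul, Nat.cast_ofNat] at h3'
  have h5 : (starRingEnd ℂ (θ : ℂ) * circleD θ a).re = 0 := by
    have : inner ℝ (θ : ℂ) (circleD θ a) = (starRingEnd ℂ (θ : ℂ) * circleD θ a).re := by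
      rw [Complex.inner, mul_comm]
    rw [← this]; linarith
  have h6 : starRingEnd ℂ (θ : ℂ) * circleD θ a = Complex.I * (circleAngle θ a : ℝ) := by
    apply Complex.ext
    · rw [h5]; simp
    · have : circleAngle θ a = (starRingEnd ℂ (θ : ℂ) * circleD θ a).im := rfl
      rw [← this]; simp
  have h7 : (θ : ℂ) * starRingEnd ℂ (θ : ℂ) = 1 := by
    rw [Complex.mul_conj, Circle.normSq_coe, Complex.ofReal_one]
  calc circleD θ a = ((θ : ℂ) * starRingEnd ℂ (θ : ℂ)) * circleD θ a := by rw [h7, one_mul]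
    _ = θ * (starRingEnd ℂ (θ : ℂ) * circleD θ a) := by ring
    _ = _ := by rw [h6]; ring

/-- The holomorphic coordinate `e^{i (φ + i r)}` of the cylinder. -/
noncomputable def cylinderExp (p : Circle × ℝ) : ℂ := (p.1 : ℂ) * Real.exp (-p.2)

theorem cylinderExp_ne_zero (p : Circle × ℝ) : cylinderExp p ≠ 0 :=
  mul_ne_zero (Circle.coe_ne_zero _) (by exact_mod_cast (Real.exp_pos _).ne')

theorem norm_cylinderExp (p : Circle × ℝ) : ‖cylinderExp p‖ = Real.exp (-p.2) := by
  rw [cylinderExp, norm_mul, Circle.norm_coe, one_mul, Complex.norm_real,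
    Real.norm_of_nonneg (Real.exp_pos _).le]

theorem cylinderExp_injective : Function.Injective cylinderExp := by
  rintro ⟨θ, r⟩ ⟨θ', r'⟩ h
  have h1 := congrArg norm h
  rw [norm_cylinderExp, norm_cylinderExp, Real.exp_eq_exp, neg_inj] at h1
  have h1 : r = r' := h1
  subst h1
  have h2 : ((Real.exp (-r) : ℝ) : ℂ) ≠ 0 := by exact_mod_cast (Real.exp_pos _).ne'
  exact Prod.ext (Circle.ext (mul_right_cancel₀ h2 h)) rfl

/-- The coordinate `φ + ir` is only defined modulo `2π`. Its exponential is a global holomorphic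
function, nowhere zero and injective, whose modulus records `r`. -/
theorem hasMFDerivAt_cylinderExp (p : Circle × ℝ) :
    ∃ L : EuclideanSpace ℝ (Fin 1) × ℝ →L[ℝ] ℂ,
      HasMFDerivAt ((𝓡 1).prod 𝓘(ℝ, ℝ)) 𝓘(ℝ, ℂ) cylinderExp p L ∧
      ∀ v : EuclideanSpace ℝ (Fin 1) × ℝ, L (cylinderJ p v) = Complex.I * L v := by
  have h1 : HasMFDerivAt ((𝓡 1).prod 𝓘(ℝ, ℝ)) 𝓘(ℝ, ℂ) (fun q : Circle × ℝ => (q.1 : ℂ)) p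
      ((circleD p.1).comp (ContinuousLinearMap.fst ℝ (EuclideanSpace ℝ (Fin 1)) ℝ)) :=
    (hasMFDerivAt_circle_coe p.1).comp p (hasMFDerivAt_fst p)
  have h2 : HasDerivAt (fun r : ℝ => ((Real.exp (-r) : ℝ) : ℂ)) (-(Real.exp (-p.2) : ℝ) : ℂ) p.2 := by
    have := ((hasDerivAt_neg p.2).exp).ofReal_comp
    simpa using this
  have h3 : HasMFDerivAt ((𝓡 1).prod 𝓘(ℝ, ℝ)) 𝓘(ℝ, ℂ)
      (fun q : Circle × ℝ => ((Real.exp (-q.2) : ℝ) : ℂ)) p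
      ((ContinuousLinearMap.toSpanSingleton ℝ (-(Real.exp (-p.2) : ℝ) : ℂ)).comp
        (ContinuousLinearMap.snd ℝ (EuclideanSpace ℝ (Fin 1)) ℝ)) :=
    h2.hasFDerivAt.hasMFDerivAt.comp p (hasMFDerivAt_snd p)
  have h4 := h1.mul h3
  refine ⟨_, h4, ?_⟩
  rintro ⟨a, b⟩
  obtain ⟨t, ht⟩ : ∃ t : EuclideanSpace ℝ (Fin 1), t = circleTangent p.1 := ⟨_, rfl⟩
  have ht2 : circleD p.1 t = Complex.I * p.1 := by rw [ht, circleD_circleTangent]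
  have e1 : cylinderJ p (a, b) = (-(b • t), circleAngle p.1 a) := by rw [ht]; rfl
  refine (congrArg _ e1).trans ?_
  change (p.1 : ℂ) * ((circleAngle p.1 a) • (-(Real.exp (-p.2) : ℝ) : ℂ)) +
    ((Real.exp (-p.2) : ℝ) : ℂ) * circleD p.1 (-(b • t)) =
    Complex.I * ((p.1 : ℂ) * (b • (-(Real.exp (-p.2) : ℝ) : ℂ)) +
    ((Real.exp (-p.2) : ℝ) : ℂ) * circleD p.1 a)
  rw [map_neg, map_smul, ht2, circleD_eq, Complex.real_smul, Complex.real_smul, Complex.real_smul]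
  linear_combination (-p.1 * Real.exp (-p.2) * circleAngle p.1 a : ℂ) * Complex.I_sq

end Cylinder

/-! ### Curves in the model -/

section ModelCurves

/-- Since `x ≥ 1 - δ ≥ 0`, the term `x²/2` uses up at least `(1 - δ)²/2` of the budget `1/2`,
leaving at most `δ` for `f_F`. -/
theorem modelU_bounds {n : ℕ} {F : Type*} [TopologicalSpace F]
    [ChartedSpace (EuclideanSpace ℝ (Fin n)) F] {fF : Cotangent n F → ℝ} {δ : ℝ}
    (hf : ∀ ξ, 0 ≤ fF ξ) (hδ1 : δ ≤ 1) {p : ModelSpace n F}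
    (hp : p ∈ modelU fF δ) : fF p.2.2 ≤ δ ∧ |p.1.re| ≤ 1 := by
  obtain ⟨h1, -, h2⟩ := hp
  have h3 := hf p.2.2
  unfold modelf at h2
  constructor
  · nlinarith [sq_nonneg p.1.im, sq_nonneg p.2.1.2, sq_nonneg (p.1.re - (1 - δ)), sq_nonneg δ]
  · rw [← sq_le_one_iff_abs_le_one]
    nlinarith [sq_nonneg p.1.im, sq_nonneg p.2.1.2]

variable {n : ℕ} {F : Type*} [TopologicalSpace F] [ChartedSpace (EuclideanSpace ℝ (Fin n)) F]
  [IsManifold (𝓡 n) ∞ F]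
  {S : Type*} [TopologicalSpace S] [ChartedSpace ClosedHalfPlane S]
  {JF : EndField (cotI n) (X := Cotangent n F)} {fF : Cotangent n F → ℝ}

/-- Outside the plurisubharmonic neighbourhood of the zero section, a compact sublevel set stays
compact and `f_F` is positive on it, hence bounded below there. -/
theorem IsFiberFunction.exists_plurisubharmonic (h : IsFiberFunction JF fF) :
    ∃ δ > 0, ∀ ξ, fF ξ ≤ δ → IsPlurisubharmonicAt JF fF ξ := by
  obtain ⟨O, hO, hFO, hpsh⟩ := h.plurisubharmonic
  obtain ⟨c, hc, hcc⟩ := h.compact_sublevel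
  have hK : IsCompact ({ξ | fF ξ ≤ c} \ O) := hcc.diff hO
  rcases ({ξ | fF ξ ≤ c} \ O).eq_empty_or_nonempty with he | hne
  · refine ⟨c, hc, fun ξ hξ => hpsh ξ ?_⟩
    by_contra hn
    exact (he ▸ (⟨hξ, hn⟩ : ξ ∈ {ξ | fF ξ ≤ c} \ O) : ξ ∈ (∅ : Set _))
  · obtain ⟨ξ₀, hξ₀, hmin⟩ := hK.exists_isMinOn hne h.contMDiff.continuous.continuousOn
    have hpos : 0 < fF ξ₀ := lt_of_le_of_ne (h.nonneg ξ₀) fun h0 =>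
      hξ₀.2 (hFO ((h.eq_zero_iff ξ₀).1 h0.symm))
    refine ⟨min c (fF ξ₀ / 2), lt_min hc (half_pos hpos), fun ξ hξ => hpsh ξ ?_⟩
    by_contra hn
    have h1 : fF ξ₀ ≤ fF ξ := hmin ⟨hξ.trans (min_le_left _ _), hn⟩
    have h2 := hξ.trans (min_le_right _ _)
    linarith

variable [IsManifold complexHalfPlane ∞ S] [CompactSpace S] [ConnectedSpace S]

/-- The structure is a product, so each component is holomorphic and has its own maximum principle.
The cylinder comes last because its boundary condition is only useful once `x` is constant. -/
theorem exists_eq_of_mem_modelU (hJF : IsAlmostComplex JF) (hfF : IsFiberFunction JF fF)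
    {ε δ : ℝ} (hε1 : ε ≤ 1) (hδ1 : δ ≤ 1) (hpsh : ∀ ξ, fF ξ ≤ δ → IsPlurisubharmonicAt JF fF ξ)
    {u : S → ModelSpace n F} (hu : IsJHolomorphic (modelJ JF) u) (hU : ∀ z, u z ∈ modelU fF δ)
    (hN : ∀ z ∈ realHalfPlane.boundary S, u z ∈ modelN n F ε) : ∃ p, ∀ z, u z = p := by
  have hcu := hu.contMDiff_one.continuous
  -- the component in the cotangent bundle
  obtain ⟨ξ₀, hξ₀⟩ : ∃ ξ₀, ∀ z, (u z).2.2 = ξ₀ := by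
    have hξ : IsJHolomorphic JF ((fun p : ModelSpace n F => p.2.2) ∘ u) := by
      refine hu.comp (fun z => contMDiffAt_snd.comp _ contMDiffAt_snd) fun z v => ?_
      have h1 := (hasMFDerivAt_snd (I := (𝓡 1).prod 𝓘(ℝ, ℝ)) (I' := cotI n) (u z).2).comp (u z)
        (hasMFDerivAt_snd (I := 𝓘(ℝ, ℂ)) (I' := ((𝓡 1).prod 𝓘(ℝ, ℝ)).prod (cotI n)) (u z))
      have h2 : mfderiv (modelI n) (cotI n) (fun p : ModelSpace n F => p.2.2) (u z) = _ := h1.mfderiv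
      rw [h2]
      rfl
    have hgc : Continuous (fF ∘ fun z => (u z).2.2) :=
      hfF.contMDiff.continuous.comp hξ.contMDiff_one.continuous
    have hpshu : ∀ z, IsPlurisubharmonicAt JF fF (u z).2.2 := fun z =>
      hpsh _ (modelU_bounds hfF.nonneg hδ1 (hU z)).1
    have hmax := const_or_le_of_max_principle hgc (c := 0) (fun z hz hm =>
      eventually_eq_of_subharmonic hz (hξ.eventually_subharmonic hJF hfF.contMDiff hz
        (Filter.Eventually.of_forall hpshu)) (Filter.Eventually.of_forall hm)) (fun z hz => by
        obtain ⟨θ, r, q, -, -, h⟩ := hN z hz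
        rw [Function.comp_apply, h]
        exact (hfF.eq_zero_iff _).2 ⟨q, rfl⟩)
    have hconst : ∃ m, ∀ z, fF (u z).2.2 = m := by
      rcases hmax with h | h
      · exact h
      · exact ⟨0, fun z => le_antisymm (h z) (hfF.nonneg _)⟩
    obtain ⟨m, hm⟩ := hconst
    exact exists_eq_of_curveD_eq_zero (fun z => hξ.mdifferentiableAt z) fun z hz =>
      hξ.curveD_eq_zero hJF hfF.contMDiff hz (hpshu z)
        (Filter.Eventually.of_forall fun w => (hm w).trans (hm z).symm)
  -- the component in the complex plane
  obtain ⟨z₀, hz₀⟩ : ∃ z₀, ∀ z, (u z).1 = z₀ := by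
    -- The modulus of `exp(-i(x + iy))` is `e^y`, which is `1` on the boundary because `y = 0` on
    -- `N_mod`.
    have hG : IsHolo ((fun p : ModelSpace n F => Complex.exp (-Complex.I * p.1)) ∘ u) := by
      refine hu.isHolo_comp fun p => ?_
      have h1 : HasFDerivAt (fun z : ℂ => Complex.exp (-Complex.I * z)) _ p.1 :=
        (((hasDerivAt_id p.1).const_mul (-Complex.I)).cexp.hasFDerivAt.restrictScalars ℝ)
      have h2 := h1.hasMFDerivAt.comp p
        (hasMFDerivAt_fst (I := 𝓘(ℝ, ℂ)) (I' := ((𝓡 1).prod 𝓘(ℝ, ℝ)).prod (cotI n)) p)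
      refine ⟨_, h2, fun v => ?_⟩
      change (Complex.I * v.1) * _ = Complex.I * (v.1 * _)
      ring
    obtain ⟨a, ha⟩ := hG.const (fun z => Complex.exp_ne_zero _) (c := 1) fun z hz => by
      obtain ⟨θ, r, q, -, -, h⟩ := hN z hz
      rw [Function.comp_apply, h, Complex.norm_exp]
      simp
    obtain ⟨w⟩ : Nonempty S := inferInstance
    -- The exponential is injective on the image because `|x| ≤ 1 < π`.
    have hre : ∀ z, -Real.pi < (-Complex.I * (u z).1).im ∧ (-Complex.I * (u z).1).im ≤ Real.pi := by
      intro z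
      have h1 := abs_le.1 (modelU_bounds hfF.nonneg hδ1 (hU z)).2
      have h2 := Real.pi_gt_three
      constructor <;> simp <;> linarith [h1.1, h1.2]
    refine ⟨(u w).1, fun z => ?_⟩
    have := Complex.exp_inj_of_neg_pi_lt_of_le_pi (hre z).1 (hre z).2 (hre w).1 (hre w).2
      ((ha z).trans (ha w).symm)
    exact mul_left_cancel₀ (neg_ne_zero.2 Complex.I_ne_zero) this
  -- the component in the cylinder
  obtain ⟨b₀, hb₀⟩ : ∃ b₀, ∀ z, (u z).2.1 = b₀ := by
    have hG : IsHolo ((fun p : ModelSpace n F => cylinderExp p.2.1) ∘ u) := by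
      refine hu.isHolo_comp fun p => ?_
      obtain ⟨L, hL, hLJ⟩ := hasMFDerivAt_cylinderExp p.2.1
      have h1 := (hasMFDerivAt_fst (I := (𝓡 1).prod 𝓘(ℝ, ℝ)) (I' := cotI n) p.2).comp p
        (hasMFDerivAt_snd (I := 𝓘(ℝ, ℂ)) (I' := ((𝓡 1).prod 𝓘(ℝ, ℝ)).prod (cotI n)) p)
      exact ⟨_, hL.comp p h1, fun v => hLJ v.2.1⟩
    -- On the boundary `x = √(1 - r²)` with `0 ≤ r < 1`, so `r = √(1 - x²)` is determined by the
    -- constant value of `x`.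
    obtain ⟨a, ha⟩ := hG.const (fun z => cylinderExp_ne_zero _)
      (c := Real.exp (-Real.sqrt (1 - z₀.re ^ 2))) fun z hz => by
        obtain ⟨θ, r, q, h0, h1, h⟩ := hN z hz
        have h2 := hz₀ z
        rw [Function.comp_apply, norm_cylinderExp]
        rw [h] at h2 ⊢
        have h3 : z₀.re = Real.sqrt (1 - r ^ 2) := by rw [← h2]; simp
        have h4 : 0 ≤ 1 - r ^ 2 := by nlinarith
        rw [h3, Real.sq_sqrt h4, sub_sub_cancel, Real.sqrt_sq h0]
    obtain ⟨w⟩ : Nonempty S := inferInstance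
    exact ⟨(u w).2.1, fun z => cylinderExp_injective ((ha z).trans (ha w).symm)⟩
  exact ⟨(z₀, b₀, ξ₀), fun z => Prod.ext (hz₀ z) (Prod.ext (hb₀ z) (hξ₀ z))⟩

end ModelCurves

/-! ### Differentiable maps on convex sets -/

section ConvexCalculus

open Metric Filter

variable {E : Type*} [NormedAddCommGroup E] [NormedSpace ℝ E]

/-- The mean value inequality on a convex set, applied where the derivative is close to its value at
`y₀`. It controls increments along segments that do not pass through `y₀`. -/
theorem exists_strict_estimate {V : Type*} [NormedAddCommGroup V] [NormedSpace ℝ V] {K : Set E}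
    (hK : Convex ℝ K) (hKu : UniqueDiffOn ℝ K) {y₀ : E} (hy₀ : y₀ ∈ K) {ψ : E → V}
    (hψ : ContDiffWithinAt ℝ 1 ψ K y₀) {ε : ℝ} (hε : 0 < ε) :
    ∃ ρ > 0, ∀ a ∈ K ∩ ball y₀ ρ, ∀ b ∈ K ∩ ball y₀ ρ,
      ‖ψ a - ψ b - fderivWithin ℝ ψ K y₀ (a - b)‖ ≤ ε * ‖a - b‖ := by
  have h1 : ∀ᶠ y in 𝓝[K] y₀, DifferentiableWithinAt ℝ ψ K y := by
    have := hψ.eventually (by simp)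
    rw [insert_eq_of_mem hy₀] at this
    filter_upwards [this] with y hy using hy.differentiableWithinAt (by simp)
  have h2 : ∀ᶠ y in 𝓝[K] y₀, dist (fderivWithin ℝ ψ K y) (fderivWithin ℝ ψ K y₀) < ε :=
    (hψ.fderivWithin_right hKu (m := 0) (by simp) hy₀).continuousWithinAt.eventually
      (ball_mem_nhds _ hε)
  obtain ⟨ρ, hρ, h⟩ := mem_nhdsWithin_iff.1 (h1.and h2)
  refine ⟨ρ, hρ, fun a ha b hb => ?_⟩
  refine (hK.inter (convex_ball y₀ ρ)).norm_image_sub_le_of_norm_hasFDerivWithin_le'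
    (f' := fderivWithin ℝ ψ K) (fun x hx => ?_) (fun x hx => ?_) hb ha
  · exact (h ⟨hx.2, hx.1⟩).1.hasFDerivWithinAt.mono inter_subset_left
  · rw [← dist_eq_norm]
    exact (h ⟨hx.2, hx.1⟩).2.le

/-- Let `U` be a closed set that is open at its points with `ξ > 0`. If, in a chart `e` modelled on
a convex set, `U` contains points arbitrarily close to the centre towards which `ξ` grows linearly,
then `U` contains all points near the centre with `ξ ≥ 0`, and the distance to `U` is controlled by
the negative part of `ξ`. -/
theorem exists_dist_estimate {W : Type*} [TopologicalSpace W] {K : Set E} (hK : Convex ℝ K)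
    (hKu : UniqueDiffOn ℝ K) {y₀ : E} (hy₀ : y₀ ∈ K) {e : E → W} {ρ₀ : ℝ} (hρ₀ : 0 < ρ₀)
    (he : ContinuousOn e (K ∩ ball y₀ ρ₀)) {ξ : W → ℝ}
    (hξ : ContDiffWithinAt ℝ 1 (ξ ∘ e) K y₀) (hξc : ContinuousOn (ξ ∘ e) (K ∩ ball y₀ ρ₀))
    {U : Set W} (hU : IsClosed U) (hUi : IsOpen {p ∈ U | 0 < ξ p}) (h0 : ξ (e y₀) = 0)
    {κ : ℝ} (hκ : 0 < κ)
    (href : ∀ η > 0, ∃ y ∈ K ∩ ball y₀ η, e y ∈ U ∧ y ≠ y₀ ∧ κ * ‖y - y₀‖ ≤ ξ (e y)) :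
    ∃ ρ > 0, ∃ C ≥ 0, ∀ y ∈ K ∩ ball y₀ ρ, (0 ≤ ξ (e y) → e y ∈ U) ∧
      ∃ y' ∈ K ∩ ball y₀ ρ₀, y' ∈ closure {x ∈ K ∩ ball y₀ ρ₀ | e x ∈ U ∧ 0 < ξ (e x)} ∧
        ‖y - y'‖ ≤ C * max (-ξ (e y)) 0 := by
  set L := fderivWithin ℝ (ξ ∘ e) K y₀ with hL
  obtain ⟨ρ₁', hρ₁', hest'⟩ := exists_strict_estimate hK hKu hy₀ hξ (show 0 < κ / 8 by positivity)
  set ρ₁ := min ρ₁' ρ₀ with hρ₁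
  have hρ₁0 : 0 < ρ₁ := lt_min hρ₁' hρ₀
  -- A single reference point `y₁` of `U` suffices: every `y` much closer to `y₀` than `y₁` is
  -- joined to `y₁` by a segment along which `ξ` increases at a definite rate.
  obtain ⟨y₁, ⟨hy₁K, hy₁b⟩, hy₁U, hne, hy₁ξ⟩ := href ρ₁ hρ₁0
  set l := ‖y₁ - y₀‖ with hl
  have hl0 : 0 < l := norm_pos_iff.2 (sub_ne_zero.2 hne)
  have hlρ : l < ρ₁ := by rwa [mem_ball, dist_eq_norm] at hy₁b
  have hest : ∀ a ∈ K ∩ ball y₀ ρ₁, ∀ b ∈ K ∩ ball y₀ ρ₁,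
      |ξ (e a) - ξ (e b) - L (a - b)| ≤ κ / 8 * ‖a - b‖ := fun a ha b hb =>
    hest' a ⟨ha.1, ball_subset_ball (min_le_left _ _) ha.2⟩ b
      ⟨hb.1, ball_subset_ball (min_le_left _ _) hb.2⟩
  have hy₀b : y₀ ∈ K ∩ ball y₀ ρ₁ := ⟨hy₀, mem_ball_self hρ₁0⟩
  have hLy₁ : 7 / 8 * κ * l ≤ L (y₁ - y₀) := by
    have := (abs_le.1 (hest y₁ ⟨hy₁K, hy₁b⟩ y₀ hy₀b)).2
    rw [h0] at this
    linarith
  set η := min 1 (κ / (4 * (‖L‖ + 1))) with hη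
  have hη0 : 0 < η := lt_min one_pos (by positivity)
  have hηL : ‖L‖ * η ≤ κ / 4 := by
    have h1 : η ≤ κ / (4 * (‖L‖ + 1)) := min_le_right _ _
    rw [le_div_iff₀ (by positivity)] at h1
    nlinarith [norm_nonneg L]
  have hη1 : η ≤ 1 := min_le_left _ _
  -- From `L(y₁ - y₀) ≥ 7/8 κl`, subtract `κl/4` for `L(y - y₀)`, by the choice of `η`, and `κl/4`
  -- for the error `κ/8 · ‖y₁ - y‖` with `‖y₁ - y‖ ≤ 2l`.
  set c₁ := 3 / 8 * κ * l with hc₁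
  have hc₁0 : 0 < c₁ := by positivity
  refine ⟨η * l, by positivity, 2 * l / c₁, by positivity, fun y hy => ?_⟩
  obtain ⟨hyK, hyb⟩ := hy
  have hyl : ‖y - y₀‖ < η * l := by rwa [mem_ball, dist_eq_norm] at hyb
  have hyb₁ : y ∈ ball y₀ ρ₁ := by
    rw [mem_ball, dist_eq_norm]
    nlinarith
  have hy₁y : ‖y₁ - y‖ ≤ 2 * l := by
    have : y₁ - y = (y₁ - y₀) - (y - y₀) := by abel
    rw [this]
    have := norm_sub_le (y₁ - y₀) (y - y₀)
    nlinarith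
  set σ : ℝ → E := fun s => y + s • (y₁ - y) with hσ
  have hσc : Continuous σ := by fun_prop
  have hσK : ∀ s ∈ Icc (0 : ℝ) 1, σ s ∈ K ∩ ball y₀ ρ₁ := fun s hs =>
    (hK.inter (convex_ball y₀ ρ₁)).add_smul_sub_mem ⟨hyK, hyb₁⟩ ⟨hy₁K, hy₁b⟩ hs
  have hsub : K ∩ ball y₀ ρ₁ ⊆ K ∩ ball y₀ ρ₀ :=
    inter_subset_inter_right _ (ball_subset_ball (min_le_right _ _))
  have hgrow : ∀ s ∈ Icc (0 : ℝ) 1, ∀ t ∈ Icc (0 : ℝ) 1, s ≤ t →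
      (t - s) * c₁ ≤ ξ (e (σ t)) - ξ (e (σ s)) := by
    intro s hs t ht hst
    have h1 := (abs_le.1 (hest _ (hσK t ht) _ (hσK s hs))).1
    have h2 : σ t - σ s = (t - s) • (y₁ - y) := by simp only [hσ]; module
    rw [h2, map_smul, norm_smul, Real.norm_of_nonneg (sub_nonneg.2 hst), smul_eq_mul] at h1
    have h3 : L (y₁ - y) = L (y₁ - y₀) - L (y - y₀) := by rw [← map_sub]; congr 1; abel
    have h4 : L (y - y₀) ≤ κ / 4 * l := by
      have h5 := (le_abs_self _).trans (L.le_opNorm (y - y₀))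
      have h6 : ‖L‖ * ‖y - y₀‖ ≤ ‖L‖ * (η * l) := mul_le_mul_of_nonneg_left hyl.le (norm_nonneg _)
      nlinarith
    have h7 : c₁ ≤ L (y₁ - y) - κ / 8 * ‖y₁ - y‖ := by
      rw [h3, hc₁]
      nlinarith
    have h8 := mul_le_mul_of_nonneg_left h7 (sub_nonneg.2 hst)
    linarith
  have hσ1 : σ 1 = y₁ := by simp [hσ]
  have hσ0 : σ 0 = y := by simp [hσ]
  -- Once `ξ ≥ 0` on the segment it is positive afterwards. There `U` is both open and closed, so
  -- the connected remainder, which ends at `y₁` in `U`, lies in `U`.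
  have hclaim : ∀ s ∈ Ico (0 : ℝ) 1, 0 ≤ ξ (e (σ s)) →
      e (σ s) ∈ U ∧ σ s ∈ closure {x ∈ K ∩ ball y₀ ρ₀ | e x ∈ U ∧ 0 < ξ (e x)} := by
    intro s hs hs0
    have hpos : ∀ t ∈ Ioc s 1, 0 < ξ (e (σ t)) := by
      intro t ht
      have := hgrow s ⟨hs.1, hs.2.le⟩ t ⟨hs.1.trans ht.1.le, ht.2⟩ ht.1.le
      have := mul_pos (sub_pos.2 ht.1) hc₁0
      linarith
    have hmem : ∀ t ∈ Ioc s 1, σ t ∈ K ∩ ball y₀ ρ₀ := fun t ht =>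
      hsub (hσK t ⟨hs.1.trans ht.1.le, ht.2⟩)
    have hP : IsPreconnected ((e ∘ σ) '' Ioc s 1) :=
      isPreconnected_Ioc.image _ (he.comp hσc.continuousOn hmem)
    have hPU : (e ∘ σ) '' Ioc s 1 ⊆ {p ∈ U | 0 < ξ p} := by
      refine hP.subset_left_of_subset_union hUi hU.isOpen_compl ?_ ?_ ?_
      · exact disjoint_compl_right.mono_left fun p hp => hp.1
      · rintro _ ⟨t, ht, rfl⟩
        by_cases h : e (σ t) ∈ U
        · exact Or.inl ⟨h, hpos t ht⟩
        · exact Or.inr h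
      · refine ⟨y₁ |> e, ⟨1, ⟨hs.2, le_rfl⟩, by simp [hσ1]⟩, hy₁U, ?_⟩
        have := hpos 1 ⟨hs.2, le_rfl⟩
        rwa [hσ1] at this
    have hcl : σ s ∈ closure {x ∈ K ∩ ball y₀ ρ₀ | e x ∈ U ∧ 0 < ξ (e x)} := by
      have h1 : σ s ∈ closure (σ '' Ioc s 1) := by
        refine hσc.continuousWithinAt.mem_closure_image ?_
        rw [closure_Ioc hs.2.ne]
        exact ⟨le_rfl, hs.2.le⟩
      refine closure_mono ?_ h1
      rintro _ ⟨t, ht, rfl⟩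
      exact ⟨hmem t ht, hPU ⟨t, ht, rfl⟩⟩
    refine ⟨?_, hcl⟩
    have h2 := ((he _ (hsub (hσK s ⟨hs.1, hs.2.le⟩))).mono (fun x hx => hx.1)).mem_closure_image hcl
    refine hU.closure_subset_iff.2 ?_ h2
    rintro _ ⟨x, hx, rfl⟩
    exact hx.2.1
  refine ⟨fun h => ?_, ?_⟩
  · have := (hclaim 0 ⟨le_rfl, one_pos⟩ (by rwa [hσ0])).1
    rwa [hσ0] at this
  · rcases le_or_gt 0 (ξ (e y)) with h | h
    · refine ⟨y, hsub ⟨hyK, hyb₁⟩, ?_, by simp; positivity⟩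
      have := (hclaim 0 ⟨le_rfl, one_pos⟩ (by rwa [hσ0])).2
      rwa [hσ0] at this
    · have hc : ContinuousOn (fun s => ξ (e (σ s))) (Icc 0 1) :=
        hξc.comp hσc.continuousOn fun s hs => hsub (hσK s hs)
      have hy₁pos : 0 < ξ (e y₁) := lt_of_lt_of_le (by positivity) hy₁ξ
      -- The nearby point is where the segment crosses `ξ = 0`; the growth rate bounds the parameter
      -- `s` of the crossing by `-ξ(y)/c₁`.
      obtain ⟨s, hs, hs0⟩ := intermediate_value_Icc zero_le_one hc
        (show (0 : ℝ) ∈ Icc _ _ by simp only [hσ0, hσ1]; exact ⟨h.le, hy₁pos.le⟩)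
      have hs0 : ξ (e (σ s)) = 0 := hs0
      have hs1 : s < 1 := by
        refine lt_of_le_of_ne hs.2 ?_
        rintro rfl
        rw [hσ1] at hs0
        exact hy₁pos.ne' hs0
      refine ⟨σ s, hsub (hσK s hs), (hclaim s ⟨hs.1, hs1⟩ hs0.ge).2, ?_⟩
      have h1 := hgrow 0 ⟨le_rfl, zero_le_one⟩ s hs hs.1
      rw [hs0, hσ0, sub_zero, zero_sub] at h1
      have h2 : ‖y - σ s‖ = s * ‖y₁ - y‖ := by
        have : y - σ s = -(s • (y₁ - y)) := by simp only [hσ]; abel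
        rw [this, norm_neg, norm_smul, Real.norm_of_nonneg hs.1]
      rw [h2, max_eq_left (by linarith)]
      calc s * ‖y₁ - y‖ ≤ s * (2 * l) := mul_le_mul_of_nonneg_left hy₁y hs.1
        _ = 2 * l / c₁ * (s * c₁) := by field_simp
        _ ≤ 2 * l / c₁ * -ξ (e y) := mul_le_mul_of_nonneg_left h1 (by positivity)

variable {V : Type*} [NormedAddCommGroup V] [NormedSpace ℝ V] [FiniteDimensional ℝ E]

/-- An injective linear map on a finite-dimensional space is bounded below, and the error of the
linear approximation absorbs only half of that bound. -/
theorem exists_norm_sub_le_of_injective {Ξ : E → V} {T : E →L[ℝ] V} {K : Set E} {a : E}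
    (h : HasFDerivWithinAt Ξ T K a) (hT : Function.Injective T) :
    ∃ C > 0, ∀ᶠ b in 𝓝[K] a, ‖b - a‖ ≤ C * ‖Ξ b - Ξ a‖ := by
  obtain ⟨C, hC, hTC⟩ := (T : E →ₗ[ℝ] V).exists_antilipschitzWith (LinearMap.ker_eq_bot.2 hT)
  have hC' : (0 : ℝ) < C := hC
  refine ⟨2 * C, by positivity, ?_⟩
  have h1 := (hasFDerivWithinAt_iff_isLittleO.1 h).def (show (0 : ℝ) < 1 / (2 * C) by positivity)
  filter_upwards [h1] with b hb
  have h2 : ‖b - a‖ ≤ C * ‖T (b - a)‖ := by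
    have := hTC.le_mul_dist (b - a) 0
    simpa using this
  have h3 : ‖T (b - a)‖ ≤ ‖Ξ b - Ξ a‖ + ‖Ξ b - Ξ a - T (b - a)‖ := by
    have := norm_sub_le (Ξ b - Ξ a) (Ξ b - Ξ a - T (b - a))
    rwa [sub_sub_cancel] at this
  have h4 : C * (1 / (2 * C) * ‖b - a‖) = ‖b - a‖ / 2 := by field_simp
  have h5 : C * ‖T (b - a)‖ ≤ C * (‖Ξ b - Ξ a‖ + 1 / (2 * C) * ‖b - a‖) := by gcongr; linarith
  rw [mul_add, h4] at h5
  linarith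

/-- A limit of difference quotients of points in the image of an immersion lies in the range of the
derivative. -/
theorem mem_range_of_tendsto_slope {Ξ : E → V} {T : E →L[ℝ] V} {K : Set E} {a : E}
    (h : HasFDerivWithinAt Ξ T K a) (hT : Function.Injective T) {ι : Type*} {l : Filter ι} [l.NeBot]
    {b : ι → E} (hb : Tendsto b l (𝓝[K] a)) {t : ι → ℝ} {w : V}
    (hw : Tendsto (fun i => (t i)⁻¹ • (Ξ (b i) - Ξ a)) l (𝓝 w)) :
    w ∈ range T := by
  obtain ⟨C, hC, hCb⟩ := exists_norm_sub_le_of_injective h hT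
  have hclosed : IsClosed (range T) := by
    have : (range T : Set V) = (LinearMap.range (T : E →ₗ[ℝ] V) : Set V) := rfl
    rw [this]
    exact Submodule.closed_of_finiteDimensional _
  have hlim : Tendsto (fun i => (t i)⁻¹ • T (b i - a)) l (𝓝 w) := by
    -- The error is small relative to `‖b - a‖`, which is at most `C ‖Ξ b - Ξ a‖`; after division by
    -- `t` the latter stays bounded because the difference quotients converge.
    have hz : Tendsto (fun i => (t i)⁻¹ • (Ξ (b i) - Ξ a - T (b i - a))) l (𝓝 0) := by
      rw [tendsto_zero_iff_norm_tendsto_zero]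
      refine (Metric.tendsto_nhds.2 fun η hη => ?_)
      have hN := hw.norm.eventually (gt_mem_nhds (lt_add_one ‖w‖))
      have h1 := (hasFDerivWithinAt_iff_isLittleO.1 h).def
        (show (0 : ℝ) < η / (C * (‖w‖ + 1)) by positivity)
      filter_upwards [hN, hb.eventually h1, hb.eventually hCb] with i h2 h3 h4
      rw [dist_zero_right, norm_norm, norm_smul]
      rw [norm_smul] at h2
      have h5 : 0 ≤ ‖(t i)⁻¹‖ := norm_nonneg _
      calc ‖(t i)⁻¹‖ * ‖Ξ (b i) - Ξ a - T (b i - a)‖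
          ≤ ‖(t i)⁻¹‖ * (η / (C * (‖w‖ + 1)) * (C * ‖Ξ (b i) - Ξ a‖)) := by
            gcongr
            exact h3.trans (by gcongr)
        _ = η / (‖w‖ + 1) * (‖(t i)⁻¹‖ * ‖Ξ (b i) - Ξ a‖) := by field_simp
        _ < η / (‖w‖ + 1) * (‖w‖ + 1) := by gcongr
        _ = η := by field_simp
    have := hw.sub hz
    rw [sub_zero] at this
    refine this.congr fun i => ?_
    rw [← smul_sub, sub_sub_cancel]
  refine hclosed.mem_of_tendsto hlim (Eventually.of_forall fun i => ?_)
  exact ⟨(t i)⁻¹ • (b i - a), map_smul _ _ _⟩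

end ConvexCalculus

/-! ### Topology -/

section Topology

open Filter

/-- The inverse of an injective continuous map on a compact set is continuous. -/
theorem tendsto_of_tendsto_comp {X Y ι : Type*} [TopologicalSpace X] [TopologicalSpace Y]
    [T2Space Y] {U : Set X} (hU : IsCompact U) {c : X → Y} (hc : ∀ p ∈ U, ContinuousAt c p)
    (hinj : InjOn c U) {l : Filter ι} {x : ι → X} {p : X} (hp : p ∈ U) (hx : ∀ᶠ i in l, x i ∈ U)
    (hlim : Tendsto (c ∘ x) l (𝓝 (c p))) : Tendsto x l (𝓝 p) := by
  refine hU.tendsto_nhds_of_unique_mapClusterPt hx fun q hq hcl => ?_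
  have h1 : MapClusterPt (c q) l (c ∘ x) := hcl.continuousAt_comp (hc q hq)
  by_contra hne
  have h2 : c q ≠ c p := fun h => hne (hinj hq hp h)
  have h3 := (h1.clusterPt.mono (hlim : map (c ∘ x) l ≤ 𝓝 (c p)))
  exact h2 (eq_of_nhds_neBot h3)

/-- Points over different base points are separated in the base, points of one fibre in a local
trivialization. Applied to `T^*F`, this makes limits in the model unique. -/
theorem t2Space_totalSpace {B F : Type*} {E : B → Type*} [TopologicalSpace B] [TopologicalSpace F]
    [TopologicalSpace (Bundle.TotalSpace F E)] [∀ b, TopologicalSpace (E b)] [FiberBundle F E]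
    [T2Space B] [T2Space F] : T2Space (Bundle.TotalSpace F E) := by
  refine ⟨fun x y hne => ?_⟩
  by_cases h : x.proj = y.proj
  · set e := trivializationAt F E x.proj with he
    have hx : x ∈ e.source := by rw [e.mem_source]; exact mem_baseSet_trivializationAt F E _
    have hy : y ∈ e.source := by
      rw [e.mem_source, ← h]; exact mem_baseSet_trivializationAt F E _
    have hne' : e x ≠ e y := fun h => hne (e.injOn hx hy h)
    obtain ⟨A, B', hA, hB, hxA, hyB, hd⟩ := t2_separation hne'
    refine ⟨_, _, e.continuousOn.isOpen_inter_preimage e.open_source hA,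
      e.continuousOn.isOpen_inter_preimage e.open_source hB, ⟨hx, hxA⟩, ⟨hy, hyB⟩, ?_⟩
    exact (hd.preimage e).mono inter_subset_right inter_subset_right
  · obtain ⟨A, B', hA, hB, hxA, hyB, hd⟩ := t2_separation h
    have hc : Continuous (Bundle.TotalSpace.proj : Bundle.TotalSpace F E → B) :=
      FiberBundle.continuous_proj F E
    exact ⟨_, _, hA.preimage hc, hB.preimage hc, hxA, hyB, hd.preimage _⟩

end Topology

/-! ### The real part of a partially holomorphic function -/

section PartiallyHolomorphic

open Metric Filter

variable {E : Type*} [NormedAddCommGroup E] [NormedSpace ℝ E]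
  {H : Type*} [TopologicalSpace H] {I : ModelWithCorners ℝ E H}
  {X : Type*} [TopologicalSpace X] [ChartedSpace H X]
  {E' : Type*} [NormedAddCommGroup E'] [NormedSpace ℝ E']
  {H' : Type*} [TopologicalSpace H'] {I' : ModelWithCorners ℝ E' H'}
  {X' : Type*} [TopologicalSpace X'] [ChartedSpace H' X']

/-- The derivative of a map between manifolds, as a linear map between the model spaces. -/
noncomputable def mapD (I : ModelWithCorners ℝ E H) (I' : ModelWithCorners ℝ E' H') (f : X → X')
    (p : X) : E →L[ℝ] E' := mfderiv I I' f p

/-- The derivative of an inverse chart. -/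
noncomputable def symmD (I : ModelWithCorners ℝ E H) (p : X) (y : E) : E →L[ℝ] E :=
  mfderivWithin 𝓘(ℝ, E) I (extChartAt I p).symm (range I) y

variable [IsManifold I ∞ X]

theorem chartD_symmD {p : X} {y : E} (hy : y ∈ (extChartAt I p).target) (v : E) :
    chartD I p ((extChartAt I p).symm y) (symmD I p y v) = v :=
  DFunLike.congr_fun (mfderiv_extChartAt_comp_mfderivWithin_extChartAt_symm (I := I) hy) v

theorem symmD_chartD {p : X} {q : X} (hq : q ∈ (extChartAt I p).source) (v : E) :
    symmD I p (extChartAt I p q) (chartD I p q v) = v :=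
  DFunLike.congr_fun (mfderivWithin_extChartAt_symm_comp_mfderiv_extChartAt' (I := I) hq) v

theorem hasFDerivWithinAt_comp_extChartAt_symm {Z : X → E'} {p : X} {y : E}
    (hy : y ∈ (extChartAt I p).target)
    (hZ : MDifferentiableAt I 𝓘(ℝ, E') Z ((extChartAt I p).symm y)) :
    HasFDerivWithinAt (Z ∘ (extChartAt I p).symm)
      ((mapD I 𝓘(ℝ, E') Z ((extChartAt I p).symm y)).comp (symmD I p y)) (range I) y := by
  have h1 := (mdifferentiableWithinAt_extChartAt_symm (I := I) hy).hasMFDerivWithinAt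
  exact hasMFDerivWithinAt_iff_hasFDerivWithinAt.1 (hZ.hasMFDerivAt.comp_hasMFDerivWithinAt y h1)

/-- The Cauchy–Riemann equations: `-d(Re Z) ∘ J = d(Im Z)` where `Z` is holomorphic. Hence `d^J Re
Z` is exact on open sets of holomorphy and `dd^J Re Z = 0` there. -/
theorem dcInChart_re_eq_fderivWithin_im {J : EndField I (X := X)} {Z : X → ℂ} {p : X} {y : E}
    (hy : y ∈ (extChartAt I p).target)
    (hZ : MDifferentiableAt I 𝓘(ℝ, ℂ) Z ((extChartAt I p).symm y))
    (hol : ∀ v : E, mapD I 𝓘(ℝ, ℂ) Z ((extChartAt I p).symm y) (J ((extChartAt I p).symm y) v) =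
      Complex.I * mapD I 𝓘(ℝ, ℂ) Z ((extChartAt I p).symm y) v) :
    dcInChart J (fun q => (Z q).re) p y =
      fderivWithin ℝ ((fun q => (Z q).im) ∘ (extChartAt I p).symm) (range I) y := by
  set q := (extChartAt I p).symm y with hq
  have hu : UniqueDiffWithinAt ℝ (range I) y := I.uniqueDiffOn _ (extChartAt_target_subset_range p hy)
  have h := hasFDerivWithinAt_comp_extChartAt_symm hy hZ
  have hre := (Complex.reCLM.hasFDerivAt.comp_hasFDerivWithinAt y h).fderivWithin hu
  have him := (Complex.imCLM.hasFDerivAt.comp_hasFDerivWithinAt y h).fderivWithin hu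
  have hqs : q ∈ (chartAt H p).source := by
    simpa only [extChartAt_source] using (extChartAt I p).map_target hy
  have hqs' : q ∈ (extChartAt I p).source := (extChartAt I p).map_target hy
  have hyq : extChartAt I p q = y := (extChartAt I p).right_inv hy
  rw [dcInChart_eq]
  refine ContinuousLinearMap.ext fun w => ?_
  have h1 : JInChart J p y w = chartD I p q (J q (symmD I p y w)) := by
    have := JInChart_apply J hqs (symmD I p y w)
    rwa [chartD_symmD hy, hyq] at this
  have h2 : symmD I p y (JInChart J p y w) = (J q (symmD I p y w) : E) := by
    rw [h1, ← hyq]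
    exact symmD_chartD hqs' _
  have hre' := DFunLike.congr_fun hre (JInChart J p y w)
  have him' := DFunLike.congr_fun him w
  refine (congrArg Neg.neg hre').trans (Eq.trans ?_ him'.symm)
  simp only [ContinuousLinearMap.comp_apply]
  rw [h2, hol, ← hq, Complex.reCLM_apply, Complex.imCLM_apply, Complex.I_mul_re, neg_neg]

/-- Although `Z` is holomorphic only on `U`, the form `dd^J Re Z` vanishes on the closure of the
open part `Re Z > a` of `U` and is Lipschitz. At a nearby point it is therefore bounded by the
distance to that closure, which `exists_dist_estimate` bounds by the negative part of `Re Z - a`. -/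
theorem exists_extD_estimate {J : EndField I (X := X)}
    (hJ : IsAlmostComplex J) {O : Set X} (hO : IsOpen O) {Z : X → ℂ}
    (hZ : ContMDiffOn I 𝓘(ℝ, ℂ) ∞ Z O) {U : Set X} (hUO : U ⊆ O) (hU : IsClosed U)
    (hol : ∀ p ∈ U, ∀ v : E, mapD I 𝓘(ℝ, ℂ) Z p (J p v) = Complex.I * mapD I 𝓘(ℝ, ℂ) Z p v)
    {a : ℝ} (hUi : IsOpen {p ∈ U | 0 < (Z p).re - a}) {p : X} (hp : p ∈ U) (hpa : a ≤ (Z p).re)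
    (href : (Z p).re = a → ∃ κ > 0, ∀ η > 0, ∃ y ∈ range I ∩ ball (extChartAt I p p) η,
      (extChartAt I p).symm y ∈ U ∧ y ≠ extChartAt I p p ∧
        κ * ‖y - extChartAt I p p‖ ≤ (Z ((extChartAt I p).symm y)).re - a) :
    ∃ ρ > 0, ∃ C ≥ 0, ∀ y ∈ range I ∩ ball (extChartAt I p p) ρ,
      ContDiffWithinAt ℝ 2 ((fun q => (Z q).re) ∘ (extChartAt I p).symm) (range I) y ∧
      DifferentiableWithinAt ℝ (JInChart J p) (range I) y ∧
      (a ≤ (Z ((extChartAt I p).symm y)).re → (extChartAt I p).symm y ∈ U) ∧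
      ∀ v w, |extD (range I) (dcInChart J (fun q => (Z q).re) p) y v w| ≤
        C * max (a - (Z ((extChartAt I p).symm y)).re) 0 * (‖v‖ * ‖w‖) := by
  set K := range I with hK
  set y₀ := extChartAt I p p with hy₀
  set e := (extChartAt I p).symm with he
  set g : X → ℝ := fun q => (Z q).re with hg
  set θ := dcInChart J g p with hθ
  have hKu : UniqueDiffOn ℝ K := I.uniqueDiffOn
  have hy₀K : y₀ ∈ K := mem_range_self _
  have hpO : p ∈ O := hUO hp
  have hZat : ∀ q ∈ O, ContMDiffAt I 𝓘(ℝ, ℂ) ∞ Z q := fun q hq => hZ.contMDiffAt (hO.mem_nhds hq)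
  have hZp : ContDiffWithinAt ℝ ∞ (Z ∘ e) K y₀ := (contMDiffAt_iff.1 (hZat p hpO)).2
  have hgp : ContDiffWithinAt ℝ ∞ (g ∘ e) K y₀ := Complex.reCLM.contDiff.comp_contDiffWithinAt hZp
  have hkp : ContDiffWithinAt ℝ ∞ ((fun q => (Z q).im) ∘ e) K y₀ :=
    Complex.imCLM.contDiff.comp_contDiffWithinAt hZp
  have hJp : ContDiffWithinAt ℝ ∞ (JInChart J p) K y₀ := contDiffWithinAt_JInChart hJ p
  have hθp : ContDiffWithinAt ℝ 2 θ K y₀ := by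
    have h1 : ContDiffWithinAt ℝ 2 (fderivWithin ℝ (g ∘ e) K) K y₀ :=
      hgp.fderivWithin_right hKu (by norm_cast) hy₀K
    exact (h1.clm_comp (hJp.of_le (by norm_cast))).neg
  have hDθ : ContDiffWithinAt ℝ 1 (fderivWithin ℝ θ K) K y₀ :=
    hθp.fderivWithin_right hKu (by norm_num) hy₀K
  obtain ⟨Lc, t, ht, hLip⟩ := hDθ.exists_lipschitzOnWith I.convex_range
  have hec : ContinuousAt e y₀ := continuousAt_extChartAt_symm p
  have hey₀ : e y₀ = p := extChartAt_to_inv p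
  have htar : (extChartAt I p).target ∈ 𝓝[K] y₀ := extChartAt_target_mem_nhdsWithin p
  have hev : ∀ᶠ y in 𝓝[K] y₀, y ∈ t ∧ y ∈ (extChartAt I p).target ∧ e y ∈ O ∧
      ContDiffWithinAt ℝ 2 (g ∘ e) K y ∧ ContDiffWithinAt ℝ 2 ((fun q => (Z q).im) ∘ e) K y ∧
      DifferentiableWithinAt ℝ (JInChart J p) K y := by
    have h1 := (hgp.of_le (show (2 : ℕ∞ω) ≤ ∞ by norm_cast)).eventually (by simp)
    have h2 := (hJp.of_le (show (2 : ℕ∞ω) ≤ ∞ by norm_cast)).eventually (by simp)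
    have h3 := (hkp.of_le (show (2 : ℕ∞ω) ≤ ∞ by norm_cast)).eventually (by simp)
    rw [insert_eq_of_mem hy₀K] at h1 h2 h3
    have h4 : ∀ᶠ y in 𝓝[K] y₀, e y ∈ O :=
      hec.continuousWithinAt.preimage_mem_nhdsWithin (hO.mem_nhds (by rwa [hey₀]))
    filter_upwards [ht, htar, h1, h2, h3, h4] with y b1 b2 b3 b4 b5 b6
    exact ⟨b1, b2, b6, b3, b5, b4.differentiableWithinAt (by simp)⟩
  obtain ⟨ρ₀, hρ₀, hb⟩ := mem_nhdsWithin_iff.1 hev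
  have hb : ∀ y ∈ K ∩ ball y₀ ρ₀, _ := fun y hy => hb ⟨hy.2, hy.1⟩
  have hecont : ContinuousOn e (K ∩ ball y₀ ρ₀) :=
    (continuousOn_extChartAt_symm p).mono fun y hy => (hb y hy).2.1
  have hzero : ∀ y ∈ K ∩ ball y₀ ρ₀, e y ∈ U → 0 < g (e y) - a → ∀ v w, extD K θ y v w = 0 := by
    intro y hy hyU hya v w
    obtain ⟨-, b2, b3, b4, b5, b6⟩ := hb y hy
    refine extD_eq_zero_of_eventuallyEq_fderivWithin hKu hy.1 (I.range_subset_closure_interior hy.1)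
      b5 ?_ v w
    have h1 : e ⁻¹' {p ∈ U | 0 < (Z p).re - a} ∈ 𝓝[K] y :=
      (continuousAt_extChartAt_symm'' b2).continuousWithinAt.preimage_mem_nhdsWithin
        (hUi.mem_nhds ⟨hyU, hya⟩)
    have h2 : (extChartAt I p).target ∈ 𝓝[K] y := extChartAt_target_mem_nhdsWithin_of_mem b2
    filter_upwards [h1, h2] with x hx1 hx2
    exact dcInChart_re_eq_fderivWithin_im hx2
      ((hZat _ (hUO hx1.1)).mdifferentiableAt (by simp)) (hol _ hx1.1)
  have hLe : ∀ y ∈ K ∩ ball y₀ ρ₀, ∀ y' ∈ K ∩ ball y₀ ρ₀, ∀ v w,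
      |extD K θ y v w - extD K θ y' v w| ≤ 2 * Lc * ‖y - y'‖ * (‖v‖ * ‖w‖) := by
    intro y hy y' hy' v w
    have h1 := hLip.dist_le_mul y (hb y hy).1 y' (hb y' hy').1
    rw [dist_eq_norm, dist_eq_norm] at h1
    set D := fderivWithin ℝ θ K y - fderivWithin ℝ θ K y' with hD
    have h2 : extD K θ y v w - extD K θ y' v w = D v w - D w v := by
      simp only [extD, hD, _root_.sub_apply]
      ring
    have h3 : ∀ v w, |D v w| ≤ Lc * ‖y - y'‖ * (‖v‖ * ‖w‖) := fun v w => by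
      have h4 := D.le_opNorm₂ v w
      rw [Real.norm_eq_abs, mul_assoc] at h4
      exact h4.trans (mul_le_mul_of_nonneg_right h1 (by positivity))
    rw [h2]
    have h5 := abs_sub (D v w) (D w v)
    have h6 := h3 v w
    have h7 := h3 w v
    rw [mul_comm ‖w‖ ‖v‖] at h7
    linarith
  -- If `Re Z > a` at `p`, a whole neighbourhood lies in the open part of `U` and `C = 0` works; the
  -- distance estimate is needed only for `Re Z = a`.
  have hmain : ∃ ρ > 0, ∃ C ≥ 0, ∀ y ∈ K ∩ ball y₀ ρ, (0 ≤ g (e y) - a → e y ∈ U) ∧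
      ∃ y' ∈ K ∩ ball y₀ ρ₀, y' ∈ closure {x ∈ K ∩ ball y₀ ρ₀ | e x ∈ U ∧ 0 < g (e x) - a} ∧
        ‖y - y'‖ ≤ C * max (-(g (e y) - a)) 0 := by
    rcases hpa.eq_or_lt with h | h
    · obtain ⟨κ, hκ, hr⟩ := href h.symm
      refine exists_dist_estimate (ξ := fun q => g q - a) I.convex_range hKu hy₀K hρ₀ hecont
        ((hgp.sub contDiffWithinAt_const).of_le (by norm_cast)) ?_ hU hUi ?_ hκ hr
      · exact fun y hy => ((hb y hy).2.2.2.1.sub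
          (contDiffWithinAt_const (c := a))).continuousWithinAt.mono inter_subset_left
      · rw [hey₀, h]
        exact sub_self _
    · have h1 : ∀ᶠ y in 𝓝[K] y₀, e y ∈ {p ∈ U | 0 < (Z p).re - a} :=
        hec.continuousWithinAt.preimage_mem_nhdsWithin
          (hUi.mem_nhds (by rw [hey₀]; exact ⟨hp, sub_pos.2 h⟩))
      obtain ⟨ρ₁, hρ₁, h2⟩ := mem_nhdsWithin_iff.1 h1
      refine ⟨min ρ₁ ρ₀, lt_min hρ₁ hρ₀, 0, le_rfl, fun y hy => ?_⟩
      have hy1 : e y ∈ {p ∈ U | 0 < (Z p).re - a} :=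
        h2 ⟨ball_subset_ball (min_le_left _ _) hy.2, hy.1⟩
      have hy2 : y ∈ K ∩ ball y₀ ρ₀ := ⟨hy.1, ball_subset_ball (min_le_right _ _) hy.2⟩
      exact ⟨fun _ => hy1.1, y, hy2, subset_closure ⟨hy2, hy1⟩, by simp⟩
  obtain ⟨ρ, hρ, C, hC, hest⟩ := hmain
  refine ⟨min ρ ρ₀, lt_min hρ hρ₀, 2 * Lc * C, by positivity, fun y hy => ?_⟩
  have hy2 : y ∈ K ∩ ball y₀ ρ₀ := ⟨hy.1, ball_subset_ball (min_le_right _ _) hy.2⟩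
  obtain ⟨-, -, -, b4, -, b6⟩ := hb y hy2
  obtain ⟨h1, y', hy', hcl, hd⟩ := hest y ⟨hy.1, ball_subset_ball (min_le_left _ _) hy.2⟩
  refine ⟨b4, b6, fun h => h1 (sub_nonneg.2 h), fun v w => ?_⟩
  -- Exactness holds at points of the open part; continuity of the derivative of `θ` carries it to
  -- the limit point `y'`.
  have h0 : extD K θ y' v w = 0 := by
    set s := {x ∈ K ∩ ball y₀ ρ₀ | e x ∈ U ∧ 0 < g (e x) - a} with hs
    have hsb : s ⊆ K ∩ ball y₀ ρ₀ := fun x hx => hx.1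
    have hcont : ContinuousWithinAt (fun x => extD K θ x v w) s y' := by
      have h3 : ContinuousWithinAt (fderivWithin ℝ θ K) s y' :=
        (hLip.continuousOn y' (hb y' hy').1).mono fun x hx => (hb x (hsb hx)).1
      exact ((h3.clm_apply continuousWithinAt_const).clm_apply continuousWithinAt_const).sub
        ((h3.clm_apply continuousWithinAt_const).clm_apply continuousWithinAt_const)
    have h4 := hcont.mem_closure_image hcl
    have h5 : (fun x => extD K θ x v w) '' s ⊆ {0} := by
      rintro _ ⟨x, hx, rfl⟩
      exact hzero x hx.1 hx.2.1 hx.2.2 v w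
    exact closure_minimal h5 isClosed_singleton h4
  have h3 := hLe y hy2 y' hy' v w
  rw [h0, sub_zero] at h3
  refine h3.trans ?_
  have h4 : -(g (e y) - a) = a - (Z (e y)).re := by simp only [hg]; ring
  rw [h4] at hd
  calc 2 * Lc * ‖y - y'‖ * (‖v‖ * ‖w‖)
      ≤ 2 * Lc * (C * max (a - (Z (e y)).re) 0) * (‖v‖ * ‖w‖) := by gcongr
    _ = _ := by ring

end PartiallyHolomorphic

/-! ### Model neighbourhoods -/

section ModelNeighborhood

open Metric Filter

variable {n : ℕ} {F : Type*} [TopologicalSpace F] [ChartedSpace (EuclideanSpace ℝ (Fin n)) F]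
  [IsManifold (𝓡 n) ∞ F] {JF : EndField (cotI n) (X := Cotangent n F)} {fF : Cotangent n F → ℝ}
  {ε δ : ℝ} {E : Type*} [NormedAddCommGroup E] [NormedSpace ℝ E]
  {H : Type*} [TopologicalSpace H] {I : ModelWithCorners ℝ E H}
  {W : Type*} [TopologicalSpace W] [ChartedSpace H W] {J : EndField I (X := W)}
  {N U : Set W} {c : W → ModelSpace n F}

theorem IsModelNeighborhood.contMDiffAt (h : IsModelNeighborhood JF fF ε δ J N U c) {p : W}
    (hp : p ∈ U) : ContMDiffAt I (modelI n) ∞ c p := by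
  obtain ⟨O, hO, hUO, hc, -, -⟩ := h.smoothEmbedding
  exact hc.contMDiffAt (hO.mem_nhds (hUO hp))

theorem IsModelNeighborhood.injOn (h : IsModelNeighborhood JF fF ε δ J N U c) : InjOn c U := by
  obtain ⟨O, hO, hUO, -, hc, -⟩ := h.smoothEmbedding
  exact hc.mono hUO

theorem IsModelNeighborhood.mapsTo (h : IsModelNeighborhood JF fF ε δ J N U c) {p : W}
    (hp : p ∈ U) : c p ∈ modelU fF δ := h.image_eq ▸ mem_image_of_mem c hp

theorem IsModelNeighborhood.injective_mapD (h : IsModelNeighborhood JF fF ε δ J N U c) {p : W}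
    (hp : p ∈ U) : Function.Injective (mapD I (modelI n) c p) := by
  obtain ⟨O, hO, hUO, -, -, hc⟩ := h.smoothEmbedding
  exact (hc p (hUO hp)).1

/-- The coordinate expression of the embedding into the model. -/
theorem IsModelNeighborhood.hasFDerivWithinAt (h : IsModelNeighborhood JF fF ε δ J N U c) {p : W}
    (hp : p ∈ U) : HasFDerivWithinAt
      (extChartAt (modelI n) (c p) ∘ c ∘ (extChartAt I p).symm)
      (mapD I (modelI n) c p) (range I) (extChartAt I p p) :=
  ((h.contMDiffAt hp).mdifferentiableAt (by simp)).hasMFDerivAt.2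

/-- Restricted to the compact set `U`, `c` is a homeomorphism onto its image in a Hausdorff space.
Paths drawn in the model thus lift to `W` with the correct limit. -/
theorem IsModelNeighborhood.tendsto [T2Space F] (h : IsModelNeighborhood JF fF ε δ J N U c)
    {ι : Type*} {l : Filter ι} {x : ι → W} {p : W} (hp : p ∈ U) (hx : ∀ᶠ i in l, x i ∈ U)
    (hlim : Tendsto (c ∘ x) l (𝓝 (c p))) : Tendsto x l (𝓝 p) := by
  have : T2Space (Cotangent n F) := t2Space_totalSpace
  exact tendsto_of_tendsto_comp h.isCompact (fun q hq => (h.contMDiffAt hq).continuousAt) h.injOn hp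
    hx hlim

/-- If the ray from `c p` in direction `∂_x - C ∂_r` starts inside the model neighbourhood, then
there are points of `U` close to `p` towards which `x` grows linearly. -/
theorem IsModelNeighborhood.exists_linear_growth [T2Space F] [FiniteDimensional ℝ E]
    (h : IsModelNeighborhood JF fF ε δ J N U c) {p : W} (hp : p ∈ U) {C : ℝ}
    (hray : ∀ᶠ τ : ℝ in 𝓝[>] 0,
      (((c p).1 + τ, ((c p).2.1.1, (c p).2.1.2 - C * τ), (c p).2.2) : ModelSpace n F) ∈
        modelU fF δ) :
    ∃ κ > 0, ∀ η > 0, ∃ y ∈ range I ∩ ball (extChartAt I p p) η,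
      (extChartAt I p).symm y ∈ U ∧ y ≠ extChartAt I p p ∧
        κ * ‖y - extChartAt I p p‖ ≤ (c ((extChartAt I p).symm y)).1.re - (c p).1.re := by
  set γ : ℝ → ModelSpace n F := fun τ =>
    ((c p).1 + τ, ((c p).2.1.1, (c p).2.1.2 - C * τ), (c p).2.2) with hγ
  have hγc : Continuous γ := by fun_prop
  have hγ0 : γ 0 = c p := by simp [hγ]
  have hex : ∀ τ, ∃ x : W, γ τ ∈ modelU fF δ → x ∈ U ∧ c x = γ τ := by
    intro τ
    by_cases hτ : γ τ ∈ modelU fF δ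
    · rw [← h.image_eq] at hτ
      obtain ⟨x, hx, hcx⟩ := hτ
      exact ⟨x, fun _ => ⟨hx, hcx⟩⟩
    -- An arbitrary value, for parameters at which the ray is not in the model neighbourhood.
    · exact ⟨p, fun h => absurd h hτ⟩
  choose x hx using hex
  have hxU : ∀ᶠ τ in 𝓝[>] (0 : ℝ), x τ ∈ U ∧ c (x τ) = γ τ := hray.mono fun τ hτ => hx τ hτ
  have hγl : Tendsto γ (𝓝[>] 0) (𝓝 (c p)) :=
    hγ0 ▸ (hγc.tendsto 0).mono_left nhdsWithin_le_nhds
  have hxl : Tendsto x (𝓝[>] (0 : ℝ)) (𝓝 p) :=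
    h.tendsto hp (hxU.mono fun _ h => h.1) (hγl.congr' (hxU.mono fun _ h => h.2.symm))
  obtain ⟨C', hC', hev⟩ := exists_norm_sub_le_of_injective (h.hasFDerivWithinAt hp)
    (h.injective_mapD hp)
  have hyl : Tendsto (fun τ => extChartAt I p (x τ)) (𝓝[>] (0 : ℝ))
      (𝓝[range I] (extChartAt I p p)) :=
    tendsto_nhdsWithin_iff.2 ⟨(continuousAt_extChartAt p).tendsto.comp hxl,
      Eventually.of_forall fun _ => mem_range_self _⟩
  have hsrc : ∀ᶠ τ in 𝓝[>] (0 : ℝ), x τ ∈ (extChartAt I p).source :=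
    hxl.eventually (extChartAt_source_mem_nhds p)
  -- Along the ray `x` grows by `τ`, the model coordinates move by at most `(1 + |C|)τ`, and the
  -- chart of `W` by at most `C'` times that.
  refine ⟨(C' * (1 + |C|))⁻¹, by positivity, fun η hη => ?_⟩
  have hball : ∀ᶠ τ in 𝓝[>] (0 : ℝ), extChartAt I p (x τ) ∈ ball (extChartAt I p p) η :=
    (tendsto_nhdsWithin_iff.1 hyl).1.eventually (ball_mem_nhds _ hη)
  obtain ⟨τ, h1, h2, h3, h4, h5⟩ := (hxU.and (hsrc.and (hball.and ((hyl.eventually hev).and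
    self_mem_nhdsWithin)))).exists
  have hτ : 0 < τ := h5
  have hinv : (extChartAt I p).symm (extChartAt I p (x τ)) = x τ := (extChartAt I p).left_inv h2
  have hdiff : (c (x τ)).1.re - (c p).1.re = τ := by simp [h1.2, hγ]
  refine ⟨extChartAt I p (x τ), ⟨mem_range_self _, h3⟩, ?_, ?_, ?_⟩
  · rw [hinv]; exact h1.1
  · intro heq
    have : x τ = p := (extChartAt I p).injOn h2 (mem_extChartAt_source p) heq
    rw [this, sub_self] at hdiff
    exact hτ.ne hdiff
  · rw [hinv, hdiff, inv_mul_le_iff₀ (by positivity)]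
    refine h4.trans ?_
    rw [mul_assoc]
    refine mul_le_mul_of_nonneg_left ?_ hC'.le
    simp only [Function.comp_apply, hinv, extChartAt_to_inv, h1.2]
    have hC : 0 ≤ |C| * τ := by positivity
    simp only [hγ, extChartAt_prod, extChartAt_model_space_eq_id, PartialEquiv.prod_coe,
      PartialEquiv.refl_coe, id_eq, Prod.mk_sub_mk, sub_self, add_sub_cancel_left]
    refine max_le ?_ (max_le (max_le ?_ ?_) ?_)
    · simp [abs_of_pos hτ]; nlinarith
    · simp; positivity
    · simp [abs_of_pos hτ]; nlinarith
    · simp; positivity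

end ModelNeighborhood

/-! ### Tangent spaces of embedded submanifolds -/

section TangentVectors

open Metric Filter

variable {E : Type*} [NormedAddCommGroup E] [NormedSpace ℝ E]
  {H : Type*} [TopologicalSpace H] {I : ModelWithCorners ℝ E H}
  {X : Type*} [TopologicalSpace X] [ChartedSpace H X]
  {E' : Type*} [NormedAddCommGroup E'] [NormedSpace ℝ E']
  {H' : Type*} [TopologicalSpace H'] {I' : ModelWithCorners ℝ E' H'}
  {Y : Type*} [TopologicalSpace Y] [ChartedSpace H' Y]
  {E'' : Type*} [NormedAddCommGroup E''] [NormedSpace ℝ E'']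
  {H'' : Type*} [TopologicalSpace H''] {I'' : ModelWithCorners ℝ E'' H''}
  {M : Type*} [TopologicalSpace M] [ChartedSpace H'' M]

theorem mapD_comp {g : Y → M} {f : X → Y} {p : X} (hg : MDifferentiableAt I' I'' g (f p))
    (hf : MDifferentiableAt I I' f p) :
    mapD I I'' (g ∘ f) p = (mapD I' I'' g (f p)).comp (mapD I I' f p) :=
  mfderiv_comp p hg hf

/-- A limit of difference quotients of points of an embedded submanifold is tangent to it. -/
theorem IsEmbeddedSubmanifold.mem_range_of_tendsto_slope [FiniteDimensional ℝ E]
    {f : X → Y} (hf : IsEmbeddedSubmanifold I I' f) {a : X} {g : Y → M}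
    (hg : MDifferentiableAt I' I'' g (f a)) (hgi : Function.Injective (mapD I' I'' g (f a)))
    {ι : Type*} {l : Filter ι} [l.NeBot] {x : ι → Y} (hx : ∀ᶠ i in l, x i ∈ range f)
    (hxl : Tendsto x l (𝓝 (f a))) {t : ι → ℝ} {w : E''}
    (hw : Tendsto (fun i => (t i)⁻¹ • (extChartAt I'' (g (f a)) (g (x i)) -
      extChartAt I'' (g (f a)) (g (f a)))) l (𝓝 w)) :
    w ∈ range (mapD I I'' (g ∘ f) a) := by
  have hfa : MDifferentiableAt I I' f a := (hf.contMDiff a).mdifferentiableAt (by simp)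
  have hD := (hg.comp a hfa).hasMFDerivAt.2
  have hinj : Function.Injective (mapD I I'' (g ∘ f) a) := by
    rw [mapD_comp hg hfa]
    exact hgi.comp (hf.injective_mfderiv a)
  have hex : ∀ i, ∃ b : X, x i ∈ range f → f b = x i := fun i => by
    by_cases h : x i ∈ range f
    · obtain ⟨b, hb⟩ := h
      exact ⟨b, fun _ => hb⟩
    · exact ⟨a, fun h' => absurd h' h⟩
  choose b hb using hex
  have hb : ∀ᶠ i in l, f (b i) = x i := hx.mono fun i hi => hb i hi
  -- This is where the submanifold must be embedded and not just immersed: convergence in the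
  -- ambient space forces convergence of the parameters.
  have hbl : Tendsto b l (𝓝 a) :=
    hf.isEmbedding.tendsto_nhds_iff.2 (hxl.congr' (hb.mono fun i hi => hi.symm))
  have hyl : Tendsto (fun i => extChartAt I a (b i)) l (𝓝[range I] (extChartAt I a a)) :=
    tendsto_nhdsWithin_iff.2 ⟨(continuousAt_extChartAt a).tendsto.comp hbl,
      Eventually.of_forall fun _ => mem_range_self _⟩
  refine CodimOneModel.mem_range_of_tendsto_slope (t := t) hD hinj hyl (hw.congr' ?_)
  filter_upwards [hb, hbl.eventually (extChartAt_source_mem_nhds (I := I) a)] with i h1 h2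
  simp only [writtenInExtChartAt, Function.comp_apply]
  rw [extChartAt_to_inv, (extChartAt I a).left_inv h2, h1]

/-- The derivative of a map along a ray in a chart is a limit of difference quotients. -/
theorem tendsto_slope_of_mdifferentiableAt {f : X → M} {a : X} (hf : MDifferentiableAt I I'' f a)
    {v : E} {l : Filter ℝ} (hl : l ≤ 𝓝[≠] 0)
    (hv : ∀ᶠ s : ℝ in l, extChartAt I a a + s • v ∈ range I) :
    Tendsto (fun s : ℝ => s⁻¹ • (extChartAt I'' (f a)
      (f ((extChartAt I a).symm (extChartAt I a a + s • v))) - extChartAt I'' (f a) (f a)))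
      l (𝓝 (mapD I I'' f a v)) := by
  have hD : HasFDerivWithinAt (writtenInExtChartAt I I'' a f) (mapD I I'' f a) (range I)
    (extChartAt I a a) := hf.hasMFDerivAt.2
  have hl0 : Tendsto (fun s : ℝ => s) l (𝓝 0) := hl.trans nhdsWithin_le_nhds
  have hd : Tendsto (fun s : ℝ => s • v) l (𝓝 0) := by
    simpa using hl0.smul_const v
  have hcd : Tendsto (fun s : ℝ => s⁻¹ • s • v) l (𝓝 v) := by
    refine tendsto_const_nhds.congr' ?_
    filter_upwards [hl self_mem_nhdsWithin] with s hs
    rw [inv_smul_smul₀ hs]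
  refine (hD.lim hd hv hcd).congr fun s => ?_
  simp only [writtenInExtChartAt, Function.comp_apply]
  rw [extChartAt_to_inv]

end TangentVectors

/-! ### The tangent space of the model submanifold -/

section ModelTangent

open Filter

variable {n : ℕ} {F : Type*} [TopologicalSpace F] [ChartedSpace (EuclideanSpace ℝ (Fin n)) F]
  [IsManifold (𝓡 n) ∞ F]

variable (n) in
/-- The model with corners of `S¹ × ℝ × F`. -/
noncomputable abbrev paramI : ModelWithCorners ℝ (EuclideanSpace ℝ (Fin 1) × ℝ × EuclideanSpace ℝ (Fin n))
    (ModelProd (EuclideanSpace ℝ (Fin 1)) (ModelProd ℝ (EuclideanSpace ℝ (Fin n)))) :=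
  (𝓡 1).prod (𝓘(ℝ, ℝ).prod (𝓡 n))

variable (n F) in
/-- The parametrization of the model submanifold. -/
noncomputable def modelParam (a : Circle × ℝ × F) : ModelSpace n F :=
  (((Real.sqrt (1 - a.2.1 ^ 2) : ℝ) : ℂ), (a.1, a.2.1), zeroSec n F a.2.2)

theorem contMDiff_zeroSec : ContMDiff (𝓡 n) (cotI n) ∞ (zeroSec n F) :=
  Bundle.contMDiff_zeroSection ℝ (fun q : F => TangentSpace (𝓡 n) q →L[ℝ] Bundle.Trivial F ℝ q)

theorem contMDiffAt_modelParam {a : Circle × ℝ × F} (ha : 1 - a.2.1 ^ 2 ≠ 0) :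
    ContMDiffAt (paramI n) (modelI n) ∞ (modelParam n F) a := by
  have h0 : ContMDiffAt (paramI n) (𝓘(ℝ, ℝ).prod (𝓡 n)) ∞
      (Prod.snd : Circle × ℝ × F → ℝ × F) a := contMDiffAt_snd
  have h1 : ContMDiffAt (paramI n) 𝓘(ℝ, ℂ) ∞
      (fun a : Circle × ℝ × F => ((Real.sqrt (1 - a.2.1 ^ 2) : ℝ) : ℂ)) a := by
    have h2 : ContDiffAt ℝ ∞ (fun r : ℝ => ((Real.sqrt (1 - r ^ 2) : ℝ) : ℂ)) a.2.1 :=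
      Complex.ofRealCLM.contDiff.contDiffAt.comp _
        ((contDiffAt_const.sub (contDiffAt_id.pow 2)).sqrt ha)
    exact h2.contMDiffAt.comp a h0.fst
  refine h1.prodMk (ContMDiffAt.prodMk ?_ ?_)
  · exact contMDiffAt_fst.prodMk (h0.fst)
  · exact contMDiff_zeroSec.contMDiffAt.comp a h0.snd

/-- The projection `(φ, r, q)` of the model is a smooth left inverse of the parametrization. -/
theorem injective_mapD_modelParam {a : Circle × ℝ × F} (ha : 1 - a.2.1 ^ 2 ≠ 0) :
    Function.Injective (mapD (paramI n) (modelI n) (modelParam n F) a) := by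
  set Q : ModelSpace n F → Circle × ℝ × F := fun p => (p.2.1.1, p.2.1.2, p.2.2.proj) with hQ
  have hQs : ContMDiff (modelI n) (paramI n) ∞ Q := by
    have h1 : ContMDiff (modelI n) (((𝓡 1).prod 𝓘(ℝ, ℝ)).prod (cotI n)) ∞
      (Prod.snd : ModelSpace n F → _) := contMDiff_snd
    exact (contMDiff_fst.comp (contMDiff_fst.comp h1)).prodMk
      ((contMDiff_snd.comp (contMDiff_fst.comp h1)).prodMk
        ((Bundle.contMDiff_proj _).comp (contMDiff_snd.comp h1)))
  have h1 := mapD_comp ((hQs (modelParam n F a)).mdifferentiableAt (by simp))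
    ((contMDiffAt_modelParam ha).mdifferentiableAt (by simp))
  have h2 : mapD (paramI n) (paramI n) (Q ∘ modelParam n F) a = ContinuousLinearMap.id ℝ _ :=
    mfderiv_id
  rw [h2] at h1
  intro v w hvw
  have h3 := DFunLike.congr_fun h1 v
  have h4 := DFunLike.congr_fun h1 w
  rw [ContinuousLinearMap.comp_apply, hvw] at h3
  exact h3.trans h4.symm

/-- The function `y` vanishes identically on the model submanifold. -/
theorem mapD_modelParam_im {a : Circle × ℝ × F} (ha : 1 - a.2.1 ^ 2 ≠ 0)
    (v : EuclideanSpace ℝ (Fin 1) × ℝ × EuclideanSpace ℝ (Fin n)) :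
    (mapD (paramI n) (modelI n) (modelParam n F) a v).1.im = 0 := by
  have hd := (contMDiffAt_modelParam (n := n) ha).mdifferentiableAt (by simp)
  have h2 := (Complex.imCLM.hasMFDerivAt (x := (modelParam n F a).1)).comp a
    ((hasMFDerivAt_fst (modelParam n F a)).comp a hd.hasMFDerivAt)
  have h3 : Complex.imCLM ∘ (Prod.fst : ModelSpace n F → ℂ) ∘ modelParam n F = fun _ => 0 := by
    funext b
    simp [modelParam]
  have h4 := h3 ▸ h2
  exact DFunLike.congr_fun (hasMFDerivAt_unique h4 (hasMFDerivAt_const 0 a)) v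

end ModelTangent

/-! ### Boundary values in the model submanifold -/

section BoundaryTangent

open Filter

variable {n : ℕ} {F : Type*} [TopologicalSpace F] [ChartedSpace (EuclideanSpace ℝ (Fin n)) F]
  [IsManifold (𝓡 n) ∞ F] {JF : EndField (cotI n) (X := Cotangent n F)} {fF : Cotangent n F → ℝ}
  {ε δ : ℝ} {E : Type*} [NormedAddCommGroup E] [NormedSpace ℝ E]
  {H : Type*} [TopologicalSpace H] {I : ModelWithCorners ℝ E H}
  {W : Type*} [TopologicalSpace W] [ChartedSpace H W] {J : EndField I (X := W)}
  {E' : Type*} [NormedAddCommGroup E'] [NormedSpace ℝ E'] [FiniteDimensional ℝ E']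
  {H' : Type*} [TopologicalSpace H'] {I' : ModelWithCorners ℝ E' H'}
  {N : Type*} [TopologicalSpace N] [ChartedSpace H' N] {ι : N → W}
  {U : Set W} {c : W → ModelSpace n F}

/-- Moving into the model submanifold, away from its boundary or towards it, one stays in the model
neighbourhood. -/
theorem eventually_modelParam_mem (hfF : IsFiberFunction JF fF) (hδ : 0 < δ) (hε1 : ε ≤ 1)
    {b : Circle × ℝ × F} (hb0 : 0 ≤ b.2.1) (hbε : b.2.1 < ε)
    (hbU : modelParam n F b ∈ modelU fF δ) {β : ℝ → Circle × ℝ × F} {ρ : ℝ}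
    (hβ : ∀ᶠ τ in 𝓝[>] 0, (β τ).2.1 = b.2.1 + τ * ρ) (hρ0 : b.2.1 = 0 → 0 < ρ)
    (hρ1 : 0 < b.2.1 → ρ < 0) :
    ∀ᶠ τ in 𝓝[>] 0, modelParam n F (β τ) ∈ modelN n F ε ∧ modelParam n F (β τ) ∈ modelU fF δ := by
  have hlim : Tendsto (fun τ : ℝ => b.2.1 + τ * ρ) (𝓝[>] 0) (𝓝 b.2.1) := by
    have : Continuous (fun τ : ℝ => b.2.1 + τ * ρ) := by fun_prop
    simpa using (this.tendsto 0).mono_left nhdsWithin_le_nhds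
  have h0 : ∀ᶠ τ in 𝓝[>] (0 : ℝ), 0 ≤ b.2.1 + τ * ρ := by
    rcases hb0.eq_or_lt with h | h
    · filter_upwards [self_mem_nhdsWithin] with τ hτ
      have := mul_pos (mem_Ioi.1 hτ) (hρ0 h.symm)
      linarith
    · filter_upwards [hlim.eventually (lt_mem_nhds h)] with τ hτ using hτ.le
  -- At `r = 0` one has `x = 1 > 1 - δ`, with room to spare. For `r > 0` the point may have `x = 1 -
  -- δ` exactly, but decreasing `r` increases `x = √(1 - r²)`.
  have hx : ∀ᶠ τ in 𝓝[>] (0 : ℝ), 1 - δ ≤ Real.sqrt (1 - (b.2.1 + τ * ρ) ^ 2) := by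
    rcases hb0.eq_or_lt with h | h
    · have h1 : Tendsto (fun τ : ℝ => Real.sqrt (1 - (b.2.1 + τ * ρ) ^ 2)) (𝓝[>] 0) (𝓝 1) := by
        have h2 : Real.sqrt (1 - b.2.1 ^ 2) = 1 := by rw [← h]; simp
        have h3 := (Real.continuous_sqrt.tendsto _).comp ((hlim.pow 2).const_sub 1)
        rw [h2] at h3
        exact h3
      filter_upwards [h1.eventually (lt_mem_nhds (show 1 - δ < 1 by linarith))] with τ hτ using hτ.le
    · have h1 : 1 - δ ≤ Real.sqrt (1 - b.2.1 ^ 2) := by simpa [modelParam] using hbU.1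
      filter_upwards [self_mem_nhdsWithin, h0] with τ hτ h2
      refine h1.trans (Real.sqrt_le_sqrt ?_)
      have := mul_pos_of_neg_of_neg (hρ1 h) (neg_lt_zero.2 (mem_Ioi.1 hτ))
      nlinarith
  filter_upwards [hβ, h0, hx, hlim.eventually (gt_mem_nhds hbε)] with τ h1 h2 h3 h4
  rw [← h1] at h2 h3 h4
  refine ⟨⟨(β τ).1, (β τ).2.1, (β τ).2.2, h2, h4, rfl⟩, h3, ?_⟩
  have h5 : fF (zeroSec n F (β τ).2.2) = 0 := (hfF.eq_zero_iff _).2 (mem_range_self _)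
  have h6 : Real.sqrt (1 - (β τ).2.1 ^ 2) ^ 2 = 1 - (β τ).2.1 ^ 2 :=
    Real.sq_sqrt (by nlinarith)
  have h7 : modelf fF (modelParam n F (β τ)) = 1 / 2 := by
    simp only [modelf, modelParam, h5, Complex.ofReal_re, Complex.ofReal_im, h6]
    ring
  rw [h7]
  norm_num

theorem exists_eq_modelParam {p : ModelSpace n F} (hp : p ∈ modelN n F ε) :
    ∃ b : Circle × ℝ × F, 0 ≤ b.2.1 ∧ b.2.1 < ε ∧ p = modelParam n F b := by
  obtain ⟨θ, r, q, h0, h1, rfl⟩ := hp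
  exact ⟨(θ, r, q), h0, h1, rfl⟩

/-- A path in `N_mod` with velocity `v` that stays in the model neighbourhood lifts to a path in
`N`, and limits of its difference quotients are tangent to `N`. The sign conditions keep the path
inside: `r` must increase from the edge `r = 0`, and elsewhere decrease so that `x` does not drop
below `1 - δ`. -/
theorem IsModelNeighborhood.mapD_modelParam_mem_range [T2Space F] (hfF : IsFiberFunction JF fF)
    (hδ : 0 < δ) (hε1 : ε ≤ 1) (hM : IsModelNeighborhood JF fF ε δ J (range ι) U c)
    (hι : IsEmbeddedSubmanifold I' I ι) {a : N} (ha : ι a ∈ U) {b : Circle × ℝ × F}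
    (hb0 : 0 ≤ b.2.1) (hbε : b.2.1 < ε) (hcb : c (ι a) = modelParam n F b)
    {v : EuclideanSpace ℝ (Fin 1) × ℝ × EuclideanSpace ℝ (Fin n)}
    (hv0 : b.2.1 = 0 → 0 < v.2.1) (hv1 : 0 < b.2.1 → v.2.1 < 0) :
    mapD (paramI n) (modelI n) (modelParam n F) b v ∈ range (mapD I' (modelI n) (c ∘ ι) a) := by
  have hb2 : 1 - b.2.1 ^ 2 ≠ 0 := by nlinarith
  set β : ℝ → Circle × ℝ × F := fun τ => (extChartAt (paramI n) b).symm
    (extChartAt (paramI n) b b + τ • v) with hβ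
  have hβr : ∀ τ, (β τ).2.1 = b.2.1 + τ * v.2.1 := fun τ => by
    simp only [hβ, extChartAt_prod, extChartAt_model_space_eq_id, PartialEquiv.prod_coe_symm,
      PartialEquiv.prod_coe, PartialEquiv.refl_coe, PartialEquiv.refl_symm, Prod.snd_add,
      Prod.fst_add, Prod.smul_snd, Prod.smul_fst, id_eq, smul_eq_mul]
  have hsl := tendsto_slope_of_mdifferentiableAt
    ((contMDiffAt_modelParam (n := n) (F := F) hb2).mdifferentiableAt (by simp)) (v := v)
    (l := 𝓝[>] 0) (nhdsGT_le_nhdsNE 0) (Eventually.of_forall fun s => by simp)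
  have hβl : Tendsto β (𝓝[>] 0) (𝓝 b) := by
    have h1 : Tendsto (fun τ : ℝ => extChartAt (paramI n) b b + τ • v) (𝓝[>] 0)
        (𝓝 (extChartAt (paramI n) b b)) := by
      have : Continuous (fun τ : ℝ => extChartAt (paramI n) b b + τ • v) := by fun_prop
      simpa using (this.tendsto 0).mono_left nhdsWithin_le_nhds
    have h2 := (continuousAt_extChartAt_symm (I := paramI n) b).tendsto.comp h1
    rwa [extChartAt_to_inv] at h2
  have hηl : Tendsto (modelParam n F ∘ β) (𝓝[>] 0) (𝓝 (c (ι a))) := by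
    rw [hcb]
    exact (contMDiffAt_modelParam (n := n) hb2).continuousAt.tendsto.comp hβl
  have hmem := eventually_modelParam_mem hfF hδ hε1 hb0 hbε (hcb ▸ hM.mapsTo ha)
    (Eventually.of_forall hβr) hv0 hv1
  have hex : ∀ τ, ∃ x : W, modelParam n F (β τ) ∈ modelU fF δ → x ∈ U ∧ c x = modelParam n F (β τ) := by
    intro τ
    by_cases hτ : modelParam n F (β τ) ∈ modelU fF δ
    · have hτ' := hτ
      rw [← hM.image_eq] at hτ'
      obtain ⟨x, hx, hcx⟩ := hτ'
      exact ⟨x, fun _ => ⟨hx, hcx⟩⟩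
    · exact ⟨ι a, fun h => absurd h hτ⟩
  choose x hx using hex
  have hxU : ∀ᶠ τ in 𝓝[>] (0 : ℝ), x τ ∈ U ∧ c (x τ) = modelParam n F (β τ) :=
    hmem.mono fun τ hτ => hx τ hτ.2
  have hxι : ∀ᶠ τ in 𝓝[>] (0 : ℝ), x τ ∈ range ι := by
    filter_upwards [hxU, hmem] with τ h1 h2
    rw [hM.submanifold_iff _ h1.1, h1.2]
    exact h2.1
  have hxl : Tendsto x (𝓝[>] (0 : ℝ)) (𝓝 (ι a)) :=
    hM.tendsto ha (hxU.mono fun _ h => h.1) (hηl.congr' (hxU.mono fun _ h => h.2.symm))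
  refine hι.mem_range_of_tendsto_slope ((hM.contMDiffAt ha).mdifferentiableAt (by simp))
    (hM.injective_mapD ha) hxι hxl (t := fun τ => τ) (hsl.congr' ?_)
  filter_upwards [hxU] with τ hτ
  rw [hτ.2, hcb]

/-- The image of the tangent space of `N` in the model. -/
theorem IsModelNeighborhood.im_eq_zero_of_mem_range [T2Space F] (hfF : IsFiberFunction JF fF)
    (hδ : 0 < δ) (hε1 : ε ≤ 1) (hM : IsModelNeighborhood JF fF ε δ J (range ι) U c)
    (hι : IsEmbeddedSubmanifold I' I ι) (hdim : Module.finrank ℝ E' = n + 2) {a : N} (ha : ι a ∈ U)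
    {w : ModelVec n} (hw : w ∈ range (mapD I' (modelI n) (c ∘ ι) a)) : w.1.im = 0 := by
  obtain ⟨b, hb0, hbε, hcb⟩ := exists_eq_modelParam
    ((hM.submanifold_iff _ ha).1 (mem_range_self a))
  have hb2 : 1 - b.2.1 ^ 2 ≠ 0 := by nlinarith
  set A := mapD (paramI n) (modelI n) (modelParam n F) b with hA
  set T := mapD I' (modelI n) (c ∘ ι) a with hT
  have hAi : Function.Injective A := injective_mapD_modelParam hb2
  have hTi : Function.Injective T := by
    rw [hT, mapD_comp ((hM.contMDiffAt ha).mdifferentiableAt (by simp))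
      ((hι.contMDiff a).mdifferentiableAt (by simp))]
    exact (hM.injective_mapD ha).comp (hι.injective_mfderiv a)
  have hmem : ∀ v, (b.2.1 = 0 → 0 < v.2.1) → (0 < b.2.1 → v.2.1 < 0) →
      A v ∈ LinearMap.range T.toLinearMap := fun v h0 h1 =>
    hM.mapD_modelParam_mem_range hfF hδ hε1 hι ha hb0 hbε hcb h0 h1
  -- The admissible vectors form an open half-space, which spans: `v = (v + e) - e` with `e` a large
  -- admissible multiple of `∂_r`.
  have hle : LinearMap.range A.toLinearMap ≤ LinearMap.range T.toLinearMap := by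
    rintro _ ⟨v, rfl⟩
    obtain ⟨σ, hσ0, hσ1⟩ : ∃ σ : ℝ, (b.2.1 = 0 → σ = 1) ∧ (0 < b.2.1 → σ = -1) := by
      rcases hb0.eq_or_lt with h | h
      · exact ⟨1, fun _ => rfl, fun h' => absurd h h'.ne⟩
      · exact ⟨-1, fun h' => absurd h' h.ne', fun _ => rfl⟩
    set e : EuclideanSpace ℝ (Fin 1) × ℝ × EuclideanSpace ℝ (Fin n) := (0, (|v.2.1| + 1) * σ, 0)
      with he
    have h1 : A (v + e) ∈ LinearMap.range T.toLinearMap := by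
      refine hmem _ (fun h => ?_) (fun h => ?_)
      · simp only [he, Prod.snd_add, Prod.fst_add, hσ0 h]
        linarith [neg_abs_le v.2.1]
      · simp only [he, Prod.snd_add, Prod.fst_add, hσ1 h]
        linarith [le_abs_self v.2.1]
    have h2 : A e ∈ LinearMap.range T.toLinearMap := by
      refine hmem _ (fun h => ?_) (fun h => ?_)
      · simp only [he, hσ0 h]
        linarith [abs_nonneg v.2.1]
      · simp only [he, hσ1 h]
        linarith [abs_nonneg v.2.1]
    have h3 := Submodule.sub_mem _ h1 h2
    rwa [map_add, add_sub_cancel_right] at h3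
  -- Both tangent spaces have dimension `n + 2`, so the inclusion is an equality and the vanishing
  -- of `dy` transfers to `N`.
  have heq := Submodule.eq_of_le_of_finrank_eq hle (by
    rw [LinearMap.finrank_range_of_inj hAi, LinearMap.finrank_range_of_inj hTi, hdim]
    simp
    omega)
  have hw' : w ∈ LinearMap.range A.toLinearMap := by
    rw [heq]
    exact hw
  obtain ⟨v, rfl⟩ := hw'
  exact mapD_modelParam_im hb2 v

/-- Along the boundary, a map with boundary values in `N` has vanishing `dy`. -/
theorem IsModelNeighborhood.mapD_curveD_one_im [T2Space F] (hfF : IsFiberFunction JF fF)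
    (hδ : 0 < δ) (hε1 : ε ≤ 1) (hM : IsModelNeighborhood JF fF ε δ J (range ι) U c)
    (hι : IsEmbeddedSubmanifold I' I ι) (hdim : Module.finrank ℝ E' = n + 2)
    {S : Type*} [TopologicalSpace S] [ChartedSpace ClosedHalfPlane S]
    [IsManifold complexHalfPlane ∞ S] {u : S → W} (hu : IsJHolomorphic J u)
    (hN : ∀ z ∈ realHalfPlane.boundary S, u z ∈ range ι) {z : S}
    (hz : z ∈ realHalfPlane.boundary S) (hzU : u z ∈ U) :
    (mapD I (modelI n) c (u z) (curveD I u z 1)).1.im = 0 := by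
  obtain ⟨a, ha⟩ := hN z hz
  have hcu : MDifferentiableAt I (modelI n) c (u z) :=
    (hM.contMDiffAt hzU).mdifferentiableAt (by simp)
  have hud := hu.mdifferentiableAt z
  set φ := extChartAt realHalfPlane z with hφ
  have hφz : (φ z).im = 0 := (isBoundaryPoint_iff_im_eq (mem_extChartAt_source z)).1 hz
  have hr : ∀ s : ℝ, φ z + s • (1 : ℂ) ∈ range realHalfPlane := fun s => by
    rw [range_realHalfPlane]
    simp [hφz]
  have hsl := tendsto_slope_of_mdifferentiableAt (hcu.comp z hud) (v := (1 : ℂ))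
    (l := 𝓝[≠] 0) le_rfl (Eventually.of_forall hr)
  have hxl : Tendsto (fun s : ℝ => φ.symm (φ z + s • (1 : ℂ))) (𝓝[≠] 0) (𝓝 z) := by
    have h1 : Tendsto (fun s : ℝ => φ z + s • (1 : ℂ)) (𝓝[≠] 0) (𝓝 (φ z)) := by
      have : Continuous (fun s : ℝ => φ z + s • (1 : ℂ)) := by fun_prop
      simpa using (this.tendsto 0).mono_left nhdsWithin_le_nhds
    have h2 := (continuousAt_extChartAt_symm (I := realHalfPlane) z).tendsto.comp h1
    rwa [extChartAt_to_inv] at h2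
  have htar : ∀ᶠ s : ℝ in 𝓝[≠] 0, φ z + s • (1 : ℂ) ∈ φ.target := by
    have h1 : Tendsto (fun s : ℝ => φ z + s • (1 : ℂ)) (𝓝[≠] 0) (𝓝[range realHalfPlane] (φ z)) := by
      refine tendsto_nhdsWithin_iff.2 ⟨?_, Eventually.of_forall hr⟩
      have : Continuous (fun s : ℝ => φ z + s • (1 : ℂ)) := by fun_prop
      simpa using (this.tendsto 0).mono_left nhdsWithin_le_nhds
    exact h1.eventually (extChartAt_target_mem_nhdsWithin z)
  -- Real translations in the chart stay on the boundary of the surface, where the curve takes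
  -- values in `N`.
  have hbd : ∀ᶠ s : ℝ in 𝓝[≠] 0, u (φ.symm (φ z + s • (1 : ℂ))) ∈ range ι := by
    filter_upwards [htar] with s hs
    refine hN _ ((isBoundaryPoint_iff_im_eq (φ.map_target hs)).2 ?_)
    rw [φ.right_inv hs]
    simp [hφz]
  have haU : ι a ∈ U := ha ▸ hzU
  refine hM.im_eq_zero_of_mem_range hfF hδ hε1 hι hdim haU ?_
  refine hι.mem_range_of_tendsto_slope (ha ▸ hcu) (ha ▸ hM.injective_mapD hzU) hbd ?_
    (t := fun s => s) (l := 𝓝[≠] 0) ?_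
  · rw [ha]
    exact (hu.contMDiff_one.continuous.tendsto z).comp hxl
  · rw [ha]
    have h5 := mapD_comp hcu hud
    rw [h5] at hsl
    exact hsl

end BoundaryTangent

/-! ### Propagation of the maximum -/

section Propagation

open Filter

variable {S : Type*} [TopologicalSpace S] [ChartedSpace ClosedHalfPlane S]
  [IsManifold complexHalfPlane ∞ S]
  {E : Type*} [NormedAddCommGroup E] [NormedSpace ℝ E]
  {H : Type*} [TopologicalSpace H] {I : ModelWithCorners ℝ E H}
  {X : Type*} [TopologicalSpace X] [ChartedSpace H X] [IsManifold I ∞ X]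
  {J : EndField I (X := X)} {u : S → X}

/-- A `C¹` curve has bounded derivative in charts. -/
theorem IsJHolomorphic.exists_norm_fderiv_le (hu : IsJHolomorphic J u) (z : S) :
    ∃ B : ℝ, ∃ t ∈ 𝓝[range realHalfPlane] (extChartAt realHalfPlane z z),
      ∀ ζ, t ∈ 𝓝 ζ → ‖fderiv ℝ (curveInChart I u z (u z)) ζ‖ ≤ B := by
  have h1 : ContDiffWithinAt ℝ 1 (curveInChart I u z (u z)) (range realHalfPlane)
    (extChartAt realHalfPlane z z) := (contMDiffAt_iff.1 (hu.contMDiff_one z)).2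
  obtain ⟨B, t, ht, hLip⟩ := h1.exists_lipschitzOnWith realHalfPlane.convex_range
  exact ⟨B, t, ht, fun ζ hζ => norm_fderiv_le_of_lipschitzOn ℝ hζ hLip⟩

/-- Let `Z` be holomorphic on a set `U` that is open where `Re Z > a`. At a maximum over `U` of `Re Z`
along a holomorphic curve, `Re Z` is locally constant along the curve. -/
theorem IsJHolomorphic.exists_isChartRadius_of_max [FiniteDimensional ℝ E]
    (hu : IsJHolomorphic J u) (hJ : IsAlmostComplex J) {O : Set X} (hO : IsOpen O) {Z : X → ℂ}
    (hZ : ContMDiffOn I 𝓘(ℝ, ℂ) ∞ Z O) {U : Set X} (hUO : U ⊆ O) (hU : IsClosed U)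
    (hol : ∀ p ∈ U, ∀ v : E, mapD I 𝓘(ℝ, ℂ) Z p (J p v) = Complex.I * mapD I 𝓘(ℝ, ℂ) Z p v)
    {a : ℝ} (hUi : IsOpen {p ∈ U | 0 < (Z p).re - a}) {z : S} (hp : u z ∈ U)
    (hpa : a ≤ (Z (u z)).re)
    (href : (Z (u z)).re = a → ∃ κ > 0, ∀ η > 0,
      ∃ y ∈ range I ∩ Metric.ball (extChartAt I (u z) (u z)) η,
        (extChartAt I (u z)).symm y ∈ U ∧ y ≠ extChartAt I (u z) (u z) ∧
          κ * ‖y - extChartAt I (u z) (u z)‖ ≤ (Z ((extChartAt I (u z)).symm y)).re - a)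
    (hmax : ∀ w, u w ∈ U → (Z (u w)).re ≤ (Z (u z)).re)
    (hbd : z ∈ realHalfPlane.boundary S → (mapD I 𝓘(ℝ, ℂ) Z (u z) (curveD I u z 1)).im = 0) :
    ∃ V R, IsChartRadius z V R ∧ innerNhd z R ⊆ {w | u w ∈ U ∧ (Z (u w)).re = (Z (u z)).re} := by
  set φ := extChartAt realHalfPlane z with hφ
  set m := (Z (u z)).re with hm
  have hcu := hu.contMDiff_one.continuous
  obtain ⟨ρ, hρ, C, hC, hest⟩ := exists_extD_estimate hJ hO hZ hUO hU hol hUi hp hpa href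
  obtain ⟨B, t, ht, hB⟩ := hu.exists_norm_fderiv_le z
  have hV : ∀ᶠ w in 𝓝 z, w ∈ φ.source ∧ φ w ∈ t ∧ u w ∈ (chartAt H (u z)).source ∧
      extChartAt I (u z) (u w) ∈ Metric.ball (extChartAt I (u z) (u z)) ρ := by
    have h1 : Tendsto φ (𝓝 z) (𝓝[range realHalfPlane] (φ z)) :=
      tendsto_nhdsWithin_iff.2 ⟨continuousAt_extChartAt z, Eventually.of_forall fun _ => mem_range_self _⟩
    filter_upwards [extChartAt_source_mem_nhds (I := realHalfPlane) z, h1.eventually ht,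
      hcu.continuousAt.eventually ((chartAt H (u z)).open_source.mem_nhds (mem_chart_source H (u z))),
      (hcu.continuousAt (x := z)).eventually ((continuousAt_extChartAt (I := I) (u z)).eventually
        (Metric.ball_mem_nhds _ hρ))] with w h1 h2 h3 h4
    exact ⟨h1, h2, h3, h4⟩
  obtain ⟨R, hR⟩ := exists_isChartRadius hV
  refine ⟨_, R, hR, ?_⟩
  set v : ℂ → ℝ := fun ζ => m - ((fun q => (Z q).re) ∘ u ∘ φ.symm) ζ with hv
  set D := halfDisc (φ z) R with hD
  have hkey : ∀ ζ ∈ D, ContDiffAt ℝ 2 v ζ ∧ 0 ≤ v ζ ∧ lap v ζ ≤ C * B ^ 2 * v ζ ∧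
      (v ζ = 0 → u (φ.symm ζ) ∈ U) := by
    intro ζ hζ
    obtain ⟨htar, -, hζt, hs, hb⟩ := hR.mem hζ
    have hy : curveInChart I u z (u z) ζ ∈
        range I ∩ Metric.ball (extChartAt I (u z) (u z)) ρ := ⟨mem_range_self _, hb⟩
    obtain ⟨h1, h2, h3, h4⟩ := hest _ hy
    have hinv : (extChartAt I (u z)).symm (curveInChart I u z (u z) ζ) = u (φ.symm ζ) :=
      (extChartAt I (u z)).left_inv (by rw [extChartAt_source]; exact hs)
    rw [hinv] at h3 h4
    obtain ⟨h5, h6⟩ := hu.lap_eq htar hζ.2 hs h1 h2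
    have hDt : t ∈ 𝓝 ζ := by
      filter_upwards [(isOpen_halfDisc (φ z) R).mem_nhds hζ] with ξ hξ
      have := (hR.mem hξ).2.2.1
      rwa [φ.right_inv (hR.mem hξ).1] at this
    -- The maximality of `m` is only known over `U`. If `Re Z ≥ a` the point is in `U` and
    -- maximality applies; if `Re Z < a ≤ m` there is nothing to prove. The same bound turns the
    -- estimate of `dd^J Re Z` into one by `v`.
    have hnn : max (a - (Z (u (φ.symm ζ))).re) 0 ≤ v ζ := by
      have hvζ : v ζ = m - (Z (u (φ.symm ζ))).re := rfl
      rw [hvζ]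
      refine max_le (by linarith) ?_
      rcases le_or_gt a (Z (u (φ.symm ζ))).re with h | h
      · exact sub_nonneg.2 (hmax _ (h3 h))
      · linarith
    have hv0 : 0 ≤ v ζ := (le_max_right _ _).trans hnn
    refine ⟨contDiffAt_const.sub h5, hv0, ?_, fun h0 => h3 ?_⟩
    · have h7 : lap v ζ = -lap ((fun q => (Z q).re) ∘ u ∘ φ.symm) ζ := lap_const_sub m
      rw [h7, h6]
      refine (neg_le_abs _).trans ((h4 _ _).trans ?_)
      -- The form is evaluated on the two partial derivatives of the curve, each bounded by `B`;
      -- this bound up to the boundary is where `C¹` regularity enters.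
      have hB1 := (fderiv ℝ (curveInChart I u z (u z)) ζ).le_of_opNorm_le (hB ζ hDt) 1
      have hBI := (fderiv ℝ (curveInChart I u z (u z)) ζ).le_of_opNorm_le (hB ζ hDt) Complex.I
      rw [norm_one, mul_one] at hB1
      rw [Complex.norm_I, mul_one] at hBI
      calc _ ≤ C * v ζ * (B * B) := by gcongr; exact (norm_nonneg _).trans hB1
        _ = _ := by ring
    · have hvζ : v ζ = m - (Z (u (φ.symm ζ))).re := rfl
      linarith
  have hvz : v (φ z) = 0 := by
    simp only [hv, Function.comp_apply, hφ, extChartAt_to_inv]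
    exact sub_self m
  have hzero : ∀ ζ ∈ D, v ζ = 0 := by
    rcases (im_nonneg_of_mem_target (mem_extChartAt_target (I := realHalfPlane) z)).eq_or_lt with
      him | him
    · have him : (φ z).im = 0 := him.symm
      have hzb : z ∈ realHalfPlane.boundary S :=
        (isBoundaryPoint_iff_im_eq (mem_extChartAt_source z)).2 him
      have hZu : MDifferentiableAt I 𝓘(ℝ, ℂ) Z (u z) :=
        (hZ.contMDiffAt (hO.mem_nhds (hUO hp))).mdifferentiableAt (by simp)
      have hL : HasFDerivWithinAt (Z ∘ u ∘ φ.symm)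
          ((mapD I 𝓘(ℝ, ℂ) Z (u z)).comp (curveD I u z)) (range realHalfPlane) (φ z) :=
        (hZu.hasMFDerivAt.comp z (hu.mdifferentiableAt z).hasMFDerivAt).2
      refine eqOn_zero_halfDisc_of_lap_le him hR.1 (by positivity) (fun ζ hζ => (hkey ζ hζ).1)
        (fun ζ hζ => (hkey ζ hζ).2.1) (fun ζ hζ => (hkey ζ hζ).2.2.1) hvz ?_ ?_
      · have h1 : HasDerivWithinAt (fun t : ℝ => φ z + t • Complex.I) Complex.I (Ici 0) 0 :=
          (hasDerivAt_line (φ z) Complex.I 0).hasDerivWithinAt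
        have h2 : MapsTo (fun t : ℝ => φ z + t • Complex.I) (Ici 0) (range realHalfPlane) := by
          intro t ht
          rw [range_realHalfPlane]
          simpa [him] using ht
        have h3 := (Complex.reCLM.hasFDerivAt.comp_hasFDerivWithinAt (φ z) hL).const_sub m
        have h4 := HasFDerivWithinAt.comp_hasDerivWithinAt_of_eq (0 : ℝ) h3 h1 h2 (by simp)
        -- The normal derivative of `Re Z` is minus the tangential derivative of `Im Z`, which
        -- vanishes by the boundary condition.
        have h5 : (mapD I 𝓘(ℝ, ℂ) Z (u z) (curveD I u z Complex.I)).re = 0 := by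
          have h6 := hu.curveD_I_mul z 1
          rw [mul_one] at h6
          rw [h6, hol _ hp, Complex.I_mul_re, hbd hzb, neg_zero]
        refine h4.congr_deriv ?_
        change -(mapD I 𝓘(ℝ, ℂ) Z (u z) (curveD I u z Complex.I)).re = 0
        rw [h5, neg_zero]
      · have h1 := hL.continuousWithinAt
        rw [range_realHalfPlane] at h1
        exact continuousWithinAt_const.sub (Complex.continuous_re.continuousAt.comp_continuousWithinAt h1)
    · exact eqOn_zero_of_lap_le (by positivity) (isOpen_halfDisc _ _)
        (convex_halfDisc _ _).isPreconnected (fun ζ hζ => (hkey ζ hζ).1)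
        (fun ζ hζ => (hkey ζ hζ).2.1) (fun ζ hζ => (hkey ζ hζ).2.2.1)
        (show φ z ∈ D from ⟨Metric.mem_ball_self hR.1, him⟩) hvz
  rintro _ ⟨ζ, hζ, rfl⟩
  have h0 := hzero ζ hζ
  exact ⟨(hkey ζ hζ).2.2.2 h0, (sub_eq_zero.1 h0).symm⟩

/-- A holomorphic curve that touches a `J`-convex boundary at an interior point is constant. -/
theorem IsJHolomorphic.exists_eq_of_mem_boundary [PreconnectedSpace S] [Nonempty S]
    (hu : IsJHolomorphic J u) (hJ : IsAlmostComplex J) (hconv : HasConvexBoundary J)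
    (hz : ∃ z ∈ realHalfPlane.interior S, u z ∈ I.boundary X) : ∃ p, ∀ z, u z = p := by
  obtain ⟨h, hh, hle, h0, -, O, hO, hbO, hpsh⟩ := hconv
  have hcu := hu.contMDiff_one.continuous
  -- As `h ≤ 0`, the value `0` is a maximum of the subharmonic function `h ∘ u`.
  have hev : ∀ z ∈ realHalfPlane.interior S, h (u z) = 0 → ∀ᶠ w in 𝓝 z, h (u w) = h (u z) := by
    intro z hz hz0
    refine eventually_eq_of_subharmonic (g := h ∘ u) hz (hu.eventually_subharmonic hJ hh hz ?_) ?_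
    · filter_upwards [hcu.continuousAt.eventually (hO.mem_nhds (hbO ((h0 _).1 hz0)))] with w hw
      exact hpsh _ hw
    · exact Eventually.of_forall fun w => (hle _).trans hz0.ge
  have hK : {z | h (u z) = 0} = univ := by
    refine eq_univ_of_isClosed (isClosed_eq (hh.continuous.comp hcu) continuous_const) ?_ ?_
    · intro z hz0 hz
      filter_upwards [hev z hz hz0] with w hw
      exact hw.trans hz0
    · obtain ⟨z, hz, hzb⟩ := hz
      exact ⟨z, (h0 _).2 hzb, hz⟩
  have hall : ∀ z, h (u z) = 0 := fun z => (hK ▸ mem_univ z : z ∈ {z | h (u z) = 0})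
  exact exists_eq_of_curveD_eq_zero hu.mdifferentiableAt fun z hz =>
    hu.curveD_eq_zero hJ hh hz (hpsh _ (hbO ((h0 _).1 (hall z)))) (hev z hz (hall z))

end Propagation

/-! ### Curves that meet a model neighbourhood -/

section MeetingCurves

open Filter

variable {n : ℕ} {F : Type*} [TopologicalSpace F] [ChartedSpace (EuclideanSpace ℝ (Fin n)) F]
  [IsManifold (𝓡 n) ∞ F] {JF : EndField (cotI n) (X := Cotangent n F)} {fF : Cotangent n F → ℝ}
  {ε δ : ℝ}

theorem modelf_nonneg (hfF : IsFiberFunction JF fF) (p : ModelSpace n F) : 0 ≤ modelf fF p := by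
  have := hfF.nonneg p.2.2
  unfold modelf
  positivity

/-- Below the level `1/2` there is room to increase `x` alone. The term `0 * τ` matches the form of
the rays in `exists_linear_growth`. -/
theorem eventually_ray_mem_of_lt (hfF : IsFiberFunction JF fF) {p : ModelSpace n F}
    (hp : p ∈ modelU fF δ) (hlt : modelf fF p < 1 / 2) :
    ∀ᶠ τ : ℝ in 𝓝[>] 0,
      ((p.1 + τ, (p.2.1.1, p.2.1.2 - 0 * τ), p.2.2) : ModelSpace n F) ∈ modelU fF δ := by
  have hc : Continuous fun τ : ℝ =>
      modelf fF ((p.1 + τ, (p.2.1.1, p.2.1.2 - 0 * τ), p.2.2) : ModelSpace n F) := by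
    simp only [modelf]
    fun_prop
  have h1 : Tendsto (fun τ : ℝ =>
      modelf fF ((p.1 + τ, (p.2.1.1, p.2.1.2 - 0 * τ), p.2.2) : ModelSpace n F)) (𝓝[>] 0)
      (𝓝 (modelf fF p)) := by
    simpa using (hc.tendsto 0).mono_left nhdsWithin_le_nhds
  filter_upwards [self_mem_nhdsWithin, h1.eventually (gt_mem_nhds hlt)] with τ h2 h3
  refine ⟨?_, modelf_nonneg hfF _, h3.le⟩
  have h4 := hp.1
  have h5 : 0 < τ := h2
  simp only [Complex.add_re, Complex.ofReal_re]
  linarith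

/-- On `N_mod` the level `1/2` is already attained, so an increase of `x` has to be paid for by a
decrease of `r`. At rate `2/r` the first-order change of `x² + r²` is `2x - 4 ≤ -2`. -/
theorem eventually_ray_mem_of_modelParam (hfF : IsFiberFunction JF fF) {b : Circle × ℝ × F}
    (hb0 : 0 < b.2.1) (hb1 : b.2.1 ≤ 1) (hb : 1 - δ ≤ Real.sqrt (1 - b.2.1 ^ 2)) :
    ∀ᶠ τ : ℝ in 𝓝[>] 0,
      (((modelParam n F b).1 + τ, ((modelParam n F b).2.1.1,
        (modelParam n F b).2.1.2 - 2 / b.2.1 * τ), (modelParam n F b).2.2) : ModelSpace n F) ∈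
        modelU fF δ := by
  set r := b.2.1 with hr
  set s := Real.sqrt (1 - r ^ 2) with hs
  have hs2 : s ^ 2 = 1 - r ^ 2 := Real.sq_sqrt (by nlinarith)
  have hs0 : 0 ≤ s := Real.sqrt_nonneg _
  have hs1 : s ≤ 1 := by nlinarith
  have hF : fF (zeroSec n F b.2.2) = 0 := (hfF.eq_zero_iff _).2 (mem_range_self _)
  set C := 2 / r with hC
  have hCr : r * C = 2 := by rw [hC]; field_simp
  -- For such `τ` the quadratic term `τ²(1 + C²)` is below the gain `2τ`.
  have hsmall : ∀ᶠ τ : ℝ in 𝓝[>] 0, τ < 2 / (1 + C ^ 2) :=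
    nhdsWithin_le_nhds (gt_mem_nhds (by positivity))
  filter_upwards [self_mem_nhdsWithin, hsmall] with τ h1 h2
  have h1 : 0 < τ := h1
  rw [lt_div_iff₀ (by positivity)] at h2
  refine ⟨?_, modelf_nonneg hfF _, ?_⟩
  · simp only [modelParam, Complex.add_re, Complex.ofReal_re]
    linarith
  · simp only [modelf, modelParam, Complex.add_re, Complex.ofReal_re, Complex.add_im,
      Complex.ofReal_im, hF]
    have h3 : (s + τ) ^ 2 + (r - C * τ) ^ 2 = 1 + τ * (2 * s - 2 * (r * C) + τ * (1 + C ^ 2)) := by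
      linear_combination hs2
    have h4 : τ * (2 * s - 2 * (r * C) + τ * (1 + C ^ 2)) ≤ 0 :=
      mul_nonpos_of_nonneg_of_nonpos h1.le (by rw [hCr]; linarith)
    linarith

variable {S : Type*} [TopologicalSpace S] [ChartedSpace ClosedHalfPlane S]
  [IsManifold complexHalfPlane ∞ S] [CompactSpace S] [ConnectedSpace S]
  {E : Type*} [NormedAddCommGroup E] [NormedSpace ℝ E] [FiniteDimensional ℝ E]
  {H : Type*} [TopologicalSpace H] {I : ModelWithCorners ℝ E H}
  {W : Type*} [TopologicalSpace W] [T2Space W] [ChartedSpace H W] [IsManifold I ∞ W]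
  {J : EndField I (X := W)}
  {E' : Type*} [NormedAddCommGroup E'] [NormedSpace ℝ E'] [FiniteDimensional ℝ E']
  {H' : Type*} [TopologicalSpace H'] {I' : ModelWithCorners ℝ E' H'}
  {N : Type*} [TopologicalSpace N] [ChartedSpace H' N] {ι : N → W}
  {U : Set W} {c : W → ModelSpace n F} {u : S → W}

/-- The points of `u⁻¹(U)` where `x ∘ u` is maximal form an open and closed set, so the curve lies
entirely in `U` and is a curve in the model. -/
theorem IsModelNeighborhood.exists_eq_of_mem [T2Space F] (hJF : IsAlmostComplex JF)
    (hfF : IsFiberFunction JF fF) (hε1 : ε ≤ 1) (hδ : 0 < δ) (hδ1 : δ ≤ 1)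
    (hpsh : ∀ ξ, fF ξ ≤ δ → IsPlurisubharmonicAt JF fF ξ) (hJ : IsAlmostComplex J)
    (hconv : HasConvexBoundary J) (hι : IsEmbeddedSubmanifold I' I ι)
    (hdim : Module.finrank ℝ E' = n + 2)
    (hM : IsModelNeighborhood JF fF ε δ J (range ι) U c) (hu : IsJHolomorphic J u)
    (hN : ∀ z ∈ realHalfPlane.boundary S, u z ∈ range ι) (hne : ∃ z, u z ∈ U) :
    ∃ p, ∀ z, u z = p := by
  by_cases hint : ∃ z ∈ realHalfPlane.interior S, u z ∈ I.boundary W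
  · exact hu.exists_eq_of_mem_boundary hJ hconv hint
  have hcu := hu.contMDiff_one.continuous
  have hUc : IsClosed U := hM.isCompact.isClosed
  obtain ⟨O, hO, hUO, hcO, -, -⟩ := hM.smoothEmbedding
  set Z : W → ℂ := fun q => (c q).1 with hZdef
  have hZ : ContMDiffOn I 𝓘(ℝ, ℂ) ∞ Z O := contMDiff_fst.comp_contMDiffOn hcO
  have hZD : ∀ p ∈ U, ∀ v : E, mapD I 𝓘(ℝ, ℂ) Z p v = (mapD I (modelI n) c p v).1 := by
    intro p hp v
    have h1 := (hasMFDerivAt_fst (I := 𝓘(ℝ, ℂ)) (I' := ((𝓡 1).prod 𝓘(ℝ, ℝ)).prod (cotI n)) (c p)).comp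
      p ((hM.contMDiffAt hp).mdifferentiableAt (by simp)).hasMFDerivAt
    exact DFunLike.congr_fun h1.mfderiv v
  have hol : ∀ p ∈ U, ∀ v : E,
      mapD I 𝓘(ℝ, ℂ) Z p (J p v) = Complex.I * mapD I 𝓘(ℝ, ℂ) Z p v := by
    intro p hp v
    refine (hZD p hp (J p v : E)).trans ?_
    rw [hZD p hp v]
    exact congrArg Prod.fst (hM.structure_eq p hp v)
  have hUi : IsOpen {p ∈ U | 0 < (Z p).re - (1 - δ)} := by
    simpa only [sub_pos] using hM.isOpen_inner
  have hUa : ∀ p ∈ U, 1 - δ ≤ (Z p).re := fun p hp => (hM.mapsTo hp).1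
  have hZU : ContinuousOn (fun q => (Z q).re) U :=
    Complex.continuous_re.comp_continuousOn (hZ.continuousOn.mono hUO)
  -- the set where the maximum is attained
  obtain ⟨z₀, hz₀, hmax⟩ := (hUc.preimage hcu).isCompact.exists_isMaxOn hne
    (hZU.comp hcu.continuousOn fun z hz => hz)
  have hmax : ∀ w, u w ∈ U → (Z (u w)).re ≤ (Z (u z₀)).re := fun w hw => hmax hw
  set K := {w | u w ∈ U ∧ (Z (u w)).re = (Z (u z₀)).re} with hK
  have hKc : IsClosed K :=
    (hZU.preimage_isClosed_of_isClosed hUc (isClosed_singleton (x := (Z (u z₀)).re))).preimage hcu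
  have hKo : IsOpen K := by
    rw [isOpen_iff_mem_nhds]
    rintro z ⟨hzU, hzm⟩
    have hbd : z ∈ realHalfPlane.boundary S →
        (mapD I 𝓘(ℝ, ℂ) Z (u z) (curveD I u z 1)).im = 0 := fun hz => by
      rw [hZD _ hzU]
      exact hM.mapD_curveD_one_im hfF hδ hε1 hι hdim hu hN hz hzU
    have href : (Z (u z)).re = 1 - δ → ∃ κ > 0, ∀ η > 0,
        ∃ y ∈ range I ∩ Metric.ball (extChartAt I (u z) (u z)) η,
        (extChartAt I (u z)).symm y ∈ U ∧ y ≠ extChartAt I (u z) (u z) ∧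
          κ * ‖y - extChartAt I (u z) (u z)‖ ≤
            (Z ((extChartAt I (u z)).symm y)).re - (1 - δ) := by
      intro hza
      rw [← hza]
      -- Only the case `x = 1 - δ` requires a direction into `U`. Interior points of the surface
      -- avoid `∂W` by now, so `f < 1/2` there and `∂_x` will do. Boundary points lie on `N_mod`,
      -- and `x = 1 - δ < 1` forces `r > 0`, so `r` can be decreased.
      by_cases hz : z ∈ realHalfPlane.interior S
      · refine hM.exists_linear_growth hzU (C := 0)
          (eventually_ray_mem_of_lt hfF (hM.mapsTo hzU) (lt_of_le_of_ne (hM.mapsTo hzU).2.2 ?_))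
        exact fun h => hint ⟨z, hz, (hM.boundary_iff _ hzU).2 h⟩
      · have hz : z ∈ realHalfPlane.boundary S := by
          rw [← realHalfPlane.compl_interior]
          exact hz
        obtain ⟨b, hb0, hbε, hcb⟩ := exists_eq_modelParam ((hM.submanifold_iff _ hzU).1 (hN z hz))
        have hbs : Real.sqrt (1 - b.2.1 ^ 2) = 1 - δ := by
          rw [← hza]
          simp [hZdef, hcb, modelParam]
        have hbpos : 0 < b.2.1 := by
          refine lt_of_le_of_ne hb0 fun h => ?_
          rw [← h] at hbs
          rw [zero_pow two_ne_zero, sub_zero, Real.sqrt_one] at hbs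
          linarith
        refine hM.exists_linear_growth hzU (C := 2 / b.2.1) ?_
        rw [hcb]
        exact eventually_ray_mem_of_modelParam hfF hbpos (hbε.le.trans hε1) hbs.ge
    obtain ⟨V, R, hR, hsub⟩ := hu.exists_isChartRadius_of_max hJ hO hZ hUO hUc hol hUi hzU
      (hUa _ hzU) href (fun w hw => (hmax w hw).trans hzm.ge) hbd
    rw [hzm] at hsub
    exact hR.mem_nhds_of_isClosed hKc hsub
  have hKu : K = univ := IsClopen.eq_univ ⟨hKc, hKo⟩ ⟨z₀, hz₀, rfl⟩
  have hall : ∀ z, u z ∈ U := fun z => (hKu ▸ mem_univ z : z ∈ K).1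
  have hcu' : IsJHolomorphic (modelJ JF) (c ∘ u) :=
    hu.comp (fun z => hM.contMDiffAt (hall z)) fun z => hM.structure_eq _ (hall z)
  obtain ⟨p, hp⟩ := exists_eq_of_mem_modelU hJF hfF hε1 hδ1 hpsh hcu'
    (fun z => hM.mapsTo (hall z))
    (fun z hz => (hM.submanifold_iff _ (hall z)).1 (hN z hz))
  exact ⟨u z₀, fun z => hM.injOn (hall z) (hall z₀) ((hp z).trans (hp z₀).symm)⟩

end MeetingCurves

end CodimOneModel
-- The theorem
theorem mainTheorem9 {n : ℕ} {F : Type*} [TopologicalSpace F] [T2Space F] [CompactSpace F]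
    [ChartedSpace (EuclideanSpace ℝ (Fin n)) F] [IsManifold (𝓡 n) ∞ F]
    (JF : CodimOneModel.EndField (CodimOneModel.cotI n) (X := CodimOneModel.Cotangent n F))
    (hJF : CodimOneModel.IsAlmostComplex JF)
    (hreal : CodimOneModel.ZeroSectionTotallyReal JF)
    (fF : CodimOneModel.Cotangent n F → ℝ) (hfF : CodimOneModel.IsFiberFunction JF fF)
    (ε : ℝ) (hε : 0 < ε) (hε1 : ε ≤ 1) :
    ∃ δ₀ > 0, ∀ δ : ℝ, 0 < δ → δ < δ₀ →
      -- curves inside the model neighbourhood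
      (∀ (S : Type*) [TopologicalSpace S] [T2Space S] [CompactSpace S] [ConnectedSpace S]
        [ChartedSpace CodimOneModel.ClosedHalfPlane S]
        [IsManifold CodimOneModel.complexHalfPlane ∞ S]
        (u : S → CodimOneModel.ModelSpace n F),
        CodimOneModel.IsJHolomorphic (CodimOneModel.modelJ JF) u →
        (∀ z, u z ∈ CodimOneModel.modelU fF δ) →
        (∀ z ∈ CodimOneModel.realHalfPlane.boundary S, u z ∈ CodimOneModel.modelN n F ε) →
        ∃ p, ∀ z, u z = p) ∧
      -- curves in an almost complex manifold that contains the model neighbourhood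
      (∀ (W : Type*) [TopologicalSpace W] [T2Space W] [CompactSpace W]
        [ChartedSpace (EuclideanHalfSpace (2 * n + 4)) W] [IsManifold (𝓡∂ (2 * n + 4)) ∞ W]
        (J : CodimOneModel.EndField (𝓡∂ (2 * n + 4)) (X := W))
        (N : Type*) [TopologicalSpace N] [ChartedSpace (EuclideanHalfSpace (n + 2)) N]
        [IsManifold (𝓡∂ (n + 2)) ∞ N] (ι : N → W)
        (U : Set W) (c : W → CodimOneModel.ModelSpace n F)
        (S : Type*) [TopologicalSpace S] [T2Space S] [CompactSpace S] [ConnectedSpace S]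
        [ChartedSpace CodimOneModel.ClosedHalfPlane S]
        [IsManifold CodimOneModel.complexHalfPlane ∞ S] (u : S → W),
        CodimOneModel.IsAlmostComplex J →
        CodimOneModel.HasConvexBoundary J →
        CodimOneModel.IsEmbeddedSubmanifold (𝓡∂ (n + 2)) (𝓡∂ (2 * n + 4)) ι →
        range ι ⊆ (𝓡∂ (2 * n + 4)).boundary W →
        CodimOneModel.IsModelNeighborhood JF fF ε δ J (range ι) U c →
        CodimOneModel.IsJHolomorphic J u →
        (∀ z ∈ CodimOneModel.realHalfPlane.boundary S, u z ∈ range ι) →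
        (∃ z, u z ∈ U) →
        ∃ p, ∀ z, u z = p) := by 
  obtain ⟨δ₁, hδ₁, hpsh⟩ := hfF.exists_plurisubharmonic
  -- `δ ≤ 1` gives `x ≥ 0`, hence `f_F ≤ δ` on the model neighbourhood, and `δ ≤ δ₁` makes `f_F`
  -- plurisubharmonic there.
  refine ⟨min 1 δ₁, lt_min one_pos hδ₁, fun δ hδ hδ₀ => ⟨?_, ?_⟩⟩
  · intro S _ _ _ _ _ _ u hu hU hN
    exact CodimOneModel.exists_eq_of_mem_modelU hJF hfF hε1 (hδ₀.le.trans (min_le_left _ _))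
      (fun ξ hξ => hpsh ξ (hξ.trans (hδ₀.le.trans (min_le_right _ _)))) hu hU hN
  · intro W _ _ _ _ _ J N _ _ _ ι U c S _ _ _ _ _ _ u hJ hconv hι _ hM hu hN hne
    exact hM.exists_eq_of_mem hJF hfF hε1 hδ (hδ₀.le.trans (min_le_left _ _))
      (fun ξ hξ => hpsh ξ (hξ.trans (hδ₀.le.trans (min_le_right _ _)))) hJ hconv hι (by simp)
      hu hN hne
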